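/- **Setting.** For a finite $R\subset\mathbb Z^2$, let $\phi^1_{R,p,q}$ be the random-cluster measure with wired boundary conditions: a configuration $\omega\in\{0,1\}^{E(R)}$ has probability proportional to $q^{k^1(\omega)}\prod_{e}p^{\omega(e)}(1-p)^{1-\omega(e)}$, where $k^1(\omega)$ is the number of clusters when all vertices of $R$ with a neighbour outside $R$ are identified. A dual edge is dual-open when the edge of $R$ that it crosses is closed. For $n\ge1$ let $S_n=\mathbb Z\times\{0,\dots,n\}$ and $$\partial^-S_n=\{(x,y):y\in\{0,n\},x<0\},\quad \partial^+S_n=\{(x,y):y\in\{0,n\},x\ge0\},\quad \partial^-_bS_n=\{(x,0):x<0\}.$$ Let $\mathcal S$ be the random set of vertices that are not joined to $\partial^+S_n$ by an open path, and let $P^*$ be the left-most dual-open path from $(-\tfrac12,-\tfrac12)$ to $(-\tfrac12,n+\tfrac12)$. For a vertex $x$, $x\overset{*}{\leftrightarrow}P^*$ is the event that $P^*$ exists and that one of the four faces around $x$ is joined to $P^*$ by a dual-open path. Probabilities $\phi^1_{S_n,p,q}[\,\cdot\,]$ and $\phi^1_{S_n,p,q}[\,\cdot\mid\mathcal S=S]$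 are limits, as $m\to\infty$, of the corresponding probabilities in the rectangles $R_m=[-m,m]\times[0,n]$, where $\mathcal S=S$ means that $\mathcal S$, computed in $R_m$, equals $S\cap R_m$, and conditional probabilities are taken along those $m$ for which this event is non-empty. For $S\subset S_n$ let $\Delta S=\{\{x,y\}\in E(S_n):x\in S,\,y\notin S\}$ and $$\overline\varphi_{p,q,n}(S)=\sum_{\{x,y\}\in\Delta S}\phi^1_{S_n,p,q}\bigl[\partial^-S_n\underset{S}{\longleftrightarrow}x\bigm|\mathcal S=S\bigr]\in[0,\infty],$$ where the connection uses only open edges with both ends in $S$. **Lemma.** Let $1\le q\le4$ and $p_{sd}=\frac{\sqrt q}{1+\sqrt q}$. There is a constant $c=c(q)>0$ such that for every $p\in[p_{sd},1)$, every $n\ge1$ and every $S\subset S_n$ with $\partial^-S_n\subset S$ and $S\cap\partial^+S_n=\emptyset$ for which the event $\mathcal S=S$ is non-empty in $R_m$ for infinitely many $m$, $$\overline\varphi_{p,q,n}(S)\ \ge\ c\sum_{x\in\partial^-_bS_n}\phi^1_{S_n,p,q}\bigl[x\overset{*}{\longleftrightarrow}P^*\bigm|\mathcal S=S\bigr] \quad\text{and}\quad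 \overline\varphi_{p,q,n}(S)\ \ge\ c\sum_{x\in\partial^-_bS_n}\phi^1_{S_n,p,q}\bigl[x\overset{*}{\longleftrightarrow}P^*\bigr].$$ (Where a limit over $m$ is not known to exist, the lower limit is meant in $\overline\varphi$ and the upper limit in the right-hand sides.) -/

import Mathlib

open Filter
open scoped NNReal ENNReal

noncomputable section

namespace FKStrip

/-- The square lattice `ℤ²`: two points are adjacent when they are at Euclidean distance one. -/
def lattice : SimpleGraph (ℤ × ℤ) where
  Adj u v := |u.1 - v.1| + |u.2 - v.2| = 1
  symm := ⟨fun u v h => by rw [abs_sub_comm v.1, abs_sub_comm v.2]; exact h⟩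
  loopless := ⟨fun u h => by simp at h⟩

/-! ### The random-cluster measure with wired boundary conditions on a finite subgraph -/

open Classical in
/-- The edges of `ℤ²` with both ends in the finite set `R`. -/
def edges (R : Finset (ℤ × ℤ)) : Finset (Sym2 (ℤ × ℤ)) :=
  R.sym2.filter (fun e => e ∈ lattice.edgeSet)

/-- The boundary vertices of `R`: those with a neighbour in `ℤ²` outside `R`. -/
def bdry (R : Finset (ℤ × ℤ)) : Set (ℤ × ℤ) :=
  {v | v ∈ R ∧ ∃ u, lattice.Adj v u ∧ u ∉ R}

/-- The graph on `R` whose edges are the open edges of `ω`, all boundary vertices of `R` being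
moreover joined to each other. A configuration is identified with its set `ω` of open edges. -/
def wiredGraph (R : Finset (ℤ × ℤ)) (ω : Finset (Sym2 (ℤ × ℤ))) : SimpleGraph R :=
  SimpleGraph.fromRel (fun u v =>
    s((u : ℤ × ℤ), (v : ℤ × ℤ)) ∈ ω ∨ ((u : ℤ × ℤ) ∈ bdry R ∧ (v : ℤ × ℤ) ∈ bdry R))

/-- `k¹(ω)`: the number of clusters of `ω`, all those touching the boundary being counted as one. -/
def numClusters (R : Finset (ℤ × ℤ)) (ω : Finset (Sym2 (ℤ × ℤ))) : ℕ :=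
  Nat.card (wiredGraph R ω).ConnectedComponent

/-- The weight `q^{k¹(ω)} p^{#open} (1-p)^{#closed}`. -/
def weight (R : Finset (ℤ × ℤ)) (p q : ℝ) (ω : Finset (Sym2 (ℤ × ℤ))) : ℝ :=
  q ^ numClusters R ω * (p ^ ω.card * (1 - p) ^ ((edges R).card - ω.card))

open Classical in
/-- The probability `φ¹_{R,p,q}[A]`. -/
def prob (R : Finset (ℤ × ℤ)) (p q : ℝ) (A : Set (Finset (Sym2 (ℤ × ℤ)))) : ℝ :=
  (∑ ω ∈ (edges R).powerset with ω ∈ A, weight R p q ω) / ∑ ω ∈ (edges R).powerset, weight R p q ω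

/-- The conditional probability `φ¹_{R,p,q}[A | C]`. -/
def condProb (R : Finset (ℤ × ℤ)) (p q : ℝ) (A C : Set (Finset (Sym2 (ℤ × ℤ)))) : ℝ :=
  prob R p q (A ∩ C) / prob R p q C

/-! ### Connections and dual connections -/

/-- `u` and `v` are joined by a path of edges that are open in `ω` and have both ends in `A`. -/
def ConnIn (ω : Finset (Sym2 (ℤ × ℤ))) (A : Set (ℤ × ℤ)) (u v : ℤ × ℤ) : Prop :=
  (SimpleGraph.fromEdgeSet {e | e ∈ ω ∧ ∀ w ∈ e, w ∈ A}).Reachable u v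

/-- A face of `ℤ²`, that is, a vertex of the dual lattice, is encoded by its lower left corner:
`f` stands for the dual vertex `f + (1/2, 1/2)`. The predicate says that `v` is one of the four
corners of `f`. -/
def IsCorner (f v : ℤ × ℤ) : Prop :=
  (v.1 = f.1 ∨ v.1 = f.1 + 1) ∧ (v.2 = f.2 ∨ v.2 = f.2 + 1)

/-- The graph of dual-open edges of the configuration `ω` on `R`: two distinct faces are joined
when they share an edge of `R` and this edge is closed in `ω`. -/
def dualGraph (R : Finset (ℤ × ℤ)) (ω : Finset (Sym2 (ℤ × ℤ))) : SimpleGraph (ℤ × ℤ) :=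
  SimpleGraph.fromRel (fun f g => ∃ u v, s(u, v) ∈ edges R ∧ s(u, v) ∉ ω ∧
    IsCorner f u ∧ IsCorner f v ∧ IsCorner g u ∧ IsCorner g v)

/-! ### The strip -/

/-- The strip `S_n` of height `n`. -/
def strip (n : ℕ) : Set (ℤ × ℤ) := {v | 0 ≤ v.2 ∧ v.2 ≤ n}

/-- The right part `∂⁺S_n` of the boundary of the strip. -/
def bdryRight (n : ℕ) : Set (ℤ × ℤ) := {v | (v.2 = 0 ∨ v.2 = n) ∧ 0 ≤ v.1}

/-- The left part `∂⁻S_n` of the boundary of the strip (disjoint from the right part). -/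
def bdryLeft (n : ℕ) : Set (ℤ × ℤ) := {v | (v.2 = 0 ∨ v.2 = n) ∧ v.1 < 0}

/-- The bottom left part `∂_b⁻S_n` of the boundary of the strip. -/
def bdryBottomLeft : Set (ℤ × ℤ) := {v | v.2 = 0 ∧ v.1 < 0}

/-- The rectangle `[-m, m] × [0, n]`. -/
def rect (n m : ℕ) : Finset (ℤ × ℤ) := Finset.Icc (-(m : ℤ)) m ×ˢ Finset.Icc (0 : ℤ) n

/-- The random set `𝒮` in the rectangle: the vertices that are not joined to the right part of
the boundary of the strip by an open path. -/
def calS (n m : ℕ) (ω : Finset (Sym2 (ℤ × ℤ))) : Set (ℤ × ℤ) :=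
  {x | x ∈ rect n m ∧ ¬ ∃ y ∈ bdryRight n, y ∈ rect n m ∧ ConnIn ω (rect n m) x y}

/-- The event `𝒮 = S` in the rectangle. -/
def evS (n m : ℕ) (S : Set (ℤ × ℤ)) : Set (Finset (Sym2 (ℤ × ℤ))) :=
  {ω | calS n m ω = S ∩ rect n m}

/-- Some configuration on the rectangle satisfies `𝒮 = S`. -/
def Possible (n m : ℕ) (S : Set (ℤ × ℤ)) : Prop :=
  ∃ ω ⊆ edges (rect n m), ω ∈ evS n m S

/-- `m → ∞` along the rectangles on which the event `𝒮 = S` is not empty. -/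
def rectFilter (n : ℕ) (S : Set (ℤ × ℤ)) : Filter ℕ := atTop ⊓ 𝓟 {m | Possible n m S}

/-- The event, in the rectangle, that `x` is joined to `∂⁻S_n` inside `S`. -/
def evConn (n m : ℕ) (S : Set (ℤ × ℤ)) (x : ℤ × ℤ) : Set (Finset (Sym2 (ℤ × ℤ))) :=
  {ω | ∃ y ∈ bdryLeft n, y ∈ rect n m ∧ ConnIn ω (S ∩ rect n m) y x}

/-- The event, in the rectangle, that there is a dual-open crossing `P` of the strip between
`∂⁻S_n` and `∂⁺S_n`, from the dual vertex `(-1/2, -1/2)` below the bottom side to the dual vertex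
`(-1/2, n + 1/2)` above the top side, and that one of the faces around `x` is joined to `P` by a
dual-open path. All such crossings share their ends, hence belong to one dual cluster, so that the
event is the same for every crossing `P`, in particular for the left-most one. -/
def evDual (n m : ℕ) (x : ℤ × ℤ) : Set (Finset (Sym2 (ℤ × ℤ))) :=
  {ω | ∃ P : (dualGraph (rect n m) ω).Walk (-1, -1) (-1, (n : ℤ)), P.IsPath ∧
    ∃ g ∈ P.support, ∃ f, IsCorner f x ∧ (dualGraph (rect n m) ω).Reachable f g}

/-- The edge boundary `ΔS` in the strip, each edge being listed with its end in `S` first. -/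
def edgeBdry (n : ℕ) (S : Set (ℤ × ℤ)) : Set ((ℤ × ℤ) × (ℤ × ℤ)) :=
  {e | lattice.Adj e.1 e.2 ∧ e.1 ∈ strip n ∧ e.2 ∈ strip n ∧ e.1 ∈ S ∧ e.2 ∉ S}

/-- The strip boundary-connection function
`φ̄_{p,q,n}(S) = ∑_{{x,y} ∈ ΔS} φ¹_{S_n,p,q}[∂⁻S_n ↔_S x | 𝒮 = S]`, each probability in the strip
being the (lower) limit of those in the rectangles. -/
def phiBar (p q : ℝ) (n : ℕ) (S : Set (ℤ × ℤ)) : ℝ≥0∞ :=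
  ∑' e : edgeBdry n S, liminf (fun m =>
    ENNReal.ofReal (condProb (rect n m) p q (evConn n m S e.1.1) (evS n m S))) (rectFilter n S)

/-- `φ¹_{S_n,p,q}[x *↔ P* | 𝒮 = S]` as the (upper) limit of the probabilities in the rectangles. -/
def dualConnCond (p q : ℝ) (n : ℕ) (S : Set (ℤ × ℤ)) (x : ℤ × ℤ) : ℝ≥0∞ :=
  limsup (fun m => ENNReal.ofReal (condProb (rect n m) p q (evDual n m x) (evS n m S)))
    (rectFilter n S)

/-- `φ¹_{S_n,p,q}[x *↔ P*]` (which contains the event that `P*` exists) as the (upper) limit of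
the probabilities in the rectangles. -/
def dualConn (p q : ℝ) (n : ℕ) (x : ℤ × ℤ) : ℝ≥0∞ :=
  limsup (fun m => ENNReal.ofReal (prob (rect n m) p q (evDual n m x))) atTop

end FKStrip

end

noncomputable section

namespace FKStrip

/-! ### Corners of the square lattice and the loop dynamics -/

/-! The engine is a real form of the parafermionic observable, used as an identity between boundary
probabilities of the self-dual model. Put a = √q and 2 cos θ = a; for 1 ≤ q ≤ 4 the angle θ lies in
[0, π/3]. Restrict S to a rectangle and to x ≤ M, and wire this domain along the left side of the
rectangle and the left parts of its horizontal sides. From the right end of the bottom arc, follow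
the loop that keeps the cluster of the arc on its left, with directions recorded in ℤ. It explores
the domain until it reaches the right end of the top arc, with a net turn of one quarter, and then
closes up along the outside of the arc.

Let g satisfy g(d + 1) - g(d) = cos(dθ). The increments of g along the inner part of the loop
telescope to 1. Grouped by the edge met, they behave as follows. On a free edge, the weighted
contributions of the two configurations differing only there cancel (`edgeIncr_pair`). This needs
the directions of the two visits to an edge to be tied together, which follows from every outer loop
making exactly one full left turn (`exists_returns`), and from an edge being a bridge when a closed
dual path joins its two sides (`not_reachable_of_faceConn`). An inner visit to the arc contributes
at most -cos θ ≤ -1/2, and a bottom edge receives one when the face above it is dually connected to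
the outside. An edge leaving the domain contributes at most 1, and only if its inner end is
connected to the arc. Averaging gives `IsDomain.sum_boundary`: 1 plus half the sum of the dual
connection probabilities is at most the sum of the connection probabilities along the boundary.

For p ≥ p_sd, the wired measure, conditioned on any event that ignores the edges of the domain,
dominates the self-dual measure on the domain (`SupDual.mean_le_condProb`). The event 𝒮 = S is of
this kind, and so is the sure event, so the same relation yields both inequalities. Two errors
remain: connections across x = M, and connections that use only the wired left side of the
rectangle. Both vanish in the limit by a map that destroys the event in many distinguishable places
(`card_mul_mean_le`). Moving the left side makes the self-dual probabilities monotone in m, which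
allows m → ∞ and then M → ∞ (`exists_limits`, `SupDual.tsum_le`).

This requires S to contain every column far to the left. If infinitely many columns are incomplete,
each one supplies a boundary edge whose probability is bounded below, and the left-hand side is
infinite (`SupDual.phiBar_eq_top`). -/

/-- The unit vector in direction `d` modulo four: east, north, west, south. -/
def dir (d : ℤ) : ℤ × ℤ :=
  if d % 4 = 0 then (1, 0) else if d % 4 = 1 then (0, 1) else if d % 4 = 2 then (-1, 0) else (0, -1)

/-- The displacement from a vertex to the face preceding the edge in direction `d`, in
counterclockwise order. -/
def off (d : ℤ) : ℤ × ℤ :=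
  if d % 4 = 0 then (0, -1) else if d % 4 = 1 then (0, 0) else if d % 4 = 2 then (-1, 0)
  else (-1, -1)

theorem dir_eq {d : ℤ} :
    (d % 4 = 0 ∧ dir d = (1, 0) ∧ off d = (0, -1)) ∨ (d % 4 = 1 ∧ dir d = (0, 1) ∧ off d = (0, 0)) ∨
    (d % 4 = 2 ∧ dir d = (-1, 0) ∧ off d = (-1, 0)) ∨
    (d % 4 = 3 ∧ dir d = (0, -1) ∧ off d = (-1, -1)) := by
  have h : d % 4 = 0 ∨ d % 4 = 1 ∨ d % 4 = 2 ∨ d % 4 = 3 := by omega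
  rcases h with h | h | h | h <;> simp [dir, off, h]

theorem dir_congr {d d' : ℤ} (h : d % 4 = d' % 4) : dir d = dir d' := by simp [dir, h]

theorem off_congr {d d' : ℤ} (h : d % 4 = d' % 4) : off d = off d' := by simp [off, h]

theorem dir_inj {d d' : ℤ} : dir d = dir d' ↔ d % 4 = d' % 4 := by
  refine ⟨fun h => ?_, dir_congr⟩
  rcases @dir_eq d with ⟨h1, h2, -⟩ | ⟨h1, h2, -⟩ | ⟨h1, h2, -⟩ | ⟨h1, h2, -⟩ <;>
  rcases @dir_eq d' with ⟨k1, k2, -⟩ | ⟨k1, k2, -⟩ | ⟨k1, k2, -⟩ | ⟨k1, k2, -⟩ <;>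
  rw [h2, k2] at h <;> first | omega | simp at h

theorem dir_ne_zero (d : ℤ) : dir d ≠ 0 := by
  rcases @dir_eq d with ⟨-, h, -⟩ | ⟨-, h, -⟩ | ⟨-, h, -⟩ | ⟨-, h, -⟩ <;> simp [h]

theorem dir_add_two (d : ℤ) : dir (d + 2) = -dir d := by
  rcases @dir_eq d with ⟨h1, h2, -⟩ | ⟨h1, h2, -⟩ | ⟨h1, h2, -⟩ | ⟨h1, h2, -⟩ <;>
  rcases @dir_eq (d + 2) with ⟨k1, k2, -⟩ | ⟨k1, k2, -⟩ | ⟨k1, k2, -⟩ | ⟨k1, k2, -⟩ <;>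
  first | omega | simp [h2, k2]

theorem dir_add_off (d : ℤ) : dir d + off (d - 1) = off d := by
  rcases @dir_eq d with ⟨h1, h2, h3⟩ | ⟨h1, h2, h3⟩ | ⟨h1, h2, h3⟩ | ⟨h1, h2, h3⟩ <;>
  rcases @dir_eq (d - 1) with ⟨k1, -, k3⟩ | ⟨k1, -, k3⟩ | ⟨k1, -, k3⟩ | ⟨k1, -, k3⟩ <;>
  first | omega | simp [h2, h3, k3]

theorem dir_add_off_add_two (d : ℤ) : dir d + off (d + 2) = off (d + 1) := by
  rcases @dir_eq d with ⟨h1, h2, h3⟩ | ⟨h1, h2, h3⟩ | ⟨h1, h2, h3⟩ | ⟨h1, h2, h3⟩ <;>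
  rcases @dir_eq (d + 1) with ⟨l1, -, l3⟩ | ⟨l1, -, l3⟩ | ⟨l1, -, l3⟩ | ⟨l1, -, l3⟩ <;>
  rcases @dir_eq (d + 2) with ⟨k1, -, k3⟩ | ⟨k1, -, k3⟩ | ⟨k1, -, k3⟩ | ⟨k1, -, k3⟩ <;>
  first | omega | simp [h2, l3, k3]

/-- A corner `(v, d)`: a vertex with a direction lifted from `ℤ/4` to `ℤ`. -/
abbrev Corner := (ℤ × ℤ) × ℤ

/-- The edge which the loop through the corner meets next. -/
def edge (s : Corner) : Sym2 (ℤ × ℤ) := s(s.1, s.1 + dir s.2)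

/-- The face of a corner. -/
def face (s : Corner) : ℤ × ℤ := s.1 + off s.2

/-- The corner `s` with its direction turned by `k` full turns. -/
def shift (k : ℤ) (s : Corner) : Corner := (s.1, s.2 + 4 * k)

@[simp] theorem edge_shift (k : ℤ) (s : Corner) : edge (shift k s) = edge s := by
  simp [edge, shift, dir_congr (show (s.2 + 4 * k) % 4 = s.2 % 4 by omega)]

@[simp] theorem face_shift (k : ℤ) (s : Corner) : face (shift k s) = face s := by
  simp [face, shift, off_congr (show (s.2 + 4 * k) % 4 = s.2 % 4 by omega)]

@[simp] theorem shift_shift (k l : ℤ) (s : Corner) : shift k (shift l s) = shift (k + l) s := by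
  simp [shift]; ring

@[simp] theorem shift_zero (s : Corner) : shift 0 s = s := by simp [shift]

theorem shift_injective (k : ℤ) : Function.Injective (shift k) := by
  intro s t h
  simp only [shift, Prod.mk.injEq] at h
  exact Prod.ext h.1 (by omega)

/-- The other corner at which a loop meets the same edge (on the other side). -/
def opp (s : Corner) : Corner := (s.1 + dir s.2, s.2 + 2)

/-- An edge can be met from its two sides only, so all visits to it are classified by a side and a
number of full turns. -/
theorem edge_eq_iff {s t : Corner} :
    edge s = edge t ↔ (∃ k, s = shift k t) ∨ ∃ k, s = shift k (opp t) := by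
  obtain ⟨v, d⟩ := s
  obtain ⟨u, c⟩ := t
  simp only [edge, shift, opp, Sym2.eq_iff, Prod.mk.injEq]
  constructor
  · rintro (⟨rfl, h⟩ | ⟨rfl, h⟩)
    · have := dir_inj.1 (add_left_cancel h)
      exact Or.inl ⟨(d - c) / 4, rfl, by omega⟩
    · have h2 : dir d = dir (c + 2) := by
        rw [dir_add_two]
        have : u + (dir c + dir d) = u + 0 := by rw [← add_assoc, h, add_zero]
        exact eq_neg_of_add_eq_zero_right (add_left_cancel this)
      have := dir_inj.1 h2
      exact Or.inr ⟨(d - (c + 2)) / 4, rfl, by omega⟩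
  · rintro (⟨k, rfl, rfl⟩ | ⟨k, rfl, rfl⟩)
    · exact Or.inl ⟨rfl, by rw [dir_congr (show (c + 4 * k) % 4 = c % 4 by omega)]⟩
    · right
      refine ⟨rfl, ?_⟩
      rw [dir_congr (show (c + 2 + 4 * k) % 4 = (c + 2) % 4 by omega), dir_add_two]
      simp

theorem edge_opp (s : Corner) : edge (opp s) = edge s :=
  edge_eq_iff.2 (Or.inr ⟨0, by simp⟩)

theorem opp_opp (s : Corner) : opp (opp s) = shift 1 s := by
  obtain ⟨v, d⟩ := s
  simp only [opp, shift, dir_add_two, Prod.mk.injEq]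
  constructor
  · simp
  · ring

theorem opp_ne_shift (s : Corner) (k : ℤ) : opp s ≠ shift k s := by
  intro h
  have := congrArg Prod.fst h
  simp only [opp, shift, add_eq_left] at this
  exact dir_ne_zero _ this

/-- The face on the other side of the edge met at `s`. -/
theorem face_opp (s : Corner) : face (opp s) = face (s.1, s.2 + 1) := by
  simp only [face, opp, add_assoc, dir_add_off_add_two]

/-- The loop dynamics: turn right along an open edge, turn left at a closed edge. -/
def step (ω : Finset (Sym2 (ℤ × ℤ))) (s : Corner) : Corner :=
  if edge s ∈ ω then (s.1 + dir s.2, s.2 - 1) else (s.1, s.2 + 1)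

theorem step_open {ω : Finset (Sym2 (ℤ × ℤ))} {s : Corner} (h : edge s ∈ ω) :
    step ω s = (s.1 + dir s.2, s.2 - 1) := if_pos h

theorem step_closed {ω : Finset (Sym2 (ℤ × ℤ))} {s : Corner} (h : edge s ∉ ω) :
    step ω s = (s.1, s.2 + 1) := if_neg h

theorem step_shift (ω : Finset (Sym2 (ℤ × ℤ))) (k : ℤ) (s : Corner) :
    step ω (shift k s) = shift k (step ω s) := by
  unfold step
  rw [edge_shift]
  split_ifs with h
  · simp only [shift, dir_congr (show (s.2 + 4 * k) % 4 = s.2 % 4 by omega), Prod.mk.injEq, true_and]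
    ring
  · simp only [shift, Prod.mk.injEq, true_and]
    ring

theorem iterate_step_shift (ω : Finset (Sym2 (ℤ × ℤ))) (k : ℤ) (s : Corner) (i : ℕ) :
    (step ω)^[i] (shift k s) = shift k ((step ω)^[i] s) := by
  induction i with
  | zero => rfl
  | succ i ih => rw [Function.iterate_succ_apply', Function.iterate_succ_apply', ih, step_shift]

/-- The edge met before arriving at a corner. -/
theorem edge_step_pred (ω : Finset (Sym2 (ℤ × ℤ))) (s : Corner) :
    edge ((step ω s).1, (step ω s).2 - 1) = edge s := by
  unfold step
  split_ifs with h
  · refine edge_eq_iff.2 (Or.inr ⟨-1, ?_⟩)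
    simp only [shift, opp, Prod.mk.injEq, true_and]; ring
  · simp

/-- The arrival corner determines the edge just met; the state of that edge then tells which of the
two moves to undo. -/
theorem step_injective (ω : Finset (Sym2 (ℤ × ℤ))) : Function.Injective (step ω) := by
  intro s t h
  have he : edge s = edge t := by rw [← edge_step_pred ω s, ← edge_step_pred ω t, h]
  unfold step at h
  rw [he] at h
  split_ifs at h with h1
  · simp only [Prod.mk.injEq] at h
    have h2 : s.2 = t.2 := by omega
    refine Prod.ext ?_ h2
    have := h.1
    rw [h2] at this
    exact add_right_cancel this
  · simp only [Prod.mk.injEq] at h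
    exact Prod.ext h.1 (by omega)

theorem face_step_open {ω : Finset (Sym2 (ℤ × ℤ))} {s : Corner} (h : edge s ∈ ω) :
    face (step ω s) = face s := by
  rw [step_open h]
  simp only [face, add_assoc, dir_add_off]

/-- With one edge closed or opened, the dynamics changes by exchanging two corners. -/
theorem step_insert_eq {ω ω' : Finset (Sym2 (ℤ × ℤ))} {s : Corner} (h : edge s ∈ ω)
    (h' : edge s ∉ ω') : step ω s = shift (-1) (step ω' (opp s)) := by
  rw [step_open h, step_closed (by rwa [edge_opp])]
  simp only [shift, opp, Prod.mk.injEq, true_and]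
  ring

theorem step_erase_eq {ω ω' : Finset (Sym2 (ℤ × ℤ))} {s : Corner} (h : edge s ∉ ω)
    (h' : edge s ∈ ω') : step ω s = step ω' (opp s) := by
  rw [step_closed h, step_open (by rwa [edge_opp])]
  simp only [opp, dir_add_two, Prod.mk.injEq]
  constructor
  · simp
  · ring

/-! ### Connections along the loop -/

/-- The graph of open edges. -/
def openGraph (ω : Finset (Sym2 (ℤ × ℤ))) : SimpleGraph (ℤ × ℤ) := SimpleGraph.fromEdgeSet ↑ω

theorem openGraph_mono {ω ω' : Finset (Sym2 (ℤ × ℤ))} (h : ω ⊆ ω') : openGraph ω ≤ openGraph ω' :=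
  SimpleGraph.fromEdgeSet_mono (by exact_mod_cast h)

theorem openGraph_adj_of_edge {ω : Finset (Sym2 (ℤ × ℤ))} {s : Corner} (h : edge s ∈ ω) :
    (openGraph ω).Adj s.1 (s.1 + dir s.2) := by
  rw [openGraph, SimpleGraph.fromEdgeSet_adj]
  exact ⟨h, fun h => dir_ne_zero s.2 (by simpa using h.symm)⟩

theorem reachable_step (ω : Finset (Sym2 (ℤ × ℤ))) (s : Corner) :
    (openGraph ω).Reachable s.1 (step ω s).1 := by
  by_cases h : edge s ∈ ω
  · rw [step_open h]
    exact (openGraph_adj_of_edge h).reachable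
  · rw [step_closed h]

theorem reachable_iterate (ω : Finset (Sym2 (ℤ × ℤ))) (s : Corner) (i : ℕ) :
    (openGraph ω).Reachable s.1 ((step ω)^[i] s).1 := by
  induction i with
  | zero => exact SimpleGraph.Reachable.refl _
  | succ i ih =>
    rw [Function.iterate_succ_apply']
    exact ih.trans (reachable_step _ _)

/-- Adjacency of faces across a closed edge. -/
def FaceAdj (ω : Finset (Sym2 (ℤ × ℤ))) (f g : ℤ × ℤ) : Prop :=
  ∃ s : Corner, edge s ∉ ω ∧ f = face s ∧ g = face (s.1, s.2 + 1)

theorem FaceAdj.symm {ω : Finset (Sym2 (ℤ × ℤ))} {f g : ℤ × ℤ} (h : FaceAdj ω f g) :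
    FaceAdj ω g f := by
  obtain ⟨s, h1, rfl, rfl⟩ := h
  refine ⟨opp s, by rwa [edge_opp], (face_opp s).symm, ?_⟩
  rw [← face_opp, opp_opp, face_shift]

/-- Connection of faces across closed edges. -/
def FaceConn (ω : Finset (Sym2 (ℤ × ℤ))) : ℤ × ℤ → ℤ × ℤ → Prop :=
  Relation.ReflTransGen (FaceAdj ω)

theorem FaceConn.symm {ω : Finset (Sym2 (ℤ × ℤ))} {f g : ℤ × ℤ} (h : FaceConn ω f g) :
    FaceConn ω g f := by
  induction h with
  | refl => exact Relation.ReflTransGen.refl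
  | tail _ h1 ih => exact Relation.ReflTransGen.head h1.symm ih

theorem FaceConn.trans {ω : Finset (Sym2 (ℤ × ℤ))} {f g k : ℤ × ℤ} (h : FaceConn ω f g)
    (h' : FaceConn ω g k) : FaceConn ω f k := Relation.ReflTransGen.trans h h'

theorem FaceConn.mono {ω ω' : Finset (Sym2 (ℤ × ℤ))} (hω : ω' ⊆ ω) {f g : ℤ × ℤ}
    (h : FaceConn ω f g) : FaceConn ω' f g := by
  induction h with
  | refl => exact Relation.ReflTransGen.refl
  | tail _ h1 ih =>
    obtain ⟨s, h1, h2⟩ := h1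
    exact ih.tail ⟨s, fun h => h1 (hω h), h2⟩

theorem faceConn_closed {ω : Finset (Sym2 (ℤ × ℤ))} {s : Corner} (h : edge s ∉ ω) :
    FaceConn ω (face s) (face (s.1, s.2 + 1)) :=
  Relation.ReflTransGen.single ⟨s, h, rfl, rfl⟩

theorem faceConn_step (ω : Finset (Sym2 (ℤ × ℤ))) (s : Corner) :
    FaceConn ω (face s) (face (step ω s)) := by
  by_cases h : edge s ∈ ω
  · rw [face_step_open h]
    exact Relation.ReflTransGen.refl
  · rw [step_closed h]
    exact faceConn_closed h

theorem faceConn_iterate (ω : Finset (Sym2 (ℤ × ℤ))) (s : Corner) (i : ℕ) :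
    FaceConn ω (face s) (face ((step ω)^[i] s)) := by
  induction i with
  | zero => exact Relation.ReflTransGen.refl
  | succ i ih =>
    rw [Function.iterate_succ_apply']
    exact ih.trans (faceConn_step _ _)

/-! ### A closed dual circuit separates the ends of the edge which it crosses -/

/-- Indicator of the horizontal edges `(x, y) - (x + 1, y)` above the face `f`. -/
def ray (f : ℤ × ℤ) (x y : ℤ) : ℤ := if x = f.1 ∧ f.2 < y then 1 else 0

/-- Crossing one edge moves the endpoint of a dual path, and with it the vertical branch cut above
that endpoint. The function `h` absorbs the displacement of the cut, and the crossing itself leaves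
the jump `σ`. -/
theorem exists_height_step (s : Corner) : ∃ (h : ℤ × ℤ → ℤ) (σ : ℤ), σ ≠ 0 ∧
    (∀ x y, h (x + 1, y) - h (x, y) = ray (face (s.1, s.2 + 1)) x y - ray (face s) x y +
      if edge s = s((x, y), (x + 1, y)) then σ else 0) ∧
    ∀ x y, h (x, y + 1) - h (x, y) = if edge s = s((x, y), (x, y + 1)) then σ else 0 := by
  obtain ⟨⟨a, b⟩, d⟩ := s
  rcases @dir_eq d with ⟨h1, h2, h3⟩ | ⟨h1, h2, h3⟩ | ⟨h1, h2, h3⟩ | ⟨h1, h2, h3⟩ <;>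
  rcases @dir_eq (d + 1) with ⟨k1, -, k3⟩ | ⟨k1, -, k3⟩ | ⟨k1, -, k3⟩ | ⟨k1, -, k3⟩ <;>
  first | omega | simp only [face, edge, ray, h2, h3, k3, Prod.mk_add_mk, Sym2.eq_iff,
    Prod.mk.injEq, add_zero]
  · refine ⟨fun _ => 0, 1, by norm_num, fun x y => ?_, fun x y => ?_⟩ <;>
      dsimp only <;> split_ifs <;> omega
  · refine ⟨fun v => if v.1 = a ∧ b < v.2 then 1 else 0, 1, by norm_num, fun x y => ?_,
      fun x y => ?_⟩ <;> dsimp only <;> split_ifs <;> omega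
  · refine ⟨fun _ => 0, -1, by norm_num, fun x y => ?_, fun x y => ?_⟩ <;>
      dsimp only <;> split_ifs <;> omega
  · refine ⟨fun v => if v.1 = a ∧ b - 1 < v.2 then -1 else 0, -1, by norm_num, fun x y => ?_,
      fun x y => ?_⟩ <;> dsimp only <;> split_ifs <;> omega

/-- Adding the local heights along a dual path cancels the intermediate cuts. The jumps sit on
closed edges, so open edges see only the cuts at the two ends. -/
theorem exists_height {ω : Finset (Sym2 (ℤ × ℤ))} {f g : ℤ × ℤ} (hfg : FaceConn ω f g) :
    ∃ h : ℤ × ℤ → ℤ,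
    (∀ x y, s((x, y), (x + 1, y)) ∈ ω → h (x + 1, y) - h (x, y) = ray g x y - ray f x y) ∧
    ∀ x y, s((x, y), (x, y + 1)) ∈ ω → h (x, y + 1) = h (x, y) := by
  induction hfg with
  | refl => exact ⟨fun _ => 0, by simp, by simp⟩
  | tail _ hs ih =>
    obtain ⟨h, hh, hv⟩ := ih
    obtain ⟨s, hs, rfl, rfl⟩ := hs
    obtain ⟨h', σ, -, hh', hv'⟩ := exists_height_step s
    refine ⟨fun v => h v + h' v, fun x y hxy => ?_, fun x y hxy => ?_⟩
    · have h1 := hh x y hxy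
      have h2 := hh' x y
      rw [if_neg (show edge s ≠ s((x, y), (x + 1, y)) from fun he => hs (he ▸ hxy))] at h2
      dsimp only
      linarith
    · have h1 := hv x y hxy
      have h2 := hv' x y
      rw [if_neg (show edge s ≠ s((x, y), (x, y + 1)) from fun he => hs (he ▸ hxy))] at h2
      dsimp only
      linarith

theorem lattice_edge_cases {u v : ℤ × ℤ} (h : lattice.Adj u v) :
    (∃ x y, (u = (x, y) ∧ v = (x + 1, y)) ∨ (v = (x, y) ∧ u = (x + 1, y))) ∨
    ∃ x y, (u = (x, y) ∧ v = (x, y + 1)) ∨ (v = (x, y) ∧ u = (x, y + 1)) := by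
  obtain ⟨a, b⟩ := u
  obtain ⟨c, d⟩ := v
  simp only [lattice] at h
  have : (a = c ∧ (d = b + 1 ∨ b = d + 1)) ∨ (b = d ∧ (c = a + 1 ∨ a = c + 1)) := by
    rcases abs_cases (a - c) with h1 | h1 <;> rcases abs_cases (b - d) with h2 | h2 <;> omega
  rcases this with ⟨rfl, rfl | rfl⟩ | ⟨rfl, rfl | rfl⟩
  · exact Or.inr ⟨a, b, Or.inl ⟨rfl, rfl⟩⟩
  · exact Or.inr ⟨a, d, Or.inr ⟨rfl, rfl⟩⟩
  · exact Or.inl ⟨a, b, Or.inl ⟨rfl, rfl⟩⟩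
  · exact Or.inl ⟨c, b, Or.inr ⟨rfl, rfl⟩⟩

/-- If the two sides of an open edge are joined by a dual path, then the edge is a bridge. -/
theorem not_reachable_of_faceConn {ω : Finset (Sym2 (ℤ × ℤ))}
    (hω : ∀ e ∈ ω, e ∈ lattice.edgeSet) {s : Corner} (hs : edge s ∈ ω)
    (hf : FaceConn ω (face s) (face (opp s))) :
    ¬ (openGraph (ω.erase (edge s))).Reachable s.1 (s.1 + dir s.2) := by
  rw [face_opp] at hf
  obtain ⟨h, hh, hv⟩ := exists_height hf
  obtain ⟨h', σ, hσ, hh', hv'⟩ := exists_height_step s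
  -- The path through closed edges and the direct crossing of `edge s` have the same ends, so their
  -- cuts cancel in `h' - h`. This difference is constant along every open edge except `edge s`,
  -- where it jumps by `σ`.
  have key : ∀ u v, s(u, v) ∈ ω → (s(u, v) ≠ edge s ↔ h' u - h u = h' v - h v) := by
    intro u v huv
    rcases lattice_edge_cases (hω _ huv) with
      ⟨x, y, ⟨rfl, rfl⟩ | ⟨rfl, rfl⟩⟩ | ⟨x, y, ⟨rfl, rfl⟩ | ⟨rfl, rfl⟩⟩
    · have h1 := hh x y huv
      have h2 := hh' x y
      split_ifs at h2 with he
      · simp only [he, ne_eq, not_true_eq_false, false_iff]; omega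
      · simp only [ne_eq, Ne.symm he, not_false_eq_true, true_iff]; omega
    · rw [Sym2.eq_swap] at huv ⊢
      have h1 := hh x y huv
      have h2 := hh' x y
      split_ifs at h2 with he
      · simp only [he, ne_eq, not_true_eq_false, false_iff]; omega
      · simp only [ne_eq, Ne.symm he, not_false_eq_true, true_iff]; omega
    · have h1 := hv x y huv
      have h2 := hv' x y
      split_ifs at h2 with he
      · simp only [he, ne_eq, not_true_eq_false, false_iff]; omega
      · simp only [ne_eq, Ne.symm he, not_false_eq_true, true_iff]; omega
    · rw [Sym2.eq_swap] at huv ⊢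
      have h1 := hv x y huv
      have h2 := hv' x y
      split_ifs at h2 with he
      · simp only [he, ne_eq, not_true_eq_false, false_iff]; omega
      · simp only [ne_eq, Ne.symm he, not_false_eq_true, true_iff]; omega
  intro hr
  have hconst : ∀ v, (openGraph (ω.erase (edge s))).Reachable s.1 v →
      h' s.1 - h s.1 = h' v - h v := by
    intro v hv
    rw [SimpleGraph.reachable_iff_reflTransGen] at hv
    induction hv with
    | refl => rfl
    | tail _ hbc ih =>
      rw [openGraph, SimpleGraph.fromEdgeSet_adj] at hbc
      have := hbc.1
      simp only [Finset.coe_erase, Set.mem_sdiff, Finset.mem_coe, Set.mem_singleton_iff] at this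
      rw [ih]
      exact (key _ _ this.1).1 this.2
  exact (key _ _ hs).2 (hconst _ hr) rfl

/-! ### The turning number of outer loops -/

/-- The loop through `s` closes up for the first time after `N` steps, with one full left turn. -/
def Returns (ω : Finset (Sym2 (ℤ × ℤ))) (s : Corner) (N : ℕ) : Prop :=
  0 < N ∧ (step ω)^[N] s = shift 1 s ∧ ∀ i, 0 < i → i < N → ∀ k, (step ω)^[i] s ≠ shift k s

theorem returns_iterate {ω : Finset (Sym2 (ℤ × ℤ))} {s : Corner} {N i : ℕ}
    (h : Returns ω ((step ω)^[i] s) N) : Returns ω s N := by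
  obtain ⟨h0, h1, h2⟩ := h
  refine ⟨h0, ?_, fun j hj hjN k hk => h2 j hj hjN k ?_⟩
  · apply (step_injective ω).iterate i
    rw [iterate_step_shift, ← h1, ← Function.iterate_add_apply, ← Function.iterate_add_apply,
      add_comm]
  · rw [← iterate_step_shift, ← hk, ← Function.iterate_add_apply, ← Function.iterate_add_apply,
      add_comm]

theorem iterate_step_turn {ω : Finset (Sym2 (ℤ × ℤ))} {s : Corner} {i : ℕ}
    (h : ∀ j < i, edge (s.1, s.2 + j) ∉ ω) : (step ω)^[i] s = (s.1, s.2 + i) := by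
  induction i with
  | zero => simp
  | succ i ih =>
    rw [Function.iterate_succ_apply', ih fun j hj => h j (by omega), step_closed (h i (by omega))]
    simp [add_assoc]

/-- Two loops that coincide after their first step stay together as long as the configurations agree
at the edges met. -/
theorem iterate_step_agree {ω ω' : Finset (Sym2 (ℤ × ℤ))} {a b : Corner} {N : ℕ}
    (hab : step ω a = step ω' b)
    (h : ∀ i, 0 < i → i < N → (edge ((step ω')^[i] b) ∈ ω ↔ edge ((step ω')^[i] b) ∈ ω'))
    {i : ℕ} (hi : 0 < i) (hiN : i ≤ N) : (step ω)^[i] a = (step ω')^[i] b := by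
  induction i with
  | zero => omega
  | succ i ih =>
    rcases Nat.eq_zero_or_pos i with rfl | hi0
    · simpa using hab
    · rw [Function.iterate_succ_apply', Function.iterate_succ_apply', ih hi0 (by omega)]
      simp only [step, h i hi0 (by omega)]

theorem edge_mem_lattice (s : Corner) : edge s ∈ lattice.edgeSet := by
  obtain ⟨⟨a, b⟩, d⟩ := s
  rw [edge, SimpleGraph.mem_edgeSet]
  rcases @dir_eq d with ⟨-, h, -⟩ | ⟨-, h, -⟩ | ⟨-, h, -⟩ | ⟨-, h, -⟩ <;> simp [h, lattice]

/-- All faces are joined to `f` or have no closed edge. -/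
def Filled (ω : Finset (Sym2 (ℤ × ℤ))) (f : ℤ × ℤ) : Prop :=
  ∀ s, FaceConn ω (face s) f ∨ edge s ∈ ω

theorem mem_erase_edge_iff {ω : Finset (Sym2 (ℤ × ℤ))} {s x : Corner}
    (h1 : ∀ k, x ≠ shift k s) (h2 : ∀ k, x ≠ shift k (opp s)) :
    edge x ∈ ω ↔ edge x ∈ ω.erase (edge s) := by
  rw [Finset.mem_erase]
  refine ⟨fun h => ⟨fun he => ?_, h⟩, fun h => h.2⟩
  rcases edge_eq_iff.1 he with ⟨k, hk⟩ | ⟨k, hk⟩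
  exacts [h1 k hk, h2 k hk]

/-- Here the edge is a bridge. Closing it separates two clusters, whose loops never meet the other
side of the edge. With the edge open, the loop runs once around the second cluster, crosses back,
and runs once around the first. The full turn gained by the second excursion is compensated by the
lift -1 in `t`. -/
theorem returns_merge {ω : Finset (Sym2 (ℤ × ℤ))} (hω : ∀ e ∈ ω, e ∈ lattice.edgeSet)
    {s : Corner} (hs : edge s ∈ ω) (hf : FaceConn ω (face s) (face (opp s))) {N₁ N₂ : ℕ}
    (h₁ : Returns (ω.erase (edge s)) s N₁)
    (h₂ : Returns (ω.erase (edge s)) (shift (-1) (opp s)) N₂) : Returns ω s (N₂ + N₁) := by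
  set ω' := ω.erase (edge s) with hω'
  set t := shift (-1) (opp s) with ht
  have hnr := not_reachable_of_faceConn hω hs hf
  have hs' : edge s ∉ ω' := by simp [hω']
  have hnt : ∀ i k, (step ω')^[i] t ≠ shift k s := by
    intro i k h
    apply hnr
    have := reachable_iterate ω' t i
    rw [h] at this
    exact this.symm
  have hns : ∀ i k, (step ω')^[i] s ≠ shift k (opp s) := by
    intro i k h
    apply hnr
    have := reachable_iterate ω' s i
    rw [h] at this
    exact this
  have hT : step ω s = step ω' t := by rw [step_insert_eq hs hs', ht, step_shift]
  have hT2 : step ω (opp s) = step ω' s := by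
    rw [step_insert_eq (ω' := ω') (by rwa [edge_opp]) (by rwa [edge_opp]), opp_opp, step_shift]
    simp
  have ha : ∀ i, 0 < i → i ≤ N₂ → (step ω)^[i] s = (step ω')^[i] t := by
    intro i
    refine iterate_step_agree hT fun j hj hjN => mem_erase_edge_iff (hnt j) fun k hk => ?_
    exact h₂.2.2 j hj hjN (k + 1) (by rw [hk, ht]; simp)
  have hN : (step ω)^[N₂] s = opp s := by
    rw [ha N₂ h₂.1 le_rfl, h₂.2.1, ht]
    simp
  have hb : ∀ i, 0 < i → i ≤ N₁ → (step ω)^[N₂ + i] s = (step ω')^[i] s := by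
    intro i hi hiN
    rw [add_comm, Function.iterate_add_apply, hN]
    exact iterate_step_agree hT2 (fun j hj hjN => mem_erase_edge_iff (h₁.2.2 j hj hjN) (hns j))
      hi hiN
  refine ⟨by have := h₁.1; omega, by rw [hb N₁ h₁.1 le_rfl, h₁.2.1], fun i hi hiN k => ?_⟩
  by_cases hle : i ≤ N₂
  · rw [ha i hi hle]
    exact hnt i k
  · obtain ⟨j, rfl⟩ : ∃ j, i = N₂ + j := ⟨i - N₂, by omega⟩
    rw [hb j (by omega) (by omega)]
    exact h₁.2.2 j (by omega) (by omega) k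

/-- Here the face beyond the edge has only open edges. Closing the edge lets the loop enter that
face and follow its other three edges; opening it again cuts off this four-step detour. -/
theorem returns_fill_face {ω : Finset (Sym2 (ℤ × ℤ))} {s : Corner} (hs : edge s ∈ ω)
    (hf : ∀ x, face x = face (opp s) → edge x ∈ ω) {N : ℕ}
    (h : Returns (ω.erase (edge s)) s N) : Returns ω s (N - 4) := by
  set ω' := ω.erase (edge s) with hω'
  have hs' : edge s ∉ ω' := by simp [hω']
  have h1 : step ω' s = (s.1, s.2 + 1) := step_closed hs'
  have f1 : face (step ω' s) = face (opp s) := by rw [h1, face_opp]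
  have e1 : edge (step ω' s) ∈ ω' := by
    rw [← mem_erase_edge_iff]
    · exact hf _ f1
    · intro k hk
      have := congrArg Prod.snd (h1 ▸ hk)
      simp only [shift] at this
      omega
    · intro k hk
      have := congrArg Prod.fst (h1 ▸ hk)
      simp only [shift, opp, left_eq_add] at this
      exact dir_ne_zero _ this
  have h2 : (step ω')^[2] s = (s.1 + dir (s.2 + 1), s.2) := by
    rw [Function.iterate_succ_apply', Function.iterate_one, step_open e1, h1]
    simp
  have f2 : face ((step ω')^[2] s) = face (opp s) := by
    rw [Function.iterate_succ_apply', Function.iterate_one, face_step_open e1, f1]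
  have e2 : edge ((step ω')^[2] s) ∈ ω' := by
    rw [← mem_erase_edge_iff]
    · exact hf _ f2
    · intro k hk
      have := congrArg Prod.fst (h2 ▸ hk)
      simp only [shift, add_eq_left] at this
      exact dir_ne_zero _ this
    · intro k hk
      have := congrArg Prod.snd (h2 ▸ hk)
      simp only [shift, opp] at this
      omega
  have h3 : (step ω')^[3] s = (s.1 + dir (s.2 + 1) + dir s.2, s.2 - 1) := by
    rw [Function.iterate_succ_apply', step_open e2, h2]
  have f3 : face ((step ω')^[3] s) = face (opp s) := by
    rw [Function.iterate_succ_apply', face_step_open e2, f2]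
  have e3 : edge ((step ω')^[3] s) ∈ ω' := by
    rw [← mem_erase_edge_iff]
    · exact hf _ f3
    · intro k hk
      have := congrArg Prod.snd (h3 ▸ hk)
      simp only [shift] at this
      omega
    · intro k hk
      have := congrArg Prod.snd (h3 ▸ hk)
      simp only [shift, opp] at this
      omega
  -- One left turn and three right turns give a net turn of -2, which is the turn +2 in `opp s`
  -- lowered by one full turn.
  have h4 : (step ω')^[4] s = shift (-1) (opp s) := by
    rw [Function.iterate_succ_apply', step_open e3, h3]
    have : dir (s.2 + 1) = -dir (s.2 - 1) := by rw [← dir_add_two]; congr 1; ring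
    simp only [shift, opp, this, Prod.mk.injEq]
    exact ⟨by abel, by ring⟩
  have hT : step ω s = step ω' ((step ω')^[4] s) := by
    rw [step_insert_eq hs hs', h4, step_shift]
  have hN : 4 < N := by
    by_contra hN
    have h0 := h.1
    have hr := congrArg Prod.snd h.2.1
    simp only [shift] at hr
    interval_cases N
    · rw [Function.iterate_one, h1] at hr; simp at hr
    · rw [h2] at hr; simp at hr
    · rw [h3] at hr; simp only at hr; omega
    · rw [h4] at hr; simp only [shift, opp] at hr; omega
  have ha : ∀ i, 0 < i → i ≤ N - 4 → (step ω)^[i] s = (step ω')^[i + 4] s := by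
    intro i hi hiN
    rw [Function.iterate_add_apply]
    refine iterate_step_agree hT (fun j hj hjN => ?_) hi hiN
    rw [← Function.iterate_add_apply]
    refine mem_erase_edge_iff (h.2.2 _ (by omega) (by omega)) fun k hk => ?_
    refine h.2.2 j hj (by omega) (k + 1) ((step_injective ω').iterate 4 ?_)
    rw [← Function.iterate_add_apply, iterate_step_shift, add_comm, h4, hk]
    simp
  refine ⟨by omega, ?_, fun i hi hiN k => ?_⟩
  · rw [ha _ (by omega) le_rfl, Nat.sub_add_cancel hN.le, h.2.1]
  · rw [ha i hi (by omega)]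
    exact h.2.2 _ (by omega) (by omega) k

/-- Induction on the number of open edges. Advance to the first open edge of the loop and close it.
Its far side is either joined to `f`, and two loops merge, or a face with all edges open, and a
detour is cut off. With no open edge at the vertex, the loop is four left turns. -/
theorem exists_returns_of_filled {f : ℤ × ℤ} (n : ℕ) : ∀ ω : Finset (Sym2 (ℤ × ℤ)), ω.card = n →
    (∀ e ∈ ω, e ∈ lattice.edgeSet) → Filled ω f → ∀ s, FaceConn ω (face s) f →
    ∃ N, Returns ω s N := by
  induction n with
  | zero =>
    intro ω hn _ _ s _
    obtain rfl := Finset.card_eq_zero.1 hn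
    refine ⟨4, by norm_num, ?_, fun i hi hi4 k hk => ?_⟩
    · rw [iterate_step_turn (by simp)]
      simp [shift]
    · rw [iterate_step_turn (by simp)] at hk
      have := congrArg Prod.snd hk
      simp only [shift] at this
      omega
  | succ n ih =>
    intro ω hn hω hfill s hs
    by_cases hop : ∃ j : ℕ, edge (s.1, s.2 + j) ∈ ω
    swap
    · push Not at hop
      refine ⟨4, by norm_num, ?_, fun i hi hi4 k hk => ?_⟩
      · rw [iterate_step_turn fun j _ => hop j]
        simp [shift]
      · rw [iterate_step_turn fun j _ => hop j] at hk
        have := congrArg Prod.snd hk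
        simp only [shift] at this
        omega
    classical
    have hj : (step ω)^[Nat.find hop] s = (s.1, s.2 + Nat.find hop) :=
      iterate_step_turn fun j hj => Nat.find_min hop hj
    have hf := hs
    replace hf := (faceConn_iterate ω s (Nat.find hop)).symm.trans hf
    suffices h : ∃ N, Returns ω ((step ω)^[Nat.find hop] s) N by
      obtain ⟨N, hN⟩ := h
      exact ⟨N, returns_iterate hN⟩
    have he : edge ((step ω)^[Nat.find hop] s) ∈ ω := by rw [hj]; exact Nat.find_spec hop
    clear hj
    generalize (step ω)^[Nat.find hop] s = s at hf he
    have hsub : ω.erase (edge s) ⊆ ω := Finset.erase_subset _ _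
    have hcl : edge s ∉ ω.erase (edge s) := by simp
    -- Closing the edge joins the face beyond it to `f`, so the hypothesis survives even when that
    -- face was isolated before.
    have hfill' : Filled (ω.erase (edge s)) f := by
      intro x
      rcases hfill x with hx | hx
      · exact Or.inl (hx.mono hsub)
      · by_cases hxe : edge x = edge s
        · left
          rcases edge_eq_iff.1 hxe with ⟨k, rfl⟩ | ⟨k, rfl⟩
          · rw [face_shift]
            exact hf.mono hsub
          · rw [face_shift, face_opp]
            exact (faceConn_closed hcl).symm.trans (hf.mono hsub)
        · exact Or.inr (Finset.mem_erase.2 ⟨hxe, hx⟩)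
    have hcard : (ω.erase (edge s)).card = n := by rw [Finset.card_erase_of_mem he]; omega
    have hlat : ∀ e ∈ ω.erase (edge s), e ∈ lattice.edgeSet := fun e h => hω e (hsub h)
    obtain ⟨N₁, hN₁⟩ := ih _ hcard hlat hfill' s (hf.mono hsub)
    by_cases hf' : FaceConn ω (face (opp s)) f
    · obtain ⟨N₂, hN₂⟩ := ih _ hcard hlat hfill' (shift (-1) (opp s))
        (by rw [face_shift]; exact hf'.mono hsub)
      exact ⟨_, returns_merge hω he (hf.trans hf'.symm) hN₁ hN₂⟩
    · refine ⟨_, returns_fill_face he (fun x hx => ?_) hN₁⟩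
      refine (hfill x).resolve_left ?_
      rwa [hx]

/-- Opening every edge around the finitely many faces not joined to `f` makes the configuration
filled, and a loop that touches only faces joined to `f` does not notice. -/
theorem exists_returns_of_finite {ω : Finset (Sym2 (ℤ × ℤ))} (hω : ∀ e ∈ ω, e ∈ lattice.edgeSet)
    {f : ℤ × ℤ} (hfin : {g | ¬ FaceConn ω g f}.Finite) {s : Corner} (hs : FaceConn ω (face s) f) :
    ∃ N, Returns ω s N := by
  classical
  set A : Finset (Sym2 (ℤ × ℤ)) := (hfin.toFinset ×ˢ Finset.Icc (0 : ℤ) 3).image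
    (fun z => edge (z.1 - off z.2, z.2)) with hA
  have hmem : ∀ x, ¬ FaceConn ω (face x) f → edge x ∈ A := by
    intro x hx
    rw [hA, Finset.mem_image]
    refine ⟨(face x, x.2 % 4), ?_, ?_⟩
    · rw [Finset.mem_product]
      exact ⟨by simpa using hx, by rw [Finset.mem_Icc]; dsimp only; omega⟩
    · dsimp only
      rw [off_congr (show x.2 % 4 % 4 = x.2 % 4 by omega), edge, edge,
        dir_congr (show x.2 % 4 % 4 = x.2 % 4 by omega)]
      simp [face]
  have hmem' : ∀ e ∈ A, ∃ y, edge y = e ∧ ¬ FaceConn ω (face y) f := by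
    intro e he
    rw [hA, Finset.mem_image] at he
    obtain ⟨z, hz, rfl⟩ := he
    refine ⟨_, rfl, ?_⟩
    rw [Finset.mem_product] at hz
    simpa [face] using hz.1
  -- An edge between a face joined to `f` and one that is not must already be open.
  have hiff : ∀ x, FaceConn ω (face x) f → (edge x ∈ ω ↔ edge x ∈ ω ∪ A) := by
    intro x hx
    refine ⟨fun h => Finset.mem_union_left _ h, fun h => ?_⟩
    by_contra hx'
    obtain ⟨y, hy, hyf⟩ := hmem' _ ((Finset.mem_union.1 h).resolve_left hx')
    apply hyf
    rcases edge_eq_iff.1 hy with ⟨k, rfl⟩ | ⟨k, rfl⟩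
    · rwa [face_shift]
    · rw [face_shift, face_opp]
      exact (faceConn_closed hx').symm.trans hx
  have hconn : ∀ g, FaceConn ω g f → FaceConn (ω ∪ A) g f := by
    intro g hg
    induction hg using Relation.ReflTransGen.head_induction_on with
    | refl => exact Relation.ReflTransGen.refl
    | head h1 h2 ih =>
      have h3 : FaceConn ω _ f := h2.head h1
      obtain ⟨x, hx, rfl, rfl⟩ := h1
      exact ih.head ⟨x, fun h => hx ((hiff x h3).2 h), rfl, rfl⟩
  obtain ⟨N, hN⟩ := exists_returns_of_filled (f := f) _ (ω ∪ A) rfl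
    (fun e he => (Finset.mem_union.1 he).elim (hω e) fun h => by
      obtain ⟨y, rfl, -⟩ := hmem' e h
      exact edge_mem_lattice y)
    (fun x => by
      by_cases hx : FaceConn ω (face x) f
      · exact Or.inl (hconn _ hx)
      · exact Or.inr (Finset.mem_union_right _ (hmem x hx))) s (hconn _ hs)
  have hit : ∀ i, (step ω)^[i] s = (step (ω ∪ A))^[i] s := by
    intro i
    induction i with
    | zero => rfl
    | succ i ih =>
      rw [Function.iterate_succ_apply', Function.iterate_succ_apply', ← ih]
      simp only [step, hiff _ ((faceConn_iterate ω s i).symm.trans hs)]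
  refine ⟨N, hN.1, by rw [hit, hN.2.1], fun i hi hiN k => ?_⟩
  rw [hit]
  exact hN.2.2 i hi hiN k

theorem faceConn_right {ω : Finset (Sym2 (ℤ × ℤ))} {x y : ℤ}
    (h : s((x + 1, y), (x + 1, y + 1)) ∉ ω) : FaceConn ω (x, y) (x + 1, y) := by
  have := faceConn_closed (ω := ω) (s := ((x + 1, y), 1)) (by simpa [edge, dir] using h)
  simpa [face, off] using this.symm

theorem faceConn_up {ω : Finset (Sym2 (ℤ × ℤ))} {x y : ℤ}
    (h : s((x, y + 1), (x + 1, y + 1)) ∉ ω) : FaceConn ω (x, y) (x, y + 1) := by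
  have := faceConn_closed (ω := ω) (s := ((x, y + 1), 0)) (by simpa [edge, dir] using h)
  simpa [face, off] using this

theorem faceConn_row {ω : Finset (Sym2 (ℤ × ℤ))} {y : ℤ}
    (h : ∀ x, s((x, y), (x, y + 1)) ∉ ω) (x x' : ℤ) : FaceConn ω (x, y) (x', y) := by
  have key : ∀ (k : ℕ) x, FaceConn ω (x, y) (x + k, y) := by
    intro k x
    induction k with
    | zero => rw [Nat.cast_zero, add_zero]; exact Relation.ReflTransGen.refl
    | succ k ih =>
      have := ih.trans (faceConn_right (h (x + k + 1)))
      simpa [add_assoc] using this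
  rcases le_total x x' with hx | hx
  · obtain ⟨k, hk⟩ := Int.le.dest hx
    exact hk ▸ key k x
  · obtain ⟨k, hk⟩ := Int.le.dest hx
    exact hk ▸ (key k x').symm

theorem faceConn_column {ω : Finset (Sym2 (ℤ × ℤ))} {x : ℤ}
    (h : ∀ y, s((x, y), (x + 1, y)) ∉ ω) (y y' : ℤ) : FaceConn ω (x, y) (x, y') := by
  have key : ∀ (k : ℕ) y, FaceConn ω (x, y) (x, y + k) := by
    intro k y
    induction k with
    | zero => rw [Nat.cast_zero, add_zero]; exact Relation.ReflTransGen.refl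
    | succ k ih =>
      have := ih.trans (faceConn_up (h (y + k + 1)))
      simpa [add_assoc] using this
  rcases le_total y y' with hx | hx
  · obtain ⟨k, hk⟩ := Int.le.dest hx
    exact hk ▸ key k y
  · obtain ⟨k, hk⟩ := Int.le.dest hx
    exact hk ▸ (key k y').symm

/-- For a configuration in a box, all faces outside are joined to each other. -/
theorem faceConn_of_outside {ω : Finset (Sym2 (ℤ × ℤ))} {L t : ℤ}
    (hω : ∀ e ∈ ω, ∀ v ∈ e, -L ≤ v.1 ∧ v.1 ≤ L ∧ 0 ≤ v.2 ∧ v.2 ≤ t) {x y : ℤ}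
    (h : x < -L ∨ L ≤ x ∨ y < 0 ∨ t ≤ y) : FaceConn ω (x, y) (-1, -1) := by
  have hcol : ∀ x, (x < -L ∨ L ≤ x) → ∀ y, FaceConn ω (x, y) (-1, -1) := by
    intro x hx y
    refine (faceConn_column (fun y he => ?_) y (-1)).trans (faceConn_row (fun x he => ?_) x (-1))
    · have h1 := hω _ he _ (Sym2.mem_mk_left _ _)
      have h2 := hω _ he _ (Sym2.mem_mk_right _ _)
      simp only at h1 h2
      omega
    · have h1 := hω _ he _ (Sym2.mem_mk_left _ _)
      simp only at h1
      omega
  by_cases hx : x < -L ∨ L ≤ x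
  · exact hcol x hx y
  · refine (faceConn_row (fun x he => ?_) x L).trans (hcol L (Or.inr le_rfl) y)
    have h1 := hω _ he _ (Sym2.mem_mk_left _ _)
    have h2 := hω _ he _ (Sym2.mem_mk_right _ _)
    simp only at h1 h2
    omega

/-- A loop which is adjacent to the outer face makes exactly one full left turn. -/
theorem exists_returns {ω : Finset (Sym2 (ℤ × ℤ))} {L t : ℤ} (hlat : ∀ e ∈ ω, e ∈ lattice.edgeSet)
    (hω : ∀ e ∈ ω, ∀ v ∈ e, -L ≤ v.1 ∧ v.1 ≤ L ∧ 0 ≤ v.2 ∧ v.2 ≤ t) {s : Corner}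
    (hs : FaceConn ω (face s) (-1, -1)) : ∃ N, Returns ω s N := by
  refine exists_returns_of_finite hlat ((Set.finite_Icc ((-L, 0) : ℤ × ℤ) (L, t)).subset ?_) hs
  rintro ⟨x, y⟩ hxy
  by_contra h
  refine hxy (faceConn_of_outside hω ?_)
  simp only [Set.mem_Icc, Prod.le_def, not_and_or, not_le] at h
  omega

/-! ### Flipping one edge -/

/-- Within one period the corners are distinct even modulo full turns: the dynamics is injective, so
a coincidence could be pulled back to an early return to `c`. -/
theorem Returns.eq_of_shift {ω : Finset (Sym2 (ℤ × ℤ))} {c : Corner} {N : ℕ} (h : Returns ω c N)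
    {i j : ℕ} (hi : i < N) (hj : j < N) {k : ℤ}
    (hij : (step ω)^[i] c = shift k ((step ω)^[j] c)) : i = j := by
  wlog hle : j ≤ i generalizing i j k
  · refine (this hj hi (k := -k) ?_ (le_of_not_ge hle)).symm
    rw [hij]; simp
  by_contra hne
  refine h.2.2 (i - j) (by omega) (by omega) k ((step_injective ω).iterate j ?_)
  rw [← Function.iterate_add_apply, iterate_step_shift, ← hij]
  congr 2
  omega

theorem Returns.iterate_mul {ω : Finset (Sym2 (ℤ × ℤ))} {c : Corner} {N : ℕ} (h : Returns ω c N)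
    (l t : ℕ) : (step ω)^[l + N * t] c = shift t ((step ω)^[l] c) := by
  induction t with
  | zero => simp
  | succ t ih =>
    rw [show l + N * (t + 1) = (l + N * t) + N by ring, Function.iterate_add_apply, h.2.1,
      iterate_step_shift, ih]
    simp [add_comm]

/-- By injectivity and periodicity, any corner that leads to the loop already lies on it. -/
theorem Returns.exists_visit {ω : Finset (Sym2 (ℤ × ℤ))} {c : Corner} {N : ℕ} (h : Returns ω c N)
    {x : Corner} {r : ℕ} {k : ℤ} (hx : (step ω)^[r] x = shift k c) :
    ∃ l < N, ∃ k', (step ω)^[l] c = shift k' x := by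
  have h0 := h.1
  have hr : r ≤ N * r := Nat.le_mul_of_pos_left r h0
  have h1 : (step ω)^[N * r - r] c = shift (r - k) x := by
    apply (step_injective ω).iterate r
    rw [← Function.iterate_add_apply, iterate_step_shift, hx, Nat.add_sub_cancel' hr]
    have := h.iterate_mul 0 r
    rw [zero_add] at this
    rw [this]
    simp
  refine ⟨(N * r - r) % N, Nat.mod_lt _ h0, r - k - ((N * r - r) / N : ℕ), ?_⟩
  have h2 := h.iterate_mul ((N * r - r) % N) ((N * r - r) / N)
  rw [Nat.mod_add_div, h1] at h2
  apply shift_injective ((N * r - r) / N : ℕ)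
  rw [← h2]
  simp

/-- The configurations `ω` and `ω'` differ exactly at the edge `e`; `σ` records which one has
the edge open. -/
structure Flip (e : Sym2 (ℤ × ℤ)) (σ : ℤ) (ω ω' : Finset (Sym2 (ℤ × ℤ))) : Prop where
  agree : ∀ x, edge x ≠ e → (edge x ∈ ω ↔ edge x ∈ ω')
  swap : ∀ x, edge x = e → step ω' x = shift σ (step ω (opp x))

theorem flip_open {e : Sym2 (ℤ × ℤ)} {ω : Finset (Sym2 (ℤ × ℤ))} (he : e ∉ ω) :
    Flip e (-1) ω (insert e ω) where
  agree x hx := by simp [hx]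
  swap x hx := step_insert_eq (by simp [hx]) (by rwa [hx])

theorem flip_close {e : Sym2 (ℤ × ℤ)} {ω : Finset (Sym2 (ℤ × ℤ))} (he : e ∉ ω) :
    Flip e 0 (insert e ω) ω where
  agree x hx := by simp [hx]
  swap x hx := by
    rw [shift_zero]
    exact step_erase_eq (by rwa [hx]) (by simp [hx])

section

variable {e : Sym2 (ℤ × ℤ)} {σ : ℤ} {ω ω' : Finset (Sym2 (ℤ × ℤ))} {c : Corner} {N N' : ℕ}

theorem Flip.step_eq (h : Flip e σ ω ω') {x : Corner} (hx : edge x ≠ e) :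
    step ω' x = step ω x := by
  simp only [step, h.agree x hx]

theorem Flip.iterate_eq (h : Flip e σ ω ω') {a : Corner} {i : ℕ}
    (hi : ∀ l < i, edge ((step ω)^[l] a) ≠ e) : (step ω')^[i] a = (step ω)^[i] a := by
  induction i with
  | zero => rfl
  | succ i ih =>
    rw [Function.iterate_succ_apply', Function.iterate_succ_apply',
      ih fun l hl => hi l (by omega), h.step_eq (hi i (by omega))]

theorem Flip.iterate_eq' (h : Flip e σ ω ω') {a : Corner} {i : ℕ}
    (hi : ∀ l < i, edge ((step ω')^[l] a) ≠ e) : (step ω')^[i] a = (step ω)^[i] a := by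
  induction i with
  | zero => rfl
  | succ i ih =>
    have := ih fun l hl => hi l (by omega)
    rw [Function.iterate_succ_apply', Function.iterate_succ_apply', ← this,
      h.step_eq (hi i (by omega))]

theorem Returns.visits_unique (hN : Returns ω c N) {i j l : ℕ} (hij : i < j) (hj : j < N)
    (hl : l < N) (hi : edge ((step ω)^[i] c) = e) (hje : edge ((step ω)^[j] c) = e)
    (hle : edge ((step ω)^[l] c) = e) : l = i ∨ l = j := by
  rcases edge_eq_iff.1 (hle.trans hi.symm) with ⟨k, hk⟩ | ⟨k, hk⟩
  · exact Or.inl (hN.eq_of_shift hl (by omega) hk)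
  rcases edge_eq_iff.1 (hje.trans hi.symm) with ⟨m, hm⟩ | ⟨m, hm⟩
  · exact absurd (hN.eq_of_shift hj (by omega) hm) (by omega)
  · right
    refine hN.eq_of_shift hl hj (k := k - m) ?_
    rw [hk, hm]
    simp

/-- A loop which meets an edge twice meets it once after the edge has been flipped; the
direction of the second visit is determined by that of the first one. -/
theorem Flip.twice (h : Flip e σ ω ω') (hN : Returns ω c N) (hN' : Returns ω' c N') {i j : ℕ}
    (hij : i < j) (hj : j < N) (hie : edge ((step ω)^[i] c) = e)
    (hje : edge ((step ω)^[j] c) = e) :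
    (step ω)^[j] c = shift σ (opp ((step ω)^[i] c)) ∧ i < N' ∧
      (step ω')^[i] c = (step ω)^[i] c ∧ ∀ l < N', edge ((step ω')^[l] c) = e → l = i := by
  have huniq : ∀ l < N, l ≠ i → l ≠ j → edge ((step ω)^[l] c) ≠ e := fun l hl h1 h2 h3 =>
    (hN.visits_unique hij hj hl hie hje h3).elim h1 h2
  have hpre : ∀ l ≤ i, (step ω')^[l] c = (step ω)^[l] c := fun l hl =>
    h.iterate_eq fun m hm => huniq m (by omega) (by omega) (by omega)
  obtain ⟨k, hk⟩ : ∃ k, (step ω)^[j] c = shift k (opp ((step ω)^[i] c)) := by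
    rcases edge_eq_iff.1 (hje.trans hie.symm) with ⟨m, hm⟩ | hk
    · exact absurd (hN.eq_of_shift hj (by omega) hm) (by omega)
    · exact hk
  -- After the flip the loop jumps at time `i` directly to the part that used to follow time `j`,
  -- leaving out the stretch in between.
  have hpost : ∀ l, j + 1 + l ≤ N →
      (step ω')^[i + 1 + l] c = shift (σ - k) ((step ω)^[j + 1 + l] c) := by
    intro l
    induction l with
    | zero =>
      intro _
      rw [add_zero, add_zero, Function.iterate_succ_apply', hpre i le_rfl, h.swap _ hie,
        Function.iterate_succ_apply', hk, step_shift]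
      simp
    | succ l ih =>
      intro hl
      rw [← add_assoc, ← add_assoc, Function.iterate_succ_apply', ih (by omega),
        Function.iterate_succ_apply', step_shift, h.step_eq]
      exact huniq _ (by omega) (by omega) (by omega)
  have hend := hpost (N - j - 1) (by omega)
  rw [show j + 1 + (N - j - 1) = N by omega, hN.2.1, shift_shift] at hend
  have hN'le : N' ≤ i + 1 + (N - j - 1) := by
    by_contra hlt
    exact hN'.2.2 _ (by omega) (by omega) _ hend
  have hge : i + 1 + (N - j - 1) ≤ N' := by
    by_contra hlt
    by_cases hN'i : N' ≤ i
    · exact hN.2.2 N' hN'.1 (by omega) 1 (by rw [← hpre N' hN'i, hN'.2.1])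
    · have h1 := hpost (N' - i - 1) (by omega)
      rw [show i + 1 + (N' - i - 1) = N' by omega, hN'.2.1] at h1
      refine hN.2.2 (j + 1 + (N' - i - 1)) (by omega) (by omega) (1 - (σ - k)) ?_
      apply shift_injective (σ - k)
      rw [← h1]
      simp
  have heq : N' = i + 1 + (N - j - 1) := le_antisymm hN'le hge
  have hσ : σ - k = 0 := by
    rw [← heq, hN'.2.1] at hend
    have := congrArg Prod.snd hend
    simp only [shift] at this
    omega
  refine ⟨by rw [hk, show k = σ by omega], by omega, hpre i le_rfl, fun l hl hle => ?_⟩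
  by_cases hli : l ≤ i
  · rw [hpre l hli] at hle
    by_contra hne
    exact huniq l (by omega) hne (by omega) hle
  · obtain ⟨m, rfl⟩ : ∃ m, l = i + 1 + m := ⟨l - i - 1, by omega⟩
    rw [hpost m (by omega), edge_shift] at hle
    exact absurd hle (huniq _ (by omega) (by omega) (by omega))

/-- A loop which meets an edge once meets it twice after the edge has been flipped. -/
theorem Flip.once (h : Flip e σ ω ω') (hN : Returns ω c N) (hN' : Returns ω' c N') {i : ℕ}
    (hi : i < N) (hie : edge ((step ω)^[i] c) = e)
    (huniq : ∀ l < N, edge ((step ω)^[l] c) = e → l = i) :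
    ∃ j, i < j ∧ j < N' ∧ edge ((step ω')^[j] c) = e ∧ (step ω')^[i] c = (step ω)^[i] c := by
  have hpre : ∀ l ≤ i, (step ω')^[l] c = (step ω)^[l] c := fun l hl =>
    h.iterate_eq fun m hm he => absurd (huniq m (by omega) he) (by omega)
  have hiN' : i < N' := by
    by_contra hlt
    exact hN.2.2 N' hN'.1 (by omega) 1 (by rw [← hpre N' (by omega), hN'.2.1])
  by_contra hcon
  have hno : ∀ j, i < j → j < N' → edge ((step ω')^[j] c) ≠ e := fun j h1 h2 h3 =>
    hcon ⟨j, h1, h2, h3, hpre i le_rfl⟩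
  have h1 : (step ω')^[i + 1] c = shift σ (step ω (opp ((step ω)^[i] c))) := by
    rw [Function.iterate_succ_apply', hpre i le_rfl, h.swap _ hie]
  -- If the flipped loop never came back to the edge, its tail would be a path of `ω` leading from
  -- the opposite corner to `c`. The original loop would then meet the edge on both sides.
  have h2 : (step ω')^[N' - i - 1] ((step ω')^[i + 1] c) =
      (step ω)^[N' - i - 1] ((step ω')^[i + 1] c) := by
    refine h.iterate_eq' fun l hl => ?_
    rw [← Function.iterate_add_apply]
    exact hno _ (by omega) (by omega)
  rw [← Function.iterate_add_apply, show N' - i - 1 + (i + 1) = N' by omega, hN'.2.1, h1,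
    ← step_shift, ← Function.iterate_succ_apply, iterate_step_shift] at h2
  obtain ⟨l, hl, k, hk⟩ := hN.exists_visit (x := opp ((step ω)^[i] c))
    (r := (N' - i - 1).succ) (k := 1 - σ) (by
      apply shift_injective σ
      rw [← h2]; simp)
  have hle : edge ((step ω)^[l] c) = e := by rw [hk, edge_shift, edge_opp, hie]
  obtain rfl := huniq l hl hle
  refine opp_ne_shift ((step ω)^[l] c) (-k) ?_
  conv_rhs => rw [hk]
  simp

theorem Flip.never (h : Flip e σ ω ω') (hN : Returns ω c N) (hN' : Returns ω' c N')
    (hno : ∀ l < N, edge ((step ω)^[l] c) ≠ e) : ∀ l < N', edge ((step ω')^[l] c) ≠ e := by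
  have hpre : ∀ l ≤ N, (step ω')^[l] c = (step ω)^[l] c := fun l hl =>
    h.iterate_eq fun m hm => hno m (by omega)
  have : N' ≤ N := by
    by_contra hlt
    exact hN'.2.2 N hN.1 (by omega) 1 (by rw [hpre N le_rfl, hN.2.1])
  intro l hl
  rw [hpre l (by omega)]
  exact hno l (by omega)

end

/-! ### The local relation of the parafermionic observable -/

/-- The increment of the observable along one step of the loop. -/
def incr (θ : ℝ) (ω : Finset (Sym2 (ℤ × ℤ))) (s : Corner) : ℝ :=
  if edge s ∈ ω then -Real.cos ((s.2 - 1 : ℤ) * θ) else Real.cos (s.2 * θ)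

/-- The increments collected at the visits of the loop to the edge `e`. -/
def edgeIncr (θ : ℝ) (ω : Finset (Sym2 (ℤ × ℤ))) (c : Corner) (N : ℕ) (e : Sym2 (ℤ × ℤ)) : ℝ :=
  ∑ l ∈ Finset.range N with edge ((step ω)^[l] c) = e, incr θ ω ((step ω)^[l] c)

theorem edgeIncr_of_once {θ : ℝ} {ω : Finset (Sym2 (ℤ × ℤ))} {c : Corner} {N : ℕ}
    {e : Sym2 (ℤ × ℤ)} {i : ℕ} (hi : i < N) (hie : edge ((step ω)^[i] c) = e)
    (huniq : ∀ l < N, edge ((step ω)^[l] c) = e → l = i) :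
    edgeIncr θ ω c N e = incr θ ω ((step ω)^[i] c) := by
  have : (Finset.range N).filter (fun l => edge ((step ω)^[l] c) = e) = {i} := by
    ext l
    simp only [Finset.mem_filter, Finset.mem_range, Finset.mem_singleton]
    exact ⟨fun h => huniq l h.1 h.2, fun h => by subst h; exact ⟨hi, hie⟩⟩
  rw [edgeIncr, this, Finset.sum_singleton]

theorem edgeIncr_of_twice {θ : ℝ} {ω : Finset (Sym2 (ℤ × ℤ))} {c : Corner} {N : ℕ}
    {e : Sym2 (ℤ × ℤ)} {i j : ℕ} (hN : Returns ω c N) (hij : i < j) (hj : j < N)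
    (hie : edge ((step ω)^[i] c) = e) (hje : edge ((step ω)^[j] c) = e) :
    edgeIncr θ ω c N e = incr θ ω ((step ω)^[i] c) + incr θ ω ((step ω)^[j] c) := by
  have : (Finset.range N).filter (fun l => edge ((step ω)^[l] c) = e) = {i, j} := by
    ext l
    simp only [Finset.mem_filter, Finset.mem_range, Finset.mem_insert, Finset.mem_singleton]
    refine ⟨fun h => hN.visits_unique hij hj h.1 hie hje h.2, ?_⟩
    rintro (rfl | rfl)
    exacts [⟨by omega, hie⟩, ⟨hj, hje⟩]
  rw [edgeIncr, this, Finset.sum_pair (by omega)]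

theorem edgeIncr_of_never {θ : ℝ} {ω : Finset (Sym2 (ℤ × ℤ))} {c : Corner} {N : ℕ}
    {e : Sym2 (ℤ × ℤ)} (h : ∀ l < N, edge ((step ω)^[l] c) ≠ e) : edgeIncr θ ω c N e = 0 := by
  rw [edgeIncr, Finset.filter_eq_empty_iff.2 fun l hl => h l (Finset.mem_range.1 hl),
    Finset.sum_empty]

/-- The two visits have directions d and d - 2. Their cosines add up to 2 cos θ times the cosine at
the middle direction, which is the one appearing once the edge is opened. -/
theorem incr_twice_closed {θ : ℝ} {ω : Finset (Sym2 (ℤ × ℤ))} {s : Corner} (hs : edge s ∉ ω) :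
    incr θ ω s + incr θ ω (shift (-1) (opp s)) =
      2 * Real.cos θ * Real.cos ((s.2 - 1 : ℤ) * θ) := by
  rw [incr, incr, if_neg hs, if_neg (by rwa [edge_shift, edge_opp])]
  simp only [shift, opp]
  have h1 : (s.2 : ℝ) * θ = (s.2 - 1 : ℤ) * θ + θ := by push_cast; ring
  have h2 : ((s.2 + 2 + 4 * -1 : ℤ) : ℝ) * θ = (s.2 - 1 : ℤ) * θ - θ := by push_cast; ring
  rw [h1, h2, Real.cos_add, Real.cos_sub]
  ring

/-- The two visits have directions d and d + 2, and the middle direction is that of the single visit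
when the edge is closed. -/
theorem incr_twice_open {θ : ℝ} {ω : Finset (Sym2 (ℤ × ℤ))} {s : Corner} (hs : edge s ∈ ω) :
    incr θ ω s + incr θ ω (opp s) = -(2 * Real.cos θ * Real.cos (s.2 * θ)) := by
  rw [incr, incr, if_pos hs, if_pos (by rwa [edge_opp])]
  simp only [opp]
  have h1 : ((s.2 - 1 : ℤ) : ℝ) * θ = s.2 * θ - θ := by push_cast; ring
  have h2 : ((s.2 + 2 - 1 : ℤ) : ℝ) * θ = s.2 * θ + θ := by push_cast; ring
  rw [h1, h2, Real.cos_add, Real.cos_sub]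
  ring

/-- If the loop meets the edge at all, it meets it once in one of the two configurations and twice
in the other. Two visits when closed mean that its ends are connected anyway; two visits when open
mean that it is a bridge. In either case the factor 2 cos θ from the sum of cosines is the ratio of
the weights. -/
theorem edgeIncr_pair {θ : ℝ} {ω : Finset (Sym2 (ℤ × ℤ))} (hlat : ∀ e ∈ ω, e ∈ lattice.edgeSet)
    {u w : ℤ × ℤ} (he : s(u, w) ∉ ω) (hel : s(u, w) ∈ lattice.edgeSet) {c : Corner} {N N' : ℕ}
    (hN : Returns ω c N) (hN' : Returns (insert s(u, w) ω) c N') {a₀ a₁ : ℝ}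
    (h₁ : (openGraph ω).Reachable u w → a₁ = 2 * Real.cos θ * a₀)
    (h₂ : ¬ (openGraph ω).Reachable u w → a₀ = 2 * Real.cos θ * a₁) :
    a₀ * edgeIncr θ ω c N s(u, w) + a₁ * edgeIncr θ (insert s(u, w) ω) c N' s(u, w) = 0 := by
  set ω' := insert s(u, w) ω with hω'
  by_cases hno : ∀ l < N, edge ((step ω)^[l] c) ≠ s(u, w)
  · rw [edgeIncr_of_never hno, edgeIncr_of_never ((flip_open he).never hN hN' hno)]
    ring
  push Not at hno
  obtain ⟨i, hi, hie⟩ := hno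
  by_cases huniq : ∀ l < N, edge ((step ω)^[l] c) = s(u, w) → l = i
  · obtain ⟨j, hij, hj, hje, hii⟩ := (flip_open he).once hN hN' hi hie huniq
    have hie' : edge ((step ω')^[i] c) = s(u, w) := by rw [hii, hie]
    obtain ⟨h3, -, -, -⟩ := (flip_close he).twice hN' hN hij hj hie' hje
    rw [shift_zero] at h3
    have ha : edge ((step ω)^[i] c) ∉ ω := by rwa [hie]
    have ha' : edge ((step ω')^[i] c) ∈ ω' := by rw [hie', hω']; simp
    have hnr : ¬ (openGraph ω).Reachable u w := by
      have hf := ((faceConn_iterate ω' c i).symm).trans (faceConn_iterate ω' c j)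
      rw [h3] at hf
      have h4 := not_reachable_of_faceConn (fun e h => (Finset.mem_insert.1 h).elim
        (fun h => h ▸ hel) (hlat e)) ha' hf
      rw [hie', hω', Finset.erase_insert he] at h4
      have h5 := Sym2.eq_iff.1 hie'
      intro h6
      rcases h5 with ⟨h5, h7⟩ | ⟨h5, h7⟩
      · exact h4 (by rwa [h7, h5])
      · exact h4 (by rw [h7, h5]; exact h6.symm)
    rw [edgeIncr_of_once hi hie huniq, edgeIncr_of_twice hN' hij hj hie' hje, h3,
      incr_twice_open ha', h₂ hnr, incr, if_neg ha, hii]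
    ring
  · push Not at huniq
    obtain ⟨j, hj, hje, hji⟩ := huniq
    wlog hij : i < j generalizing i j
    · exact this j hj hje i hi hie hji.symm (by omega)
    obtain ⟨h3, hiN', hii, hu⟩ := (flip_open he).twice hN hN' hij hj hie hje
    have hie' : edge ((step ω')^[i] c) = s(u, w) := by rw [hii, hie]
    have ha : edge ((step ω)^[i] c) ∉ ω := by rwa [hie]
    have ha' : edge ((step ω')^[i] c) ∈ ω' := by rw [hie', hω']; simp
    have hr : (openGraph ω).Reachable u w := by
      have hf := ((reachable_iterate ω c i).symm).trans (reachable_iterate ω c j)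
      rw [h3] at hf
      simp only [shift, opp] at hf
      rcases Sym2.eq_iff.1 hie with ⟨h5, h7⟩ | ⟨h5, h7⟩
      · rwa [h7, h5] at hf
      · rw [h7, h5] at hf
        exact hf.symm
    rw [edgeIncr_of_twice hN hij hj hie hje, edgeIncr_of_once hiN' hie' hu, h3,
      incr_twice_closed ha, h₁ hr, incr, if_pos ha', hii]
    ring

/-- For θ > 0 a primitive is sin((d - 1/2)θ) / (2 sin(θ/2)). The case θ = 0, which is q = 4, needs
the linear function instead. -/
theorem exists_primitive {θ : ℝ} (h0 : 0 ≤ θ) (h1 : θ ≤ Real.pi / 3) :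
    ∃ g : ℤ → ℝ, ∀ d : ℤ, g (d + 1) - g d = Real.cos (d * θ) := by
  rcases h0.eq_or_lt with rfl | hpos
  · exact ⟨fun d => d, fun d => by simp⟩
  · have hs : Real.sin (θ / 2) ≠ 0 :=
      (Real.sin_pos_of_pos_of_lt_pi (by linarith) (by linarith [Real.pi_pos])).ne'
    refine ⟨fun d => Real.sin (d * θ - θ / 2) / (2 * Real.sin (θ / 2)), fun d => ?_⟩
    have : ((d + 1 : ℤ) : ℝ) * θ - θ / 2 = d * θ + θ / 2 := by push_cast; ring
    dsimp only
    rw [this, Real.sin_add, Real.sin_sub]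
    field_simp
    ring

/-- The increments add up to the increment of a primitive. -/
theorem incr_eq {θ : ℝ} {g : ℤ → ℝ} (hg : ∀ d : ℤ, g (d + 1) - g d = Real.cos (d * θ))
    (ω : Finset (Sym2 (ℤ × ℤ))) (s : Corner) : incr θ ω s = g (step ω s).2 - g s.2 := by
  unfold incr step
  split_ifs
  · rw [← hg, sub_add_cancel]
    ring
  · exact (hg _).symm

theorem sum_incr {θ : ℝ} {g : ℤ → ℝ} (hg : ∀ d : ℤ, g (d + 1) - g d = Real.cos (d * θ))
    (ω : Finset (Sym2 (ℤ × ℤ))) (c : Corner) (k : ℕ) :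
    ∑ l ∈ Finset.range k, incr θ ω ((step ω)^[l] c) = g ((step ω)^[k] c).2 - g c.2 := by
  have h := Finset.sum_range_sub (fun l => g ((step ω)^[l] c).2) k
  rw [Function.iterate_zero_apply] at h
  rw [← h]
  refine Finset.sum_congr rfl fun l _ => ?_
  rw [incr_eq hg, Function.iterate_succ_apply']

/-! ### Strip domains with a wired arc on the left -/

theorem mem_edges {R : Finset (ℤ × ℤ)} {u v : ℤ × ℤ} :
    s(u, v) ∈ edges R ↔ u ∈ R ∧ v ∈ R ∧ lattice.Adj u v := by
  simp [edges, and_assoc]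

theorem edge_mem_edges {R : Finset (ℤ × ℤ)} {s : Corner} :
    edge s ∈ edges R ↔ s.1 ∈ R ∧ s.1 + dir s.2 ∈ R := by
  rw [edge, mem_edges]
  have := edge_mem_lattice s
  rw [edge, SimpleGraph.mem_edgeSet] at this
  tauto

theorem edges_mem_lattice {R : Finset (ℤ × ℤ)} {e : Sym2 (ℤ × ℤ)} (h : e ∈ edges R) :
    e ∈ lattice.edgeSet := by
  simp only [edges, Finset.mem_filter] at h
  exact h.2

theorem mem_of_mem_edges {R : Finset (ℤ × ℤ)} {e : Sym2 (ℤ × ℤ)} (h : e ∈ edges R)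
    {v : ℤ × ℤ} (hv : v ∈ e) : v ∈ R := by
  simp only [edges, Finset.mem_filter, Finset.mem_sym2_iff] at h
  exact h.1 v hv

open Classical in
/-- The edges of `V` along the bottom side, the top side and the left side `x = -m`. -/
def arcEdges (n m : ℕ) (V : Finset (ℤ × ℤ)) : Finset (Sym2 (ℤ × ℤ)) :=
  (edges V).filter fun e => (∀ v ∈ e, v.2 = 0) ∨ (∀ v ∈ e, v.2 = n) ∨ ∀ v ∈ e, v.1 = -m

/-- The other edges of `V`. -/
def freeEdges (n m : ℕ) (V : Finset (ℤ × ℤ)) : Finset (Sym2 (ℤ × ℤ)) :=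
  edges V \ arcEdges n m V

/-- `V` is a finite part of the strip which contains the left side of the rectangle and the left
part of its horizontal sides, but does not meet the right part. -/
structure IsDomain (n m : ℕ) (V : Finset (ℤ × ℤ)) : Prop where
  one_le_n : 1 ≤ n
  one_le_m : 1 ≤ m
  subset : ∀ v ∈ V, -(m : ℤ) ≤ v.1 ∧ v.1 ≤ m ∧ 0 ≤ v.2 ∧ v.2 ≤ n
  left : ∀ y : ℤ, 0 ≤ y → y ≤ n → (-(m : ℤ), y) ∈ V
  bottom : ∀ x : ℤ, -(m : ℤ) ≤ x → (((x, 0) : ℤ × ℤ) ∈ V ↔ x < 0)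
  top : ∀ x : ℤ, -(m : ℤ) ≤ x → ((x, (n : ℤ)) ∈ V ↔ x < 0)

theorem arcEdges_subset {n m : ℕ} {V : Finset (ℤ × ℤ)} : arcEdges n m V ⊆ edges V := by
  classical exact Finset.filter_subset _ _

theorem edge_mem_arcEdges {n m : ℕ} {V : Finset (ℤ × ℤ)} {s : Corner} :
    edge s ∈ arcEdges n m V ↔ (s.1 ∈ V ∧ s.1 + dir s.2 ∈ V) ∧
      ((s.1.2 = 0 ∧ (s.1 + dir s.2).2 = 0) ∨ (s.1.2 = n ∧ (s.1 + dir s.2).2 = n) ∨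
        (s.1.1 = -m ∧ (s.1 + dir s.2).1 = -m)) := by
  simp only [arcEdges, Finset.mem_filter, edge_mem_edges]
  simp [edge]

/-- The base corner, at the right end of the bottom arc. -/
def base : Corner := ((-1, 0), 0)

/-- The corners met by the loop outside the domain. -/
def Ext (n m : ℕ) (s : Corner) : Prop :=
  (s.1.2 = n ∧ -(m : ℤ) ≤ s.1.1 ∧ s.1.1 ≤ -1 ∧ (s.2 = 1 ∨ s.2 = 2)) ∨
  (s.1.1 = -m ∧ 0 ≤ s.1.2 ∧ s.1.2 ≤ n ∧ (s.2 = 2 ∨ s.2 = 3)) ∨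
  (s.1.2 = 0 ∧ -(m : ℤ) ≤ s.1.1 ∧ s.1.1 ≤ -1 ∧ (s.2 = 3 ∨ s.2 = 4))

section

variable {n m : ℕ} {V : Finset (ℤ × ℤ)} {ω : Finset (Sym2 (ℤ × ℤ))}

theorem union_arc_subset (hω : ω ⊆ freeEdges n m V) : ω ∪ arcEdges n m V ⊆ edges V :=
  Finset.union_subset (hω.trans Finset.sdiff_subset) arcEdges_subset

theorem IsDomain.box (hV : IsDomain n m V) (hω : ω ⊆ edges V) :
    ∀ e ∈ ω, ∀ v ∈ e, -(m : ℤ) ≤ v.1 ∧ v.1 ≤ m ∧ 0 ≤ v.2 ∧ v.2 ≤ n :=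
  fun _ he v hv => hV.subset v (mem_of_mem_edges (hω he) hv)

theorem IsDomain.exists_returns (hV : IsDomain n m V) (hω : ω ⊆ edges V) :
    ∃ N, Returns ω base N := by
  refine FKStrip.exists_returns (fun e he => edges_mem_lattice (hω he)) (hV.box hω) ?_
  have : face base = (-1, -1) := by simp [face, base, off]
  rw [this]
  exact Relation.ReflTransGen.refl

/-- One step along the outside of the domain. -/
theorem IsDomain.step_ext (hV : IsDomain n m V) (hω : ω ⊆ edges V)
    (hB : arcEdges n m V ⊆ ω) {s : Corner} (hs : Ext n m s) (hne : s ≠ shift 1 base) :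
    Ext n m (step ω s) ∧ edge s ∉ freeEdges n m V := by
  obtain ⟨⟨x, y⟩, d⟩ := s
  have hn := hV.one_le_n
  have hm := hV.one_le_m
  have hop : edge ((x, y), d) ∈ arcEdges n m V →
      Ext n m (((x, y) : ℤ × ℤ) + dir d, d - 1) →
      Ext n m (step ω ((x, y), d)) ∧ edge ((x, y), d) ∉ freeEdges n m V := by
    intro h1 h2
    rw [step_open (hB h1)]
    exact ⟨h2, by simp [freeEdges, h1]⟩
  have hcl : ((x, y) : ℤ × ℤ) + dir d ∉ V → Ext n m ((x, y), d + 1) →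
      Ext n m (step ω ((x, y), d)) ∧ edge ((x, y), d) ∉ freeEdges n m V := by
    intro h1 h2
    have h3 : edge ((x, y), d) ∉ edges V := fun h => h1 (edge_mem_edges.1 h).2
    rw [step_closed fun h => h3 (hω h)]
    exact ⟨h2, fun h => h3 (Finset.sdiff_subset h)⟩
  have houtside : ∀ v : ℤ × ℤ, (v.1 < -m ∨ v.2 < 0 ∨ (n : ℤ) < v.2) → v ∉ V := by
    intro v hv h
    have := hV.subset v h
    omega
  have htop : ∀ x : ℤ, -(m : ℤ) ≤ x → x < 0 → ((x, (n : ℤ)) ∈ V) := fun x h1 h2 =>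
    (hV.top x h1).2 h2
  have hbot : ∀ x : ℤ, -(m : ℤ) ≤ x → x < 0 → (((x, 0) : ℤ × ℤ) ∈ V) := fun x h1 h2 =>
    (hV.bottom x h1).2 h2
  simp only [edge_mem_arcEdges] at hop
  by_cases hd : d = 1
  · subst hd
    have hd1 : dir 1 = (0, 1) := by simp [dir]
    simp only [Ext, hd1, Prod.mk_add_mk] at *
    exact hcl (houtside _ (by dsimp only; omega)) (by omega)
  by_cases hd : d = 2
  · subst hd
    have hd1 : dir 2 = (-1, 0) := by simp [dir]
    simp only [Ext, hd1, Prod.mk_add_mk] at *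
    by_cases hx : x = -m
    · exact hcl (houtside _ (by dsimp only; omega)) (by omega)
    · obtain rfl : y = n := by omega
      refine hop ⟨⟨htop _ (by omega) (by omega), ?_⟩, by omega⟩ (by omega)
      rw [add_zero]
      exact htop _ (by omega) (by omega)
  by_cases hd : d = 3
  · subst hd
    have hd1 : dir 3 = (0, -1) := by simp [dir]
    simp only [Ext, hd1, Prod.mk_add_mk] at *
    by_cases hy : y = 0
    · exact hcl (houtside _ (by dsimp only; omega)) (by omega)
    · obtain rfl : x = -m := by omega
      refine hop ⟨⟨hV.left _ (by omega) (by omega), ?_⟩, by omega⟩ (by omega)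
      rw [add_zero]
      exact hV.left _ (by omega) (by omega)
  · obtain rfl : d = 4 := by simp only [Ext] at hs; omega
    have hd1 : dir 4 = (1, 0) := by simp [dir]
    simp only [Ext, hd1, Prod.mk_add_mk] at *
    obtain rfl : y = 0 := by omega
    have hx : x ≠ -1 := by
      rintro rfl
      exact hne (by simp [shift, base])
    refine hop ⟨⟨hbot _ (by omega) (by omega), ?_⟩, by omega⟩ (by omega)
    rw [add_zero]
    exact hbot _ (by omega) (by omega)

theorem not_ext_base : ¬ Ext n m base := by simp [Ext, base]

theorem Ext.faceConn (hV : IsDomain n m V) (hω : ω ⊆ edges V) {s : Corner} (hs : Ext n m s) :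
    FaceConn ω (face s) (-1, -1) := by
  obtain ⟨⟨x, y⟩, d⟩ := s
  refine faceConn_of_outside (x := x + (off d).1) (y := y + (off d).2) (hV.box hω) ?_
  rcases @dir_eq d with ⟨h1, -, h3⟩ | ⟨h1, -, h3⟩ | ⟨h1, -, h3⟩ | ⟨h1, -, h3⟩ <;>
  simp only [Ext, h3] at * <;> omega

/-- From a corner outside the domain, the loop runs outside the domain to the base corner. -/
theorem IsDomain.ext_to_base (hV : IsDomain n m V) (hω : ω ⊆ edges V)
    (hB : arcEdges n m V ⊆ ω) {s : Corner} (hs : Ext n m s) :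
    ∃ j, (step ω)^[j] s = shift 1 base ∧ ∀ i ≤ j, Ext n m ((step ω)^[i] s) := by
  classical
  obtain ⟨N, hN⟩ := FKStrip.exists_returns (fun e he => edges_mem_lattice (hω he)) (hV.box hω)
    (hs.faceConn hV hω)
  have hex : ∃ j, (step ω)^[j] s = shift 1 base := by
    by_contra hno
    push Not at hno
    have hall : ∀ i, Ext n m ((step ω)^[i] s) := by
      intro i
      induction i with
      | zero => exact hs
      | succ i ih =>
        rw [Function.iterate_succ_apply']
        exact (hV.step_ext hω hB ih (hno i)).1
    -- A full turn adds four to the direction, while outside corners have directions from 1 to 4;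
    -- the loop cannot stay outside for a whole period.
    have h1 := hall N
    rw [hN.2.1] at h1
    simp only [Ext, shift] at hs h1
    omega
  refine ⟨Nat.find hex, Nat.find_spec hex, fun i hi => ?_⟩
  induction i with
  | zero => exact hs
  | succ i ih =>
    rw [Function.iterate_succ_apply']
    exact (hV.step_ext hω hB (ih (by omega)) (Nat.find_min hex (by omega))).1

/-- The loop from the base corner first stays inside the domain, until some time `k`, and then
visits all the corners outside the domain. -/
theorem IsDomain.exists_exit (hV : IsDomain n m V) (hω : ω ⊆ edges V)
    (hB : arcEdges n m V ⊆ ω) {N : ℕ} (hN : Returns ω base N) :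
    ∃ k < N, (step ω)^[k] base = ((-1, (n : ℤ)), 1) ∧
      (∀ l, k ≤ l → l < N → Ext n m ((step ω)^[l] base)) ∧
      (∀ l < k, ¬ Ext n m ((step ω)^[l] base)) ∧
      ∀ s, Ext n m s → s ≠ shift 1 base → ∃ l, k ≤ l ∧ l < N ∧ (step ω)^[l] base = s := by
  have hn := hV.one_le_n
  have hm := hV.one_le_m
  -- An outside corner leads to the lifted base corner in some number of steps. Counting these back
  -- from the end of the period locates the corner on the loop.
  have hvisit : ∀ s, Ext n m s → s ≠ shift 1 base → ∃ l < N, (step ω)^[l] base = s ∧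
      ∀ i, l ≤ i → i < N → Ext n m ((step ω)^[i] base) := by
    intro s hs hne
    obtain ⟨j, hj, hjE⟩ := hV.ext_to_base hω hB hs
    have hjN : j ≤ N := by
      by_contra hlt
      have h1 : (step ω)^[j - N] s = base := by
        apply (step_injective ω).iterate N
        rw [← Function.iterate_add_apply, show N + (j - N) = j by omega, hj, hN.2.1]
      exact not_ext_base (h1 ▸ hjE (j - N) (by omega))
    have hs' : (step ω)^[N - j] base = s := by
      apply (step_injective ω).iterate j
      rw [← Function.iterate_add_apply, show j + (N - j) = N by omega, hj, hN.2.1]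
    have hj0 : j ≠ 0 := by
      rintro rfl
      exact hne hj
    refine ⟨N - j, by have := hN.1; omega, hs', fun i hi hiN => ?_⟩
    have := hjE (i - (N - j)) (by omega)
    rwa [← hs', ← Function.iterate_add_apply, show i - (N - j) + (N - j) = i by omega] at this
  have ha : Ext n m ((-1, (n : ℤ)), 1) :=
    Or.inl ⟨rfl, by dsimp only; omega, le_rfl, Or.inl rfl⟩
  obtain ⟨k, hkN, hk, hkE⟩ := hvisit _ ha (by simp [shift, base])
  have hpre : ∀ l < k, ¬ Ext n m ((step ω)^[l] base) := by
    intro l hl hlE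
    have hne : (step ω)^[l] base ≠ shift 1 base := by
      intro h
      rcases Nat.eq_zero_or_pos l with rfl | h0
      · exact absurd (congrArg Prod.snd h) (by simp [shift, base])
      · exact hN.2.2 l h0 (by omega) 1 h
    obtain ⟨l', hl', hll, hE⟩ := hvisit _ hlE hne
    have : l' = l := hN.eq_of_shift hl' (by omega) (k := 0) (by rw [hll, shift_zero])
    subst this
    have h1 := hE (k - 1) (by omega) (by omega)
    -- The vertex (0, n) is not in the domain, so the exit corner is reached by turning at the
    -- closed edge towards it. The preceding corner is not outside, hence an outside corner cannot
    -- occur before time `k`.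
    have h2 : (step ω)^[k - 1] base = ((-1, (n : ℤ)), 0) := by
      apply step_injective ω
      rw [← Function.iterate_succ_apply' (step ω), show (k - 1).succ = k by omega, hk]
      have h3 : edge ((-1, (n : ℤ)), 0) ∉ ω := by
        intro h
        have := (edge_mem_edges.1 (hω h)).2
        simp only [dir, EuclideanDomain.zero_mod, if_true, Prod.mk_add_mk, add_zero] at this
        have := (hV.top _ (by omega)).1 this
        omega
      rw [step_closed h3]
      rfl
    rw [h2] at h1
    simp [Ext] at h1
  refine ⟨k, hkN, hk, hkE, hpre, fun s hs hne => ?_⟩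
  obtain ⟨l, hlN, hl, -⟩ := hvisit s hs hne
  refine ⟨l, ?_, hlN, hl⟩
  by_contra hlt
  exact hpre l (by omega) (hl ▸ hs)

/-- Each edge of the arc is met from outside. -/
theorem IsDomain.exists_ext_of_arc (hV : IsDomain n m V) {e : Sym2 (ℤ × ℤ)}
    (he : e ∈ arcEdges n m V) : ∃ t, Ext n m t ∧ edge t = e ∧ 2 ≤ t.2 ∧ t ≠ shift 1 base ∧
      ∀ r, ¬ Ext n m (shift r (opp t)) := by
  have hn := hV.one_le_n
  have hm := hV.one_le_m
  have hbot : ∀ x : ℤ, -(m : ℤ) ≤ x → x < -1 → ∃ t, Ext n m t ∧ edge t = s((x, 0), (x + 1, 0)) ∧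
      2 ≤ t.2 ∧ t ≠ shift 1 base ∧ ∀ r, ¬ Ext n m (shift r (opp t)) := by
    intro x h1 h2
    refine ⟨((x, 0), 4), ?_, by simp [edge, dir], by simp, ?_, fun r hr => ?_⟩
    · simp [Ext]; omega
    · intro h; simp [shift, base] at h; omega
    · simp [Ext, opp, shift, dir] at hr; omega
  have htop : ∀ x : ℤ, -(m : ℤ) ≤ x → x < -1 →
      ∃ t, Ext n m t ∧ edge t = s((x, (n : ℤ)), (x + 1, (n : ℤ))) ∧
      2 ≤ t.2 ∧ t ≠ shift 1 base ∧ ∀ r, ¬ Ext n m (shift r (opp t)) := by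
    intro x h1 h2
    refine ⟨((x + 1, n), 2), ?_, by simp [edge, dir, Sym2.eq_swap], by simp, ?_, fun r hr => ?_⟩
    · simp [Ext]; omega
    · intro h; simp [shift, base] at h
    · simp [Ext, opp, shift, dir] at hr; omega
  have hleft : ∀ y : ℤ, 0 ≤ y → y < n →
      ∃ t, Ext n m t ∧ edge t = s((-(m : ℤ), y), (-(m : ℤ), y + 1)) ∧
      2 ≤ t.2 ∧ t ≠ shift 1 base ∧ ∀ r, ¬ Ext n m (shift r (opp t)) := by
    intro y h1 h2
    refine ⟨((-m, y + 1), 3), ?_, by simp [edge, dir, Sym2.eq_swap], by simp, ?_, fun r hr => ?_⟩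
    · simp [Ext]; omega
    · intro h; simp [shift, base] at h
    · simp [Ext, opp, shift, dir] at hr; omega
  induction e using Sym2.ind with
  | _ u v =>
  simp only [arcEdges, Finset.mem_filter, mem_edges, Sym2.mem_iff, forall_eq_or_imp, forall_eq] at he
  obtain ⟨⟨hu, hv, hadj⟩, h⟩ := he
  have hu' := hV.subset u hu
  have hv' := hV.subset v hv
  rcases lattice_edge_cases hadj with
      ⟨x, y, ⟨rfl, rfl⟩ | ⟨rfl, rfl⟩⟩ | ⟨x, y, ⟨rfl, rfl⟩ | ⟨rfl, rfl⟩⟩ <;> simp only at h hu' hv'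
  · rcases h with ⟨rfl, -⟩ | ⟨rfl, -⟩ | h
    · exact hbot x (by omega) (by have := (hV.bottom (x + 1) (by omega)).1 hv; omega)
    · exact htop x (by omega) (by have := (hV.top (x + 1) (by omega)).1 hv; omega)
    · omega
  · rw [Sym2.eq_swap]
    rcases h with ⟨rfl, -⟩ | ⟨rfl, -⟩ | h
    · exact hbot x (by omega) (by have := (hV.bottom (x + 1) (by omega)).1 hu; omega)
    · exact htop x (by omega) (by have := (hV.top (x + 1) (by omega)).1 hu; omega)
    · omega
  · obtain rfl : x = -m := by omega
    exact hleft y (by omega) (by omega)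
  · obtain rfl : x = -m := by omega
    rw [Sym2.eq_swap]
    exact hleft y (by omega) (by omega)

end

/-! ### The sum of the observable along the boundary of the domain -/

open Classical in
/-- The edges leaving `V` inside the strip, to the right of the left side of the rectangle. -/
def outPairs (n m : ℕ) (V : Finset (ℤ × ℤ)) : Finset ((ℤ × ℤ) × (ℤ × ℤ)) :=
  (V ×ˢ (Finset.Icc (-(m : ℤ)) (m + 1) ×ˢ Finset.Icc (0 : ℤ) n)).filter
    fun e => lattice.Adj e.1 e.2 ∧ e.2 ∉ V

section

variable {n m : ℕ} {V : Finset (ℤ × ℤ)} {ω : Finset (Sym2 (ℤ × ℤ))} {N k : ℕ}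

/-- The arc edge is also met from outside, with a direction between 2 and 4. Closing it and applying
`Flip.twice` makes the inner direction exactly two less. -/
theorem IsDomain.arc_visit (hV : IsDomain n m V) (hω : ω ⊆ edges V)
    (hB : arcEdges n m V ⊆ ω) (hN : Returns ω base N)
    (hk : ∀ s, Ext n m s → s ≠ shift 1 base → ∃ l, k ≤ l ∧ l < N ∧ (step ω)^[l] base = s)
    {l : ℕ} (hl : l < k) (he : edge ((step ω)^[l] base) ∈ arcEdges n m V) :
    0 ≤ ((step ω)^[l] base).2 ∧ ((step ω)^[l] base).2 ≤ 2 := by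
  obtain ⟨t, ht, hte, ht2, htne, -⟩ := hV.exists_ext_of_arc he
  obtain ⟨l', hl', hlN, rfl⟩ := hk t ht htne
  set e := edge ((step ω)^[l] base) with he'
  have heω : e ∈ ω := hB he
  obtain ⟨N', hN'⟩ := hV.exists_returns ((Finset.erase_subset e ω).trans hω)
  have hf := flip_close (Finset.notMem_erase e ω)
  rw [Finset.insert_erase heω] at hf
  have h := (hf.twice hN hN' (by omega) hlN he'.symm hte).1
  rw [shift_zero] at h
  have h2 : ((step ω)^[l'] base).2 ≤ 4 := by simp only [Ext] at ht; omega
  rw [h] at h2 ht2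
  simp only [opp] at h2 ht2
  omega

/-- Both sides of the edge are dually joined to the outside, so it is a bridge. A single visit would
become two visits after closing it, connecting its ends without it. Hence there is a second visit,
which comes from the inner side. -/
theorem IsDomain.exists_inside_visit (hV : IsDomain n m V) (hω : ω ⊆ edges V)
    (hB : arcEdges n m V ⊆ ω) (hN : Returns ω base N)
    (hk : ∀ s, Ext n m s → s ≠ shift 1 base → ∃ l, k ≤ l ∧ l < N ∧ (step ω)^[l] base = s)
    (hkE : ∀ l, k ≤ l → l < N → Ext n m ((step ω)^[l] base))
    {e : Sym2 (ℤ × ℤ)} (he : e ∈ arcEdges n m V)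
    (hf : ∀ t, edge t = e → FaceConn ω (face t) (-1, -1)) :
    ∃ l < k, edge ((step ω)^[l] base) = e := by
  obtain ⟨t, ht, hte, ht2, htne, hop⟩ := hV.exists_ext_of_arc he
  obtain ⟨l', hl', hlN, hlt⟩ := hk t ht htne
  have heω : e ∈ ω := hB he
  have hte' : edge ((step ω)^[l'] base) = e := by rw [hlt, hte]
  obtain ⟨N', hN'⟩ := hV.exists_returns ((Finset.erase_subset e ω).trans hω)
  have hfl := flip_close (Finset.notMem_erase e ω)
  rw [Finset.insert_erase heω] at hfl
  have hnr : ¬ (openGraph (ω.erase e)).Reachable t.1 (t.1 + dir t.2) := by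
    rw [← hte]
    refine not_reachable_of_faceConn (fun e he => edges_mem_lattice (hω he)) (by rwa [hte]) ?_
    exact (hf t hte).trans (hf (opp t) (by rw [edge_opp, hte])).symm
  by_cases huniq : ∀ l < N, edge ((step ω)^[l] base) = e → l = l'
  · exfalso
    obtain ⟨j, hlj, hj, hje, hll⟩ := hfl.once hN hN' hlN hte' huniq
    apply hnr
    have hr := (reachable_iterate (ω.erase e) base l').symm.trans
      (reachable_iterate (ω.erase e) base j)
    rw [hll, hlt] at hr
    rcases edge_eq_iff.1 (hje.trans hte.symm) with ⟨r, hr'⟩ | ⟨r, hr'⟩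
    · exact absurd (hN'.eq_of_shift hj (by omega) (by rw [hr', hll, hlt])) (by omega : j ≠ l')
    · rw [hr'] at hr
      exact hr
  · push Not at huniq
    obtain ⟨l, hlN', hle, hne⟩ := huniq
    refine ⟨l, ?_, hle⟩
    by_contra hlk
    have hE := hkE l (by omega) hlN'
    rcases edge_eq_iff.1 (hle.trans hte.symm) with ⟨r, hr'⟩ | ⟨r, hr'⟩
    · exact hne (hN.eq_of_shift hlN' hlN (by rw [hr', hlt]))
    · exact hop r (hr' ▸ hE)

theorem mem_of_reachable (hω : ω ⊆ edges V) {u v : ℤ × ℤ} (hu : u ∈ V)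
    (h : (openGraph ω).Reachable u v) : v ∈ V := by
  rw [SimpleGraph.reachable_iff_reflTransGen] at h
  induction h with
  | refl => exact hu
  | tail _ h1 _ =>
    rw [openGraph, SimpleGraph.fromEdgeSet_adj] at h1
    exact (mem_edges.1 (hω h1.1)).2.1

theorem IsDomain.base_mem (hV : IsDomain n m V) : base.1 ∈ V :=
  (hV.bottom (-1) (by have := hV.one_le_m; omega)).2 (by norm_num)

/-- If the neighbour lay outside the strip or to the left of the rectangle, the corner would be a
lift of an outside corner. That one is visited after time `k`, and no corner is visited twice in a
period. -/
theorem IsDomain.outer_visit (hV : IsDomain n m V) (hω : ω ⊆ edges V)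
    (hN : Returns ω base N) (hkN : k ≤ N)
    (hk : ∀ s, Ext n m s → s ≠ shift 1 base → ∃ l, k ≤ l ∧ l < N ∧ (step ω)^[l] base = s)
    {l : ℕ} (hl : l < k) (he : edge ((step ω)^[l] base) ∉ edges V) :
    (((step ω)^[l] base).1, ((step ω)^[l] base).1 + dir ((step ω)^[l] base).2) ∈ outPairs n m V := by
  have hmem : ((step ω)^[l] base).1 ∈ V :=
    mem_of_reachable hω hV.base_mem (reachable_iterate ω base l)
  have hno : ∀ r t, shift r t = (step ω)^[l] base → ¬ (Ext n m t ∧ t ≠ shift 1 base) := by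
    rintro r t hr ⟨ht, htne⟩
    obtain ⟨l', hl', hlN, rfl⟩ := hk t ht htne
    exact absurd (hN.eq_of_shift (by omega) hlN hr.symm) (by omega)
  have hout : ((step ω)^[l] base).1 + dir ((step ω)^[l] base).2 ∉ V := fun h =>
    he (edge_mem_edges.2 ⟨hmem, h⟩)
  generalize (step ω)^[l] base = s at hmem hno hout
  obtain ⟨⟨x, y⟩, d⟩ := s
  have hadj := edge_mem_lattice ((x, y), d)
  rw [edge, SimpleGraph.mem_edgeSet] at hadj
  have hb := hV.subset _ hmem
  have hno' : ∀ c : ℤ, c % 4 = d % 4 → ¬ (Ext n m ((x, y), c) ∧ ((x, y), c) ≠ shift 1 base) := by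
    intro c hc
    refine hno ((d - c) / 4) _ ?_
    simp only [shift, Prod.mk.injEq, true_and]
    omega
  have hx0 : y = 0 → x < 0 := fun h => (hV.bottom x hb.1).1 (by rwa [h] at hmem)
  have hxn : y = n → x < 0 := fun h => (hV.top x hb.1).1 (by rwa [h] at hmem)
  have hm := hV.one_le_m
  have hn := hV.one_le_n
  simp only [outPairs, Finset.mem_filter, Finset.mem_product, Finset.mem_Icc]
  refine ⟨⟨hmem, ?_⟩, hadj, hout⟩
  simp only [Ext, shift, base, ne_eq, Prod.mk.injEq] at hno' hb
  have h1 := hno' 1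
  have h2 := hno' 2
  have h3 := hno' 3
  rcases @dir_eq d with ⟨hd, hd', -⟩ | ⟨hd, hd', -⟩ | ⟨hd, hd', -⟩ | ⟨hd, hd', -⟩ <;>
    simp only [hd', Prod.mk_add_mk] <;> omega

open Classical in
/-- The contribution of one configuration to the relation between the boundary values. -/
theorem IsDomain.one_le_sum (hV : IsDomain n m V) (hω : ω ⊆ edges V)
    (hB : arcEdges n m V ⊆ ω) (hN : Returns ω base N) {θ : ℝ} (h0 : 0 ≤ θ)
    (h1 : θ ≤ Real.pi / 3) :
    1 ≤ ∑ e ∈ freeEdges n m V, edgeIncr θ ω base N e -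
      1 / 2 * ((Finset.Icc (-(m : ℤ)) (-2)).filter
        fun x => FaceConn ω (x, 0) (-1, -1)).card +
      ((outPairs n m V).filter fun e => (openGraph ω).Reachable e.1 base.1).card := by
  obtain ⟨k, hkN, hk, hkE, hkpre, hkv⟩ := hV.exists_exit hω hB hN
  obtain ⟨g, hg⟩ := exists_primitive h0 h1
  have hsum := sum_incr hg ω base k
  have hg0 := hg 0
  rw [hk] at hsum
  -- The inner path starts with direction 0 and ends with direction 1, so the total is cos 0.
  replace hsum := hsum.trans (show _ = (1 : ℝ) by simpa [base] using hg0)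
  set s : ℕ → Corner := fun l => (step ω)^[l] base with hs
  have hsplit : ∑ l ∈ Finset.range k, incr θ ω (s l) =
      ∑ l ∈ Finset.range k with edge (s l) ∈ freeEdges n m V, incr θ ω (s l) +
      (∑ l ∈ Finset.range k with edge (s l) ∈ arcEdges n m V, incr θ ω (s l) +
      ∑ l ∈ Finset.range k with edge (s l) ∉ edges V, incr θ ω (s l)) := by
    rw [Finset.sum_filter, Finset.sum_filter, Finset.sum_filter, ← Finset.sum_add_distrib,
      ← Finset.sum_add_distrib]
    refine Finset.sum_congr rfl fun l _ => ?_
    have := @arcEdges_subset n m V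
    by_cases ha : edge (s l) ∈ arcEdges n m V
    · simp [freeEdges, ha, this ha]
    · by_cases hb : edge (s l) ∈ edges V <;> simp [freeEdges, ha, hb]
  have hfree : ∑ l ∈ Finset.range k with edge (s l) ∈ freeEdges n m V, incr θ ω (s l) =
      ∑ e ∈ freeEdges n m V, edgeIncr θ ω base N e := by
    simp only [edgeIncr]
    rw [Finset.sum_fiberwise_eq_sum_filter]
    refine Finset.sum_congr (Finset.ext fun l => ?_) fun _ _ => rfl
    simp only [Finset.mem_filter, Finset.mem_range]
    refine ⟨fun h => ⟨by omega, h.2⟩, fun h => ⟨?_, h.2⟩⟩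
    by_contra hlk
    refine (hV.step_ext hω hB (hkE l (by omega) h.1) fun hc => ?_).2 h.2
    rcases Nat.eq_zero_or_pos l with rfl | hl0
    · exact absurd (congrArg Prod.snd hc) (by simp [shift, base])
    · exact hN.2.2 l hl0 h.1 1 hc
  -- Arc edges are open and met with direction 0, 1 or 2, so each increment is at most -cos θ ≤
  -- -1/2. Only bottom edges are kept in the count, each with one inner visit.
  have harc : ∑ l ∈ Finset.range k with edge (s l) ∈ arcEdges n m V, incr θ ω (s l) ≤
      -(1 / 2 * ((Finset.Icc (-(m : ℤ)) (-2)).filter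
        fun x => FaceConn ω (x, 0) (-1, -1)).card) := by
    have hle : ∀ l ∈ (Finset.range k).filter (fun l => edge (s l) ∈ arcEdges n m V),
        incr θ ω (s l) ≤ -(1 / 2) := by
      intro l hl
      rw [Finset.mem_filter, Finset.mem_range] at hl
      have hd := hV.arc_visit hω hB hN hkv hl.1 hl.2
      rw [incr, if_pos (hB hl.2)]
      have hcos : 1 / 2 ≤ Real.cos θ := by
        rw [← Real.cos_pi_div_three]
        exact Real.cos_le_cos_of_nonneg_of_le_pi h0 (by linarith [Real.pi_pos]) h1
      have hd' : (s l).2 = 0 ∨ (s l).2 = 1 ∨ (s l).2 = 2 := by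
        simp only [hs]; omega
      rcases hd' with hd' | hd' | hd' <;> rw [hd'] <;> norm_num
      · exact hcos
      · exact hcos
    have hcard : ((Finset.Icc (-(m : ℤ)) (-2)).filter
        fun x => FaceConn ω (x, 0) (-1, -1)).card ≤
        ((Finset.range k).filter (fun l => edge (s l) ∈ arcEdges n m V)).card := by
      have hex : ∀ x ∈ (Finset.Icc (-(m : ℤ)) (-2)).filter
          (fun x => FaceConn ω (x, 0) (-1, -1)), ∃ l < k,
          edge (s l) = s((x, 0), (x + 1, 0)) := by
        intro x hx
        rw [Finset.mem_filter, Finset.mem_Icc] at hx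
        have hee : s((x, 0), (x + 1, 0)) = edge ((x, 0), 0) := by simp [edge, dir]
        refine hV.exists_inside_visit hω hB hN hkv hkE ?_ ?_
        · rw [hee, edge_mem_arcEdges]
          simp only [dir, EuclideanDomain.zero_mod, if_true, Prod.mk_add_mk, add_zero]
          exact ⟨⟨(hV.bottom x hx.1.1).2 (by omega), (hV.bottom _ (by omega)).2 (by omega)⟩,
            Or.inl ⟨trivial, trivial⟩⟩
        · intro t ht
          rw [hee] at ht
          rcases edge_eq_iff.1 ht with ⟨r, rfl⟩ | ⟨r, rfl⟩
          · rw [face_shift]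
            exact faceConn_of_outside (hV.box hω) (by simp [off])
          · rw [face_shift, face_opp]
            have : face ((x, 0), 0 + 1) = (x, 0) := by simp [face, off]
            rw [this]
            exact hx.2
      choose! f hf hfe using hex
      refine Finset.card_le_card_of_injOn f (fun x hx => ?_) (fun x hx y hy hxy => ?_)
      · rw [Finset.mem_coe, Finset.mem_filter, Finset.mem_range, hfe x hx]
        refine ⟨hf x hx, ?_⟩
        rw [Finset.mem_coe, Finset.mem_filter, Finset.mem_Icc] at hx
        have hee : s((x, 0), (x + 1, 0)) = edge ((x, 0), 0) := by simp [edge, dir]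
        rw [hee, edge_mem_arcEdges]
        simp only [dir, EuclideanDomain.zero_mod, if_true, Prod.mk_add_mk, add_zero]
        exact ⟨⟨(hV.bottom x hx.1.1).2 (by omega), (hV.bottom _ (by omega)).2 (by omega)⟩,
          Or.inl ⟨trivial, trivial⟩⟩
      · have h2 := hfe x hx
        rw [hxy, hfe y hy, Sym2.eq_iff] at h2
        simp only [Prod.mk.injEq, and_true] at h2
        omega
    have h3 := Finset.sum_le_card_nsmul _ _ _ hle
    rw [nsmul_eq_mul] at h3
    have h4 : (((Finset.Icc (-(m : ℤ)) (-2)).filter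
        fun x => FaceConn ω (x, 0) (-1, -1)).card : ℝ) ≤
        ((Finset.range k).filter (fun l => edge (s l) ∈ arcEdges n m V)).card := by
      exact_mod_cast hcard
    linarith
  -- Different visits give different oriented edges, because an oriented edge determines the corner
  -- modulo full turns.
  have hout : ∑ l ∈ Finset.range k with edge (s l) ∉ edges V, incr θ ω (s l) ≤
      ((outPairs n m V).filter fun e => (openGraph ω).Reachable e.1 base.1).card := by
    have hle : ∀ l ∈ (Finset.range k).filter (fun l => edge (s l) ∉ edges V),
        incr θ ω (s l) ≤ 1 := by
      intro l hl
      rw [Finset.mem_filter, Finset.mem_range] at hl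
      rw [incr, if_neg fun h => hl.2 (hω h)]
      exact Real.cos_le_one _
    have hcard : ((Finset.range k).filter (fun l => edge (s l) ∉ edges V)).card ≤
        ((outPairs n m V).filter fun e => (openGraph ω).Reachable e.1 base.1).card := by
      refine Finset.card_le_card_of_injOn (fun l => ((s l).1, (s l).1 + dir (s l).2))
        (fun l hl => ?_) (fun l hl l' hl' hll => ?_)
      · rw [Finset.mem_coe, Finset.mem_filter, Finset.mem_range] at hl
        rw [Finset.mem_coe, Finset.mem_filter]
        exact ⟨hV.outer_visit hω hN hkN.le hkv hl.1 hl.2, (reachable_iterate ω base l).symm⟩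
      · rw [Finset.mem_coe, Finset.mem_filter, Finset.mem_range] at hl hl'
        simp only [Prod.mk.injEq] at hll
        have h2 := hll.2
        rw [hll.1] at h2
        have h3 := dir_inj.1 (add_left_cancel h2)
        refine hN.eq_of_shift (k := ((s l).2 - (s l').2) / 4) (by omega) (by omega)
          (Prod.ext hll.1 ?_)
        simp only [shift]
        change (s l).2 = (s l').2 + _
        omega
    have h3 := Finset.sum_le_card_nsmul _ _ _ hle
    rw [nsmul_eq_mul, mul_one] at h3
    have h4 : (((Finset.range k).filter (fun l => edge (s l) ∉ edges V)).card : ℝ) ≤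
        ((outPairs n m V).filter fun e => (openGraph ω).Reachable e.1 base.1).card := by
      exact_mod_cast hcard
    linarith
  linarith

end

/-- The weights are those of the random-cluster model at the self-dual point: opening an edge
multiplies the weight by `a`, or by `1 / a` when its ends are not connected. -/
def SelfDual (F B : Finset (Sym2 (ℤ × ℤ))) (a : ℝ) (f : Finset (Sym2 (ℤ × ℤ)) → ℝ) : Prop :=
  ∀ ω ⊆ F, ∀ u w, s(u, w) ∈ F → s(u, w) ∉ ω →
    ((openGraph (ω ∪ B)).Reachable u w → f (insert s(u, w) ω) = a * f ω) ∧
    (¬ (openGraph (ω ∪ B)).Reachable u w → f ω = a * f (insert s(u, w) ω))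

/-- Pair each configuration without `e` with the one where `e` is opened; every pair cancels by
`edgeIncr_pair`. -/
theorem sum_mul_edgeIncr_eq_zero {n m : ℕ} {V : Finset (ℤ × ℤ)} {θ : ℝ}
    {f : Finset (Sym2 (ℤ × ℤ)) → ℝ}
    (hf : SelfDual (freeEdges n m V) (arcEdges n m V) (2 * Real.cos θ) f)
    {N : Finset (Sym2 (ℤ × ℤ)) → ℕ}
    (hN : ∀ ω ⊆ freeEdges n m V, Returns (ω ∪ arcEdges n m V) base (N ω))
    {e : Sym2 (ℤ × ℤ)} (he : e ∈ freeEdges n m V) :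
    ∑ ω ∈ (freeEdges n m V).powerset,
      f ω * edgeIncr θ (ω ∪ arcEdges n m V) base (N ω) e = 0 := by
  rw [← Finset.insert_erase he, Finset.sum_powerset_insert (Finset.notMem_erase _ _),
    ← Finset.sum_add_distrib]
  refine Finset.sum_eq_zero fun ω hω => ?_
  rw [Finset.mem_powerset] at hω
  have hω' : ω ⊆ freeEdges n m V := hω.trans (Finset.erase_subset _ _)
  have heω : e ∉ ω := fun h => Finset.notMem_erase e _ (hω h)
  have hins : insert e ω ⊆ freeEdges n m V := Finset.insert_subset he hω'
  have hel : e ∈ edges V := Finset.sdiff_subset he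
  have heB : e ∉ arcEdges n m V := (Finset.mem_sdiff.1 he).2
  have hN0 := hN ω hω'
  have hN1 := hN _ hins
  rw [Finset.insert_union] at hN1 ⊢
  induction e using Sym2.ind with
  | _ u w =>
  obtain ⟨h1, h2⟩ := hf ω hω' u w he heω
  exact edgeIncr_pair (fun e h => edges_mem_lattice (union_arc_subset hω' h))
    (by simp [heω, heB]) (edges_mem_lattice hel) hN0 hN1 h1 h2

/-- Faces of the strip to the right of the left side of the rectangle. -/
def InnerFace (n m : ℕ) (f : ℤ × ℤ) : Prop := -(m : ℤ) ≤ f.1 ∧ 0 ≤ f.2 ∧ f.2 < n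

/-- Connection inside the strip, across closed edges, to the face at the end of the arc. -/
def InnerConn (n m : ℕ) (ω : Finset (Sym2 (ℤ × ℤ))) (f : ℤ × ℤ) : Prop :=
  Relation.ReflTransGen (fun f g => FaceAdj ω f g ∧ InnerFace n m f ∧ InnerFace n m g) (-1, 0) f

theorem InnerConn.mono {n m m' : ℕ} {ω ω' : Finset (Sym2 (ℤ × ℤ))} {f : ℤ × ℤ} (hm : m ≤ m')
    (hω : ω' ⊆ ω) (h : InnerConn n m ω f) : InnerConn n m' ω' f := by
  induction h with
  | refl => exact Relation.ReflTransGen.refl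
  | tail _ h1 ih =>
    obtain ⟨⟨s, h1, h2⟩, h3, h4⟩ := h1
    refine ih.tail ⟨⟨s, fun h => h1 (hω h), h2⟩, ⟨?_, h3.2⟩, ⟨?_, h4.2⟩⟩
    · have := h3.1; omega
    · have := h4.1; omega

/-- An arc edge has one side outside the strip or left of the rectangle. Inner dual paths therefore
never cross the arc and are not affected by wiring it. -/
theorem not_inner_of_arc {n m : ℕ} {V : Finset (ℤ × ℤ)} {s : Corner}
    (hs : edge s ∈ arcEdges n m V) (h1 : InnerFace n m (face s))
    (h2 : InnerFace n m (face (s.1, s.2 + 1))) : False := by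
  obtain ⟨⟨x, y⟩, d⟩ := s
  rw [edge_mem_arcEdges] at hs
  replace hs := hs.2
  rcases @dir_eq d with ⟨k1, k2, k3⟩ | ⟨k1, k2, k3⟩ | ⟨k1, k2, k3⟩ | ⟨k1, k2, k3⟩ <;>
  rcases @dir_eq (d + 1) with ⟨l1, -, l3⟩ | ⟨l1, -, l3⟩ | ⟨l1, -, l3⟩ | ⟨l1, -, l3⟩ <;>
  first
    | omega
    | (simp only [InnerFace, face, k2, k3, l3, Prod.mk_add_mk] at hs h1 h2; omega)

/-- The first face is joined to the outside through the edge from (-1, 0) to (0, 0), which is closed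
since (0, 0) is not in the domain. -/
theorem InnerConn.faceConn {n m : ℕ} {V : Finset (ℤ × ℤ)} (hV : IsDomain n m V)
    {ω : Finset (Sym2 (ℤ × ℤ))} (hω : ω ⊆ freeEdges n m V) {f : ℤ × ℤ} (h : InnerConn n m ω f) :
    FaceConn (ω ∪ arcEdges n m V) f (-1, -1) := by
  refine FaceConn.symm ?_
  induction h with
  | refl =>
    refine faceConn_up fun h => ?_
    have h1 := (mem_edges.1 (union_arc_subset hω h)).2.1
    simp only [Int.reduceNeg, neg_add_cancel] at h1
    exact absurd ((hV.bottom 0 (by omega)).1 h1) (lt_irrefl _)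
  | tail _ h1 ih =>
    obtain ⟨⟨s, h1, rfl, rfl⟩, h3, h4⟩ := h1
    refine ih.trans (faceConn_closed fun h => ?_)
    rcases Finset.mem_union.1 h with h | h
    · exact h1 h
    · exact not_inner_of_arc h h3 h4

open Classical in
/-- The relation between the boundary values at the self-dual point. -/
theorem IsDomain.sum_boundary {n m : ℕ} {V : Finset (ℤ × ℤ)} (hV : IsDomain n m V) {θ : ℝ}
    (h0 : 0 ≤ θ) (h1 : θ ≤ Real.pi / 3) {f : Finset (Sym2 (ℤ × ℤ)) → ℝ} (hf0 : ∀ ω, 0 ≤ f ω)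
    (hf : SelfDual (freeEdges n m V) (arcEdges n m V) (2 * Real.cos θ) f) :
    ∑ ω ∈ (freeEdges n m V).powerset, f ω + 1 / 2 * ∑ x ∈ Finset.Icc (-(m : ℤ)) (-2),
      ∑ ω ∈ (freeEdges n m V).powerset with InnerConn n m ω (x, 0), f ω ≤
    ∑ e ∈ outPairs n m V, ∑ ω ∈ (freeEdges n m V).powerset with
      (openGraph (ω ∪ arcEdges n m V)).Reachable e.1 base.1, f ω := by
  have hex : ∀ ω ⊆ freeEdges n m V, ∃ N, Returns (ω ∪ arcEdges n m V) base N := fun ω hω =>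
    hV.exists_returns (union_arc_subset hω)
  choose! N hN using hex
  have hz : ∑ ω ∈ (freeEdges n m V).powerset, f ω *
      ∑ e ∈ freeEdges n m V, edgeIncr θ (ω ∪ arcEdges n m V) base (N ω) e = 0 := by
    simp only [Finset.mul_sum]
    rw [Finset.sum_comm]
    exact Finset.sum_eq_zero fun e he => sum_mul_edgeIncr_eq_zero hf hN he
  have hswap : ∀ {ι : Type} (T : Finset ι) (P : Finset (Sym2 (ℤ × ℤ)) → ι → Prop),
      ∑ x ∈ T, ∑ ω ∈ (freeEdges n m V).powerset with P ω x, f ω =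
      ∑ ω ∈ (freeEdges n m V).powerset, f ω * (T.filter fun x => P ω x).card := by
    intro ι T P
    simp only [Finset.sum_filter]
    rw [Finset.sum_comm]
    refine Finset.sum_congr rfl fun ω _ => ?_
    rw [← Finset.sum_filter, Finset.sum_const, nsmul_eq_mul, mul_comm]
  have key : ∀ a b c d d' : ℝ, 0 ≤ a → 1 ≤ b - 1 / 2 * d + c → d' ≤ d →
      a + 1 / 2 * (a * d') ≤ a * b + a * c := by
    intro a b c d d' ha h2 h3
    nlinarith [mul_le_mul_of_nonneg_left (show 1 + 1 / 2 * d' ≤ b + c by linarith) ha]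
  rw [hswap, hswap, Finset.mul_sum, ← Finset.sum_add_distrib]
  calc _ ≤ ∑ ω ∈ (freeEdges n m V).powerset, (f ω *
        ∑ e ∈ freeEdges n m V, edgeIncr θ (ω ∪ arcEdges n m V) base (N ω) e + f ω *
        ((outPairs n m V).filter fun e =>
          (openGraph (ω ∪ arcEdges n m V)).Reachable e.1 base.1).card) := by
        refine Finset.sum_le_sum fun ω hω => ?_
        rw [Finset.mem_powerset] at hω
        have h2 := hV.one_le_sum (union_arc_subset hω) Finset.subset_union_right (hN ω hω) h0 h1
        have h3 : (((Finset.Icc (-(m : ℤ)) (-2)).filter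
            fun x => InnerConn n m ω (x, 0)).card : ℝ) ≤
            ((Finset.Icc (-(m : ℤ)) (-2)).filter
              fun x => FaceConn (ω ∪ arcEdges n m V) (x, 0) (-1, -1)).card := by
          exact_mod_cast Finset.card_le_card
            (Finset.monotone_filter_right _ fun x _ hx => InnerConn.faceConn hV hω hx)
        exact key _ _ _ _ _ (hf0 ω) h2 h3
    _ = _ := by rw [Finset.sum_add_distrib, hz, zero_add]

/-! ### Counting clusters when an edge is opened -/

section

variable {X : Type*} {G G' : SimpleGraph X} {u w : X}

theorem reachable_insert (hadj : ∀ x y, G'.Adj x y → G.Adj x y ∨ s(x, y) = s(u, w)) {x y : X}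
    (h : G'.Reachable x y) :
    G.Reachable x y ∨ (G.Reachable x u ∧ G.Reachable w y) ∨ (G.Reachable x w ∧ G.Reachable u y) := by
  rw [SimpleGraph.reachable_iff_reflTransGen] at h
  induction h with
  | refl => exact Or.inl (SimpleGraph.Reachable.refl _)
  | @tail y z _ h1 ih =>
    rcases hadj _ _ h1 with h2 | h2
    · have h3 := h2.reachable
      rcases ih with h4 | h4 | h4
      · exact Or.inl (h4.trans h3)
      · exact Or.inr (Or.inl ⟨h4.1, h4.2.trans h3⟩)
      · exact Or.inr (Or.inr ⟨h4.1, h4.2.trans h3⟩)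
    · rcases Sym2.eq_iff.1 h2 with ⟨rfl, rfl⟩ | ⟨rfl, rfl⟩
      · rcases ih with h4 | h4 | h4
        · exact Or.inr (Or.inl ⟨h4, SimpleGraph.Reachable.refl _⟩)
        · exact Or.inr (Or.inl ⟨h4.1, SimpleGraph.Reachable.refl _⟩)
        · exact Or.inl h4.1
      · rcases ih with h4 | h4 | h4
        · exact Or.inr (Or.inr ⟨h4, SimpleGraph.Reachable.refl _⟩)
        · exact Or.inl h4.1
        · exact Or.inr (Or.inr ⟨h4.1, SimpleGraph.Reachable.refl _⟩)

theorem reachable_insert_iff (hle : G ≤ G')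
    (hadj : ∀ x y, G'.Adj x y → G.Adj x y ∨ s(x, y) = s(u, w)) (hr : G.Reachable u w) {x y : X} :
    G'.Reachable x y ↔ G.Reachable x y := by
  refine ⟨fun h => ?_, fun h => h.mono hle⟩
  rcases reachable_insert hadj h with h | h | h
  · exact h
  · exact (h.1.trans hr).trans h.2
  · exact (h.1.trans hr.symm).trans h.2

/-- The number of clusters of `G` which meet the set `R`. -/
def clusterCount (G : SimpleGraph X) (R : Set X) : ℕ := (G.connectedComponentMk '' R).ncard

theorem clusterCount_of_iff {R : Set X}
    (h : ∀ x ∈ R, ∀ y ∈ R, (G'.Reachable x y ↔ G.Reachable x y)) :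
    clusterCount G' R = clusterCount G R := by
  unfold clusterCount
  refine Set.ncard_congr (fun c hc => G.connectedComponentMk hc.choose) (fun c hc => ?_)
    (fun c c' hc hc' hcc => ?_) (fun c hc => ?_)
  · exact ⟨_, hc.choose_spec.1, rfl⟩
  · rw [← hc.choose_spec.2, ← hc'.choose_spec.2]
    rw [SimpleGraph.ConnectedComponent.eq] at hcc ⊢
    exact (h _ hc.choose_spec.1 _ hc'.choose_spec.1).2 hcc
  · obtain ⟨x, hx, rfl⟩ := hc
    have hx' : G'.connectedComponentMk x ∈ G'.connectedComponentMk '' R := ⟨x, hx, rfl⟩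
    refine ⟨_, hx', ?_⟩
    rw [SimpleGraph.ConnectedComponent.eq]
    refine (h _ hx'.choose_spec.1 _ hx).1 ?_
    exact SimpleGraph.ConnectedComponent.eq.1 hx'.choose_spec.2

/-- With the cluster of `w` left out, the remaining clusters of `G` correspond bijectively to those
of `G'`. -/
theorem clusterCount_insert (hle : G ≤ G')
    (hadj : ∀ x y, G'.Adj x y → G.Adj x y ∨ s(x, y) = s(u, w)) (huw : G'.Reachable u w)
    (hr : ¬ G.Reachable u w) {R : Set X} (hR : R.Finite) (hu : u ∈ R) (hw : w ∈ R) :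
    clusterCount G R = clusterCount G' R + 1 := by
  classical
  unfold clusterCount
  set φ : G.ConnectedComponent → G'.ConnectedComponent :=
    SimpleGraph.ConnectedComponent.map (SimpleGraph.Hom.ofLE hle) with hφ
  have hφm : ∀ x, φ (G.connectedComponentMk x) = G'.connectedComponentMk x := fun x => rfl
  set T := G.connectedComponentMk '' R with hT
  have hTf : T.Finite := hR.image _
  have hwT : G.connectedComponentMk w ∈ T := ⟨w, hw, rfl⟩
  have himg : G'.connectedComponentMk '' R = φ '' (T \ {G.connectedComponentMk w}) := by
    ext c
    constructor
    · rintro ⟨x, hx, rfl⟩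
      by_cases hxw : G.connectedComponentMk x = G.connectedComponentMk w
      · refine ⟨G.connectedComponentMk u, ⟨⟨u, hu, rfl⟩, ?_⟩, ?_⟩
        · rw [Set.mem_singleton_iff, SimpleGraph.ConnectedComponent.eq]
          exact hr
        · rw [hφm, SimpleGraph.ConnectedComponent.eq]
          exact huw.trans ((SimpleGraph.ConnectedComponent.eq.1 hxw).mono hle).symm
      · exact ⟨G.connectedComponentMk x, ⟨⟨x, hx, rfl⟩, hxw⟩, hφm x⟩
    · rintro ⟨_, ⟨⟨x, hx, rfl⟩, -⟩, rfl⟩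
      exact ⟨x, hx, rfl⟩
  have hinj : Set.InjOn φ (T \ {G.connectedComponentMk w}) := by
    rintro _ ⟨⟨x, hx, rfl⟩, hxw⟩ _ ⟨⟨y, hy, rfl⟩, hyw⟩ hxy
    rw [Set.mem_singleton_iff, SimpleGraph.ConnectedComponent.eq] at hxw hyw
    rw [hφm, hφm, SimpleGraph.ConnectedComponent.eq] at hxy
    rw [SimpleGraph.ConnectedComponent.eq]
    rcases reachable_insert hadj hxy with h | h | h
    · exact h
    · exact absurd h.2.symm hyw
    · exact absurd h.1 hxw
  rw [himg, hinj.ncard_image, Set.ncard_sdiff_singleton_add_one hwT hTf]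

end

theorem openGraph_insert {ω : Finset (Sym2 (ℤ × ℤ))} {u w : ℤ × ℤ} :
    openGraph ω ≤ openGraph (insert s(u, w) ω) ∧
    (∀ x y, (openGraph (insert s(u, w) ω)).Adj x y → (openGraph ω).Adj x y ∨ s(x, y) = s(u, w)) ∧
    (openGraph (insert s(u, w) ω)).Reachable u w := by
  refine ⟨openGraph_mono (Finset.subset_insert _ _), fun x y h => ?_, ?_⟩
  · simp only [openGraph, SimpleGraph.fromEdgeSet_adj, Finset.coe_insert, Set.mem_insert_iff] at h ⊢
    tauto
  · by_cases h : u = w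
    · rw [h]
    · refine SimpleGraph.Adj.reachable ?_
      simp [openGraph, SimpleGraph.fromEdgeSet_adj, h]

/-- The weights of the self-dual random-cluster model on `V` with the edges of `B` open. -/
def fkWeight (a : ℝ) (V : Finset (ℤ × ℤ)) (B ω : Finset (Sym2 (ℤ × ℤ))) : ℝ :=
  a ^ ω.card * (a ^ 2) ^ clusterCount (openGraph (ω ∪ B)) (V : Set (ℤ × ℤ))

theorem fkWeight_pos {a : ℝ} (ha : 0 < a) (V : Finset (ℤ × ℤ)) (B ω : Finset (Sym2 (ℤ × ℤ))) :
    0 < fkWeight a V B ω := by unfold fkWeight; positivity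

/-- An open edge weighs a and a cluster weighs a². Opening an edge multiplies by a, and merging two
clusters also divides by a². -/
theorem selfDual_fkWeight {a : ℝ} {V : Finset (ℤ × ℤ)} {F B : Finset (Sym2 (ℤ × ℤ))}
    (hF : F ⊆ edges V) : SelfDual F B a (fkWeight a V B) := by
  intro ω hω u w he heω
  have hm := mem_edges.1 (hF he)
  obtain ⟨h1, h2, h3⟩ := @openGraph_insert (ω ∪ B) u w
  unfold fkWeight
  rw [Finset.card_insert_of_notMem heω, Finset.insert_union]
  constructor
  · intro hr
    rw [clusterCount_of_iff fun x _ y _ => reachable_insert_iff h1 h2 hr]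
    ring
  · intro hr
    rw [clusterCount_insert h1 h2 h3 hr V.finite_toSet hm.1 hm.2.1]
    ring

/-! ### The weights of the random-cluster model with wired boundary conditions -/

theorem numClusters_eq (R : Finset (ℤ × ℤ)) (ω : Finset (Sym2 (ℤ × ℤ))) :
    numClusters R ω = clusterCount (wiredGraph R ω) Set.univ := by
  unfold numClusters clusterCount
  rw [Set.image_univ, Set.range_eq_univ.2 (by exact Quot.mk_surjective), Set.ncard_univ]

theorem wiredGraph_insert {R : Finset (ℤ × ℤ)} {ω : Finset (Sym2 (ℤ × ℤ))} (u w : R)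
    (huw : u ≠ w) : wiredGraph R ω ≤ wiredGraph R (insert s((u : ℤ × ℤ), (w : ℤ × ℤ)) ω) ∧
    (∀ x y, (wiredGraph R (insert s((u : ℤ × ℤ), (w : ℤ × ℤ)) ω)).Adj x y →
      (wiredGraph R ω).Adj x y ∨ s(x, y) = s(u, w)) ∧
    (wiredGraph R (insert s((u : ℤ × ℤ), (w : ℤ × ℤ)) ω)).Reachable u w := by
  refine ⟨fun x y h => ?_, fun x y h => ?_, SimpleGraph.Adj.reachable ?_⟩
  · simp only [wiredGraph, SimpleGraph.fromRel_adj, Finset.mem_insert] at h ⊢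
    tauto
  · simp only [wiredGraph, SimpleGraph.fromRel_adj, Finset.mem_insert, Sym2.eq_iff,
      Subtype.coe_inj] at h ⊢
    tauto
  · simp [wiredGraph, huw]

theorem weight_pos {R : Finset (ℤ × ℤ)} {p q : ℝ} (hp0 : 0 < p) (hp1 : p < 1) (hq : 0 < q)
    (ω : Finset (Sym2 (ℤ × ℤ))) : 0 < weight R p q ω := by
  have : 0 < 1 - p := by linarith
  unfold weight
  positivity

/-- Effect of opening an edge on the weight. -/
theorem weight_insert {R : Finset (ℤ × ℤ)} {p q : ℝ} {ω : Finset (Sym2 (ℤ × ℤ))}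
    (hω : ω ⊆ edges R) {u w : R} (he : s((u : ℤ × ℤ), (w : ℤ × ℤ)) ∈ edges R)
    (heω : s((u : ℤ × ℤ), (w : ℤ × ℤ)) ∉ ω) :
    ((wiredGraph R ω).Reachable u w →
      weight R p q (insert s((u : ℤ × ℤ), (w : ℤ × ℤ)) ω) * (1 - p) = weight R p q ω * p) ∧
    (¬ (wiredGraph R ω).Reachable u w →
      weight R p q (insert s((u : ℤ × ℤ), (w : ℤ × ℤ)) ω) * (1 - p) * q = weight R p q ω * p) := by
  have huw : u ≠ w := by
    rintro rfl
    exact (mem_edges.1 he).2.2.ne rfl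
  obtain ⟨h1, h2, h3⟩ := wiredGraph_insert (ω := ω) u w huw
  have hc : (insert s((u : ℤ × ℤ), (w : ℤ × ℤ)) ω).card = ω.card + 1 :=
    Finset.card_insert_of_notMem heω
  have hlt : ω.card + 1 ≤ (edges R).card := by
    rw [← hc]
    exact Finset.card_le_card (Finset.insert_subset he hω)
  obtain ⟨r, hr⟩ : ∃ r, (edges R).card = ω.card + 1 + r := ⟨_, (Nat.add_sub_cancel' hlt).symm⟩
  have e1 : (edges R).card - (ω.card + 1) = r := by omega
  have e2 : (edges R).card - ω.card = r + 1 := by omega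
  unfold weight
  rw [hc, e1, e2, numClusters_eq, numClusters_eq]
  constructor
  · intro hr
    rw [clusterCount_of_iff fun x _ y _ => reachable_insert_iff h1 h2 hr]
    ring
  · intro hr
    rw [clusterCount_insert h1 h2 h3 hr Set.finite_univ trivial trivial]
    ring

/-! ### Comparison of measures -/

section

variable {α : Type*} [DecidableEq α]

/-- The elements of a \ b are added one at a time to both arguments, each addition costing one use
of the single-edge comparison. -/
theorem lattice_condition {F₁ F₂ : Finset α} (hF : F₁ ⊆ F₂) {f₁ f₂ : Finset α → ℝ}
    (h₁ : ∀ a, 0 < f₁ a)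
    (h : ∀ e ∈ F₁, ∀ ω ⊆ F₁, ∀ ω' ⊆ F₂, ω ⊆ ω' → e ∉ ω' →
      f₁ (insert e ω) * f₂ ω' ≤ f₁ ω * f₂ (insert e ω')) {a b : Finset α} (ha : a ⊆ F₁)
    (hb : b ⊆ F₂) : f₁ a * f₂ b ≤ f₁ (a ∩ b) * f₂ (a ∪ b) := by
  have key : ∀ D : Finset α, D ⊆ F₁ → Disjoint D b → 
      f₁ ((a ∩ b) ∪ D) * f₂ b ≤ f₁ (a ∩ b) * f₂ (b ∪ D) := by
    intro D
    induction D using Finset.induction with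
    | empty => simp
    | insert e D he ih =>
      intro hD hdis
      rw [Finset.insert_subset_iff] at hD
      rw [Finset.disjoint_insert_left] at hdis
      have h1 := ih hD.2 hdis.2
      have hc : a ∩ b ∪ D ⊆ F₁ := Finset.union_subset (Finset.inter_subset_left.trans ha) hD.2
      have h2 := h e hD.1 (a ∩ b ∪ D) hc (b ∪ D) (Finset.union_subset hb (hD.2.trans hF))
        (Finset.union_subset_union_left Finset.inter_subset_right) (by simp [he, hdis.1])
      rw [Finset.union_insert, Finset.union_insert]
      refine le_of_mul_le_mul_left ?_ (h₁ (a ∩ b ∪ D))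
      calc _ = f₁ (insert e (a ∩ b ∪ D)) * (f₁ (a ∩ b ∪ D) * f₂ b) := by ring
        _ ≤ f₁ (insert e (a ∩ b ∪ D)) * (f₁ (a ∩ b) * f₂ (b ∪ D)) :=
          mul_le_mul_of_nonneg_left h1 (h₁ _).le
        _ = f₁ (a ∩ b) * (f₁ (insert e (a ∩ b ∪ D)) * f₂ (b ∪ D)) := by ring
        _ ≤ f₁ (a ∩ b) * (f₁ (a ∩ b ∪ D) * f₂ (insert e (b ∪ D))) :=
          mul_le_mul_of_nonneg_left h2 (h₁ _).le
        _ = _ := by ring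
  have := key (a \ b) (Finset.sdiff_subset.trans ha) Finset.sdiff_disjoint
  rwa [Finset.union_comm (a ∩ b), Finset.sdiff_union_inter, Finset.union_sdiff_self_eq_union,
    Finset.union_comm b] at this

open Classical in
/-- Stochastic domination from a comparison of the effects of opening one edge. -/
theorem holley_sum {F₁ F₂ : Finset α} (hF : F₁ ⊆ F₂) {f₁ f₂ : Finset α → ℝ}
    (h₁ : ∀ a, 0 < f₁ a) (h₂ : ∀ a, 0 ≤ f₂ a)
    (h : ∀ e ∈ F₁, ∀ ω ⊆ F₁, ∀ ω' ⊆ F₂, ω ⊆ ω' → e ∉ ω' →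
      f₁ (insert e ω) * f₂ ω' ≤ f₁ ω * f₂ (insert e ω')) {A : Finset α → Prop}
    (hA : ∀ a b, a ⊆ b → A a → A b) :
    (∑ ω ∈ F₁.powerset with A ω, f₁ ω) * ∑ ω ∈ F₂.powerset, f₂ ω ≤
    (∑ ω ∈ F₁.powerset, f₁ ω) * ∑ ω ∈ F₂.powerset with A ω, f₂ ω := by
  -- Extending the smaller measure by zero puts both weights on the subsets of `F₂`, as the four
  -- functions theorem requires.
  set g : Finset α → ℝ := fun ω => if ω ⊆ F₁ then f₁ ω else 0 with hg
  have hg0 : 0 ≤ g := fun ω => by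
    simp only [hg]; split_ifs
    · exact (h₁ _).le
    · exact le_rfl
  have hgs : ∀ T : Finset (Finset α), T ⊆ F₁.powerset → ∑ ω ∈ T, g ω = ∑ ω ∈ T, f₁ ω :=
    fun T hT => Finset.sum_congr rfl fun ω hω => if_pos (Finset.mem_powerset.1 (hT hω))
  have hpow : F₁.powerset ⊆ F₂.powerset := Finset.powerset_mono.2 hF
  have key := Finset.four_functions_theorem F₂ (f₁ := g) (f₂ := f₂) (f₃ := g) (f₄ := f₂) hg0 h₂
    hg0 h₂ (fun a _ b hb => by
      by_cases haF : a ⊆ F₁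
      · simp only [hg, if_pos haF, if_pos (Finset.inter_subset_left.trans haF)]
        exact lattice_condition hF h₁ h haF hb
      · simp only [hg, if_neg haF, zero_mul]
        exact mul_nonneg (hg0 _) (h₂ _))
    (𝒜 := F₁.powerset.filter A) (ℬ := F₂.powerset) ((Finset.filter_subset _ _).trans hpow)
    Finset.Subset.rfl
  rw [hgs _ (Finset.filter_subset _ _)] at key
  refine key.trans (mul_le_mul ?_ ?_ (Finset.sum_nonneg fun _ _ => h₂ _)
    (Finset.sum_nonneg fun _ _ => (h₁ _).le))
  · rw [← hgs _ Finset.Subset.rfl]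
    refine Finset.sum_le_sum_of_subset_of_nonneg (fun ω hω => ?_) fun ω _ _ => hg0 ω
    obtain ⟨a, ha, b, hb, rfl⟩ := Finset.mem_infs.1 hω
    rw [Finset.mem_filter, Finset.mem_powerset] at ha
    exact Finset.mem_powerset.2 (Finset.inter_subset_left.trans ha.1)
  · refine Finset.sum_le_sum_of_subset_of_nonneg (fun ω hω => ?_) fun ω _ _ => h₂ ω
    obtain ⟨a, ha, b, hb, rfl⟩ := Finset.mem_sups.1 hω
    rw [Finset.mem_filter, Finset.mem_powerset] at ha
    rw [Finset.mem_powerset] at hb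
    exact Finset.mem_filter.2 ⟨Finset.mem_powerset.2 (Finset.union_subset (ha.1.trans hF) hb),
      hA _ _ Finset.subset_union_left ha.2⟩

/-- Elements outside `E` are independent, each contributing a factor 1 + t. -/
theorem sum_powerset_marginal {E F : Finset α} (hEF : E ⊆ F) (g : Finset α → ℝ) (t : ℝ) :
    ∑ ω ∈ F.powerset, g (ω ∩ E) * t ^ (ω \ E).card =
      (∑ ω ∈ E.powerset, g ω) * (1 + t) ^ (F \ E).card := by
  have key : ∀ D : Finset α, Disjoint D E → ∑ ω ∈ (E ∪ D).powerset,
      g (ω ∩ E) * t ^ (ω \ E).card = (∑ ω ∈ E.powerset, g ω) * (1 + t) ^ D.card := by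
    intro D
    induction D using Finset.induction with
    | empty =>
      intro _
      rw [Finset.union_empty, Finset.card_empty, pow_zero, mul_one]
      refine Finset.sum_congr rfl fun ω hω => ?_
      rw [Finset.mem_powerset] at hω
      rw [Finset.inter_eq_left.2 hω, Finset.sdiff_eq_empty_iff_subset.2 hω]
      simp
    | insert e D he ih =>
      intro hdis
      rw [Finset.disjoint_insert_left] at hdis
      have heE : e ∉ E ∪ D := by simp [he, hdis.1]
      rw [Finset.union_insert, Finset.sum_powerset_insert heE, ih hdis.2,
        Finset.card_insert_of_notMem he, pow_succ]
      have : ∀ ω ∈ (E ∪ D).powerset, g (insert e ω ∩ E) * t ^ (insert e ω \ E).card =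
          t * (g (ω ∩ E) * t ^ (ω \ E).card) := by
        intro ω hω
        have heω : e ∉ ω := fun h => heE (Finset.mem_powerset.1 hω h)
        rw [Finset.insert_inter_of_notMem hdis.1, Finset.insert_sdiff_of_notMem _ hdis.1,
          Finset.card_insert_of_notMem (by simp [heω])]
        ring
      rw [Finset.sum_congr rfl this, ← Finset.mul_sum, ih hdis.2]
      ring
  have := key (F \ E) Finset.sdiff_disjoint
  rwa [Finset.union_sdiff_of_subset hEF] at this

open Classical in
/-- Stochastic domination when the larger measure lives on fewer edges. -/
theorem holley_sum_of_subset {F₁ F₂ : Finset α} (hF : F₂ ⊆ F₁) {f₁ f₂ : Finset α → ℝ}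
    (h₁ : ∀ a, 0 < f₁ a) (h₂ : ∀ a, 0 < f₂ a) {t : ℝ} (ht : 0 < t)
    (h : ∀ e ∈ F₂, ∀ ω ⊆ F₁, ∀ ω' ⊆ F₂, ω ∩ F₂ ⊆ ω' → e ∉ ω' →
      f₁ (insert e ω) * f₂ ω' ≤ f₁ ω * f₂ (insert e ω'))
    (h' : ∀ e ∈ F₁, ∀ ω ⊆ F₁, e ∉ ω → f₁ (insert e ω) ≤ f₁ ω * t) {A : Finset α → Prop}
    (hA : ∀ a b, a ⊆ b → A a → A b) :
    (∑ ω ∈ F₁.powerset with A (ω ∩ F₂), f₁ ω) * ∑ ω ∈ F₂.powerset, f₂ ω ≤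
    (∑ ω ∈ F₁.powerset, f₁ ω) * ∑ ω ∈ F₂.powerset with A ω, f₂ ω := by
  have hpos : 0 < (1 + t) ^ (F₁ \ F₂).card := by positivity
  -- The larger measure is extended to `F₁` by independent edges of weight `t`, which bounds the
  -- effect of opening any edge under the smaller one. The extension does not change probabilities
  -- of events depending on `F₂` only.
  have key := holley_sum (Finset.Subset.refl F₁) h₁
    (f₂ := fun ω => f₂ (ω ∩ F₂) * t ^ (ω \ F₂).card)
    (fun ω => mul_nonneg (h₂ _).le (by positivity)) (fun e he ω hω ω' hω' hωω heω' => ?_)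
    (A := fun ω => A (ω ∩ F₂)) (fun a b hab => hA _ _ (Finset.inter_subset_inter_right hab))
  · have h3 : ∑ ω ∈ F₁.powerset with A (ω ∩ F₂), f₂ (ω ∩ F₂) * t ^ (ω \ F₂).card =
        (∑ ω ∈ F₂.powerset with A ω, f₂ ω) * (1 + t) ^ (F₁ \ F₂).card := by
      rw [Finset.sum_filter, Finset.sum_filter, ← sum_powerset_marginal hF]
      refine Finset.sum_congr rfl fun ω _ => ?_
      split_ifs <;> simp
    rw [h3, sum_powerset_marginal hF, ← mul_assoc, ← mul_assoc] at key
    exact le_of_mul_le_mul_right key hpos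
  · by_cases heF : e ∈ F₂
    · rw [Finset.insert_inter_of_mem heF, Finset.insert_sdiff_of_mem _ heF, ← mul_assoc,
        ← mul_assoc]
      refine mul_le_mul_of_nonneg_right ?_ (by positivity)
      exact h e heF ω hω _ Finset.inter_subset_right (Finset.inter_subset_inter_right hωω)
        fun h => heω' (Finset.inter_subset_left h)
    · rw [Finset.insert_inter_of_notMem heF, Finset.insert_sdiff_of_notMem _ heF,
        Finset.card_insert_of_notMem (by simp [heω']), pow_succ]
      have := h' e he ω hω fun h => heω' (hωω h)
      calc _ ≤ f₁ ω * t * (f₂ (ω' ∩ F₂) * t ^ (ω' \ F₂).card) :=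
            mul_le_mul_of_nonneg_right this (mul_nonneg (h₂ _).le (by positivity))
        _ = _ := by ring

end

section

variable {α : Type*}

open Classical in
/-- The probability of `A` under the measure on the subsets of `F` with weights `f`. -/
def mean (F : Finset α) (f : Finset α → ℝ) (A : Finset α → Prop) : ℝ :=
  (∑ ω ∈ F.powerset with A ω, f ω) / ∑ ω ∈ F.powerset, f ω

variable {F : Finset α} {f : Finset α → ℝ}

theorem mean_mono (hf : ∀ ω, 0 ≤ f ω) {A A' : Finset α → Prop}
    (h : ∀ ω ⊆ F, A ω → A' ω) : mean F f A ≤ mean F f A' := by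
  classical
  unfold mean
  refine div_le_div_of_nonneg_right ?_ (Finset.sum_nonneg fun ω _ => hf ω)
  refine Finset.sum_le_sum_of_subset_of_nonneg (fun ω hω => ?_) fun ω _ _ => hf ω
  rw [Finset.mem_filter] at hω ⊢
  exact ⟨hω.1, h ω (Finset.mem_powerset.1 hω.1) hω.2⟩

theorem mean_nonneg (hf : ∀ ω, 0 ≤ f ω) (A : Finset α → Prop) : 0 ≤ mean F f A := 
  div_nonneg (Finset.sum_nonneg fun ω _ => hf ω) (Finset.sum_nonneg fun ω _ => hf ω)

theorem mean_le_one (hf : ∀ ω, 0 ≤ f ω) (A : Finset α → Prop) : mean F f A ≤ 1 := by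
  classical
  refine div_le_one_of_le₀ ?_ (Finset.sum_nonneg fun ω _ => hf ω)
  exact Finset.sum_le_sum_of_subset_of_nonneg (Finset.filter_subset _ _) fun ω _ _ => hf ω

theorem mean_or_le (hf : ∀ ω, 0 ≤ f ω) (A A' : Finset α → Prop) :
    mean F f (fun ω => A ω ∨ A' ω) ≤ mean F f A + mean F f A' := by
  classical
  unfold mean
  rw [← add_div]
  refine div_le_div_of_nonneg_right ?_ (Finset.sum_nonneg fun ω _ => hf ω)
  rw [Finset.sum_filter, Finset.sum_filter, Finset.sum_filter, ← Finset.sum_add_distrib]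
  refine Finset.sum_le_sum fun ω _ => ?_
  have := hf ω
  by_cases h1 : A ω <;> by_cases h2 : A' ω <;> simp [h1, h2, this]

theorem mean_not (h : 0 < ∑ ω ∈ F.powerset, f ω) (A : Finset α → Prop) :
    mean F f (fun ω => ¬ A ω) = 1 - mean F f A := by
  classical
  unfold mean
  rw [eq_sub_iff_add_eq, ← add_div, add_comm, Finset.sum_filter_add_sum_filter_not,
    div_self h.ne']

theorem sum_powerset_pos (hf : ∀ ω, 0 < f ω) : 0 < ∑ ω ∈ F.powerset, f ω :=
  Finset.sum_pos (fun ω _ => hf ω) ⟨∅, Finset.empty_mem_powerset F⟩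

variable [DecidableEq α]

theorem mean_le_mean {F₁ F₂ : Finset α} (hF : F₁ ⊆ F₂) {f₁ f₂ : Finset α → ℝ}
    (h₁ : ∀ a, 0 < f₁ a) (h₂ : ∀ a, 0 ≤ f₂ a) (hpos : 0 < ∑ ω ∈ F₂.powerset, f₂ ω)
    (h : ∀ e ∈ F₁, ∀ ω ⊆ F₁, ∀ ω' ⊆ F₂, ω ⊆ ω' → e ∉ ω' →
      f₁ (insert e ω) * f₂ ω' ≤ f₁ ω * f₂ (insert e ω')) {A : Finset α → Prop}
    (hA : ∀ a b, a ⊆ b → A a → A b) : mean F₁ f₁ A ≤ mean F₂ f₂ A := by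
  have key := holley_sum hF h₁ h₂ h hA
  unfold mean
  rw [div_le_div_iff₀ (sum_powerset_pos h₁) hpos]
  linarith

theorem mean_le_mean_of_subset {F₁ F₂ : Finset α} (hF : F₂ ⊆ F₁) {f₁ f₂ : Finset α → ℝ}
    (h₁ : ∀ a, 0 < f₁ a) (h₂ : ∀ a, 0 < f₂ a) {t : ℝ} (ht : 0 < t)
    (h : ∀ e ∈ F₂, ∀ ω ⊆ F₁, ∀ ω' ⊆ F₂, ω ∩ F₂ ⊆ ω' → e ∉ ω' →
      f₁ (insert e ω) * f₂ ω' ≤ f₁ ω * f₂ (insert e ω'))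
    (h' : ∀ e ∈ F₁, ∀ ω ⊆ F₁, e ∉ ω → f₁ (insert e ω) ≤ f₁ ω * t) {A : Finset α → Prop}
    (hA : ∀ a b, a ⊆ b → A a → A b) : mean F₁ f₁ (fun ω => A (ω ∩ F₂)) ≤ mean F₂ f₂ A := by
  have key := holley_sum_of_subset hF h₁ h₂ ht h h' hA
  unfold mean
  rw [div_le_div_iff₀ (sum_powerset_pos h₁) (sum_powerset_pos h₂)]
  linarith

end

/-! ### Conditional probabilities in the wired model -/

open Classical in
/-- The weights of the wired model restricted to the event `C`. -/
def condWeight (R : Finset (ℤ × ℤ)) (p q : ℝ) (C : Set (Finset (Sym2 (ℤ × ℤ))))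
    (ω : Finset (Sym2 (ℤ × ℤ))) : ℝ := if ω ∈ C then weight R p q ω else 0

section

variable {R : Finset (ℤ × ℤ)} {p q : ℝ} {A C : Set (Finset (Sym2 (ℤ × ℤ)))}

theorem condProb_eq_mean (hp0 : 0 < p) (hp1 : p < 1) (hq : 0 < q) :
    condProb R p q A C = mean (edges R) (condWeight R p q C) (· ∈ A) := by
  have hZ : (∑ ω ∈ (edges R).powerset, weight R p q ω) ≠ 0 :=
    (sum_powerset_pos (weight_pos hp0 hp1 hq)).ne'
  unfold condProb prob mean condWeight
  rw [div_div_div_cancel_right₀ hZ, ← Finset.sum_filter, ← Finset.sum_filter,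
    Finset.filter_filter]
  congr 1
  exact Finset.sum_congr (by ext ω; simp) fun _ _ => rfl

/-- The unconditional inequality becomes the case of the sure event, which trivially ignores the
edges of the domain. -/
theorem prob_eq_condProb (hp0 : 0 < p) (hp1 : p < 1) (hq : 0 < q) :
    prob R p q A = condProb R p q A Set.univ := by
  have hZ : (∑ ω ∈ (edges R).powerset, weight R p q ω) ≠ 0 :=
    (sum_powerset_pos (weight_pos hp0 hp1 hq)).ne'
  unfold condProb prob
  simp only [Set.inter_univ, Set.mem_univ, Finset.filter_true, div_self hZ, div_one]
  congr 1
  exact Finset.sum_congr (by ext ω; simp) fun _ _ => rfl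

theorem condWeight_nonneg (hp0 : 0 < p) (hp1 : p < 1) (hq : 0 < q) (ω : Finset (Sym2 (ℤ × ℤ))) :
    0 ≤ condWeight R p q C ω := by
  unfold condWeight
  split_ifs
  · exact (weight_pos hp0 hp1 hq ω).le
  · exact le_rfl

theorem sum_condWeight_pos (hp0 : 0 < p) (hp1 : p < 1) (hq : 0 < q)
    (hC : ∃ ω ⊆ edges R, ω ∈ C) : 0 < ∑ ω ∈ (edges R).powerset, condWeight R p q C ω := by
  obtain ⟨ω, h1, h2⟩ := hC
  refine Finset.sum_pos' (fun ω _ => condWeight_nonneg hp0 hp1 hq ω)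
    ⟨ω, Finset.mem_powerset.2 h1, ?_⟩
  rw [condWeight, if_pos h2]
  exact weight_pos hp0 hp1 hq ω

/-- `a ^ 2 = q` and `p` is at least the self-dual value `a / (1 + a)`. -/
structure SupDual (a p q : ℝ) : Prop where
  one_le : 1 ≤ a
  sq : a ^ 2 = q
  le : a ≤ p * (1 + a)
  lt_one : p < 1

theorem SupDual.pos {a : ℝ} (h : SupDual a p q) : 0 < p := by
  have h1 := h.one_le
  have h2 := h.le
  by_contra h3
  nlinarith

theorem SupDual.q_pos {a : ℝ} (h : SupDual a p q) : 0 < q := by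
  rw [← h.sq]
  have := h.one_le
  positivity

/-- Opening an edge multiplies the weight by at least `1 / a`, and by at least `a` when the ends of
the edge are connected already. -/
theorem SupDual.weight_le {a : ℝ} (h : SupDual a p q) {ω : Finset (Sym2 (ℤ × ℤ))}
    (hω : ω ⊆ edges R) {u w : R} (he : s((u : ℤ × ℤ), (w : ℤ × ℤ)) ∈ edges R)
    (heω : s((u : ℤ × ℤ), (w : ℤ × ℤ)) ∉ ω) :
    weight R p q ω ≤ a * weight R p q (insert s((u : ℤ × ℤ), (w : ℤ × ℤ)) ω) ∧
    ((wiredGraph R ω).Reachable u w →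
      a * weight R p q ω ≤ weight R p q (insert s((u : ℤ × ℤ), (w : ℤ × ℤ)) ω)) := by
  have ha := h.one_le
  have hp := h.lt_one
  have hle := h.le
  have hw := weight_pos (R := R) h.pos hp h.q_pos ω
  have hw' := weight_pos (R := R) h.pos hp h.q_pos (insert s((u : ℤ × ℤ), (w : ℤ × ℤ)) ω)
  obtain ⟨h1, h2⟩ := weight_insert (p := p) (q := q) hω he heω
  set W := weight R p q ω
  set W' := weight R p q (insert s((u : ℤ × ℤ), (w : ℤ × ℤ)) ω)
  -- This is p ≥ p_sd. It gives p / (1 - p) ≥ a for an edge between connected ends, and p / ((1 - p)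
  -- q) ≥ 1 / a otherwise.
  have h3 : a * (1 - p) ≤ p := by linarith
  have hp1 : 0 < 1 - p := by linarith
  have key : (wiredGraph R ω).Reachable u w → a * W ≤ W' := by
    intro hr
    refine le_of_mul_le_mul_right ?_ hp1
    rw [h1 hr]
    nlinarith
  refine ⟨?_, key⟩
  by_cases hr : (wiredGraph R ω).Reachable u w
  · have := key hr
    nlinarith
  · have h4 := h2 hr
    rw [← h.sq] at h4
    refine le_of_mul_le_mul_right ?_ (show 0 < a * (1 - p) by positivity)
    nlinarith

/-- The weights restricted to an event which does not depend on the edges of `F`. -/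
theorem SupDual.condWeight_le {a : ℝ} (h : SupDual a p q) {u w : R}
    (hC : ∀ ω, insert s((u : ℤ × ℤ), (w : ℤ × ℤ)) ω ∈ C ↔ ω ∈ C)
    {ω : Finset (Sym2 (ℤ × ℤ))} (hω : ω ⊆ edges R)
    (he : s((u : ℤ × ℤ), (w : ℤ × ℤ)) ∈ edges R) (heω : s((u : ℤ × ℤ), (w : ℤ × ℤ)) ∉ ω) :
    condWeight R p q C ω ≤ a * condWeight R p q C (insert s((u : ℤ × ℤ), (w : ℤ × ℤ)) ω) ∧
    ((wiredGraph R ω).Reachable u w →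
      a * condWeight R p q C ω ≤ condWeight R p q C (insert s((u : ℤ × ℤ), (w : ℤ × ℤ)) ω)) := by
  unfold condWeight
  by_cases hc : ω ∈ C
  · rw [if_pos hc, if_pos ((hC ω).2 hc)]
    exact h.weight_le hω he heω
  · rw [if_neg hc, if_neg fun h => hc ((hC ω).1 h)]
    simp

end

theorem wiredGraph_reachable {R : Finset (ℤ × ℤ)} {ω ω' : Finset (Sym2 (ℤ × ℤ))}
    (h : ∀ x y, s(x, y) ∈ ω → x ∈ R ∧ y ∈ R ∧ (s(x, y) ∈ ω' ∨ x ∈ bdry R ∧ y ∈ bdry R))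
    {u w : R} (hr : (openGraph ω).Reachable (u : ℤ × ℤ) w) : (wiredGraph R ω').Reachable u w := by
  have key : ∀ y, (openGraph ω).Reachable (u : ℤ × ℤ) y → ∃ hy : y ∈ R,
      (wiredGraph R ω').Reachable u ⟨y, hy⟩ := by
    intro y hy
    rw [SimpleGraph.reachable_iff_reflTransGen] at hy
    induction hy with
    | refl => exact ⟨u.2, SimpleGraph.Reachable.refl _⟩
    | @tail x y _ h1 ih =>
      obtain ⟨hx, ih⟩ := ih
      rw [openGraph, SimpleGraph.fromEdgeSet_adj] at h1
      obtain ⟨-, hy, h2⟩ := h x y h1.1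
      refine ⟨hy, ih.trans (SimpleGraph.Adj.reachable ?_)⟩
      rw [wiredGraph, SimpleGraph.fromRel_adj]
      refine ⟨fun h => h1.2 (congrArg Subtype.val h), Or.inl h2⟩
  exact (key w hr).2

theorem mem_rect {n m : ℕ} {v : ℤ × ℤ} :
    v ∈ rect n m ↔ (-(m : ℤ) ≤ v.1 ∧ v.1 ≤ m) ∧ 0 ≤ v.2 ∧ v.2 ≤ n := by
  simp [rect]

theorem mem_bdry_rect {n m : ℕ} {v : ℤ × ℤ} (hv : v ∈ rect n m)
    (h : v.2 = 0 ∨ v.2 = n ∨ v.1 = -m) : v ∈ bdry (rect n m) := by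
  obtain ⟨x, y⟩ := v
  refine ⟨hv, ?_⟩
  simp only at h
  rcases h with rfl | rfl | rfl
  · exact ⟨(x, -1), by simp [lattice], by simp [mem_rect]⟩
  · exact ⟨(x, n + 1), by simp [lattice], by simp [mem_rect]⟩
  · exact ⟨(-m - 1, y), by simp [lattice], by simp [mem_rect]⟩

theorem edges_mono {R R' : Finset (ℤ × ℤ)} (h : R ⊆ R') : edges R ⊆ edges R' := by
  intro e he
  induction e using Sym2.ind with
  | _ u w =>
  rw [mem_edges] at he ⊢
  exact ⟨h he.1, h he.2.1, he.2.2⟩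

/-- Conditionally on an event which does not depend on the edges of the domain, the wired measure
dominates the self-dual one on the domain. -/
theorem SupDual.mean_le_condProb {a p q : ℝ} (h : SupDual a p q) {n m : ℕ} {V : Finset (ℤ × ℤ)}
    (hV : V ⊆ rect n m) {A C : Set (Finset (Sym2 (ℤ × ℤ)))}
    (hC : ∀ u w ω, s(u, w) ∈ edges V → (insert s(u, w) ω ∈ C ↔ ω ∈ C))
    (hC' : ∃ ω ⊆ edges (rect n m), ω ∈ C) (hA : ∀ ω ω', ω ⊆ ω' → ω ∈ A → ω' ∈ A) :
    mean (freeEdges n m V) (fkWeight a V (arcEdges n m V)) (· ∈ A) ≤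
      condProb (rect n m) p q A C := by
  have ha : 0 < a := zero_lt_one.trans_le h.one_le
  rw [condProb_eq_mean h.pos h.lt_one h.q_pos]
  have hFE : freeEdges n m V ⊆ edges V := Finset.sdiff_subset
  refine mean_le_mean (hFE.trans (edges_mono hV)) (fkWeight_pos ha V _)
    (condWeight_nonneg h.pos h.lt_one h.q_pos) (sum_condWeight_pos h.pos h.lt_one h.q_pos hC') ?_ hA
  intro e he ω hω ω' hω' hωω heω
  induction e using Sym2.ind with
  | _ u w =>
  have heV := hFE he
  have heR := edges_mono hV heV
  have hu := (mem_edges.1 heR).1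
  have hw := (mem_edges.1 heR).2.1
  obtain ⟨k1, k2⟩ := h.condWeight_le (u := ⟨u, hu⟩) (w := ⟨w, hw⟩) (fun ω => hC u w ω heV)
    hω' heR heω
  obtain ⟨l1, l2⟩ := selfDual_fkWeight (a := a) hFE ω hω u w he fun h => heω (hωω h)
  have hp := fkWeight_pos ha V (arcEdges n m V) ω
  have hp' := fkWeight_pos ha V (arcEdges n m V) (insert s(u, w) ω)
  by_cases hr : (openGraph (ω ∪ arcEdges n m V)).Reachable u w
  -- Arc edges need not be open in `ω'`, but their ends are boundary vertices of the rectangle and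
  -- hence are wired together.
  · have hr' : (wiredGraph (rect n m) ω').Reachable ⟨u, hu⟩ ⟨w, hw⟩ := by
      refine wiredGraph_reachable (ω := ω ∪ arcEdges n m V) (fun x y hxy => ?_) hr
      have h1 := mem_edges.1 (union_arc_subset hω hxy)
      refine ⟨hV h1.1, hV h1.2.1, ?_⟩
      rcases Finset.mem_union.1 hxy with h2 | h2
      · exact Or.inl (hωω h2)
      · have h3 : (∀ v ∈ s(x, y), v.2 = 0) ∨ (∀ v ∈ s(x, y), v.2 = n) ∨ ∀ v ∈ s(x, y), v.1 = -m := by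
          classical exact (Finset.mem_filter.1 h2).2
        simp only [Sym2.mem_iff, forall_eq_or_imp, forall_eq] at h3
        exact Or.inr ⟨mem_bdry_rect (hV h1.1) (by tauto), mem_bdry_rect (hV h1.2.1) (by tauto)⟩
    have h4 := k2 hr'
    simp only at h4
    rw [l1 hr]
    nlinarith
  · have h4 := l2 hr
    simp only at k1
    rw [h4]
    nlinarith

/-- The version of the domination for decreasing events. -/
theorem SupDual.condProb_le_mean {a p q : ℝ} (h : SupDual a p q) {n m : ℕ} {V : Finset (ℤ × ℤ)}
    (hV : V ⊆ rect n m) {A C : Set (Finset (Sym2 (ℤ × ℤ)))}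
    (hC : ∀ u w ω, s(u, w) ∈ edges V → (insert s(u, w) ω ∈ C ↔ ω ∈ C))
    (hC' : ∃ ω ⊆ edges (rect n m), ω ∈ C) (hA : ∀ ω ω', ω ⊆ ω' → ω' ∈ A → ω ∈ A) :
    condProb (rect n m) p q A C ≤
      mean (freeEdges n m V) (fkWeight a V (arcEdges n m V)) (· ∈ A) := by
  have ha : 0 < a := zero_lt_one.trans_le h.one_le
  have key := h.mean_le_condProb hV hC hC' (A := Aᶜ) fun ω ω' h1 h2 h3 => h2 (hA ω ω' h1 h3)
  rw [condProb_eq_mean h.pos h.lt_one h.q_pos] at key ⊢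
  simp only [Set.mem_compl_iff] at key
  rw [mean_not (sum_powerset_pos (fkWeight_pos ha V _)),
    mean_not (sum_condWeight_pos h.pos h.lt_one h.q_pos hC')] at key
  linarith

/-- Lower bound for the probability that all edges of `Q` are open. -/
theorem SupDual.pow_le_condProb {a p q : ℝ} (h : SupDual a p q) {n m : ℕ}
    {Q : Finset (Sym2 (ℤ × ℤ))} (hQ : Q ⊆ edges (rect n m)) {A C : Set (Finset (Sym2 (ℤ × ℤ)))}
    (hC : ∀ u w ω, s(u, w) ∈ Q → (insert s(u, w) ω ∈ C ↔ ω ∈ C))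
    (hC' : ∃ ω ⊆ edges (rect n m), ω ∈ C) (hA : ∀ ω, Q ⊆ ω → ω ∈ A) :
    (1 / (1 + a)) ^ Q.card ≤ condProb (rect n m) p q A C := by
  have ha : 0 < a := zero_lt_one.trans_le h.one_le
  rw [condProb_eq_mean h.pos h.lt_one h.q_pos]
  -- Opening an edge changes the weight by a factor of at least 1 / a, so the edges of `Q` dominate
  -- independent ones open with probability 1 / (1 + a).
  have key := mean_le_mean hQ (f₁ := fun ω => (1 / a) ^ ω.card) (fun ω => by positivity)
    (condWeight_nonneg h.pos h.lt_one h.q_pos) (sum_condWeight_pos h.pos h.lt_one h.q_pos hC')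
    (fun e he ω hω ω' hω' hωω heω => ?_) (A := fun ω => Q ⊆ ω)
    (fun a b hab h => h.trans hab)
  · refine le_trans (le_of_eq ?_) (key.trans
      (mean_mono (condWeight_nonneg h.pos h.lt_one h.q_pos) fun ω _ => hA ω))
    have h1 : Q.powerset.filter (fun ω => Q ⊆ ω) = {Q} := by
      ext ω
      simp only [Finset.mem_filter, Finset.mem_powerset, Finset.mem_singleton]
      exact ⟨fun h => h.1.antisymm h.2, fun h => by simp [h]⟩
    have h2 := sum_powerset_marginal (Finset.empty_subset Q) (fun _ => (1 : ℝ)) (1 / a)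
    simp only [Finset.sdiff_empty, one_mul, Finset.powerset_empty, Finset.sum_singleton] at h2
    unfold mean
    rw [h2]
    have h3 : ∀ inst : DecidablePred fun ω => Q ⊆ ω, ∑ ω ∈ @Finset.filter _ (fun ω => Q ⊆ ω) inst Q.powerset,
      (1 / a) ^ ω.card = (1 / a) ^ Q.card := by
      intro inst
      rw [show @Finset.filter _ (fun ω => Q ⊆ ω) inst Q.powerset = {Q} by convert h1]
      simp
    rw [h3, ← div_pow]
    congr 1
    field_simp
    ring
  · induction e using Sym2.ind with
    | _ u w =>
    have heR := hQ he
    have hu := (mem_edges.1 heR).1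
    have hw := (mem_edges.1 heR).2.1
    obtain ⟨k1, -⟩ := h.condWeight_le (u := ⟨u, hu⟩) (w := ⟨w, hw⟩) (fun ω => hC u w ω he)
      hω' heR heω
    rw [Finset.card_insert_of_notMem fun h => heω (hωω h), pow_succ, mul_assoc]
    refine mul_le_mul_of_nonneg_left ?_ (by positivity)
    rw [one_div, inv_mul_le_iff₀ ha]
    exact k1

/-! ### The event `𝒮 = S` -/

theorem connIn_adj {ω : Finset (Sym2 (ℤ × ℤ))} {A : Set (ℤ × ℤ)} {u v : ℤ × ℤ} :
    (SimpleGraph.fromEdgeSet {e | e ∈ ω ∧ ∀ w ∈ e, w ∈ A}).Adj u v ↔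
      s(u, v) ∈ ω ∧ u ∈ A ∧ v ∈ A ∧ u ≠ v := by
  simp only [SimpleGraph.fromEdgeSet_adj, Set.mem_ofPred_eq, Sym2.mem_iff, forall_eq_or_imp,
    forall_eq, and_assoc, ne_eq]

theorem ConnIn.mem {ω : Finset (Sym2 (ℤ × ℤ))} {A T : Set (ℤ × ℤ)} {x y : ℤ × ℤ}
    (h : ∀ u v, s(u, v) ∈ ω → u ∈ A → v ∈ A → u ∈ T → v ∈ T) (hxy : ConnIn ω A x y)
    (hx : x ∈ T) : y ∈ T := by
  rw [ConnIn, SimpleGraph.reachable_iff_reflTransGen] at hxy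
  induction hxy with
  | refl => exact hx
  | tail _ h1 ih =>
    rw [connIn_adj] at h1
    exact h _ _ h1.1 h1.2.1 h1.2.2.1 ih

theorem ConnIn.mono {ω ω' : Finset (Sym2 (ℤ × ℤ))} {A A' : Set (ℤ × ℤ)} {x y : ℤ × ℤ}
    (hω : ω ⊆ ω') (hA : A ⊆ A') (h : ConnIn ω A x y) : ConnIn ω' A' x y :=
  SimpleGraph.Reachable.mono (fun u v h => by
    rw [connIn_adj] at h ⊢
    exact ⟨hω h.1, hA h.2.1, hA h.2.2.1, h.2.2.2⟩) h

/-- The event splits into closedness of the edges leaving S, and connections to the right boundary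
that avoid S. Neither condition involves an edge inside S, which is what makes the domination
usable. -/
theorem mem_evS_iff {n m : ℕ} {S : Set (ℤ × ℤ)} (hS : Disjoint S (bdryRight n))
    {ω : Finset (Sym2 (ℤ × ℤ))} : ω ∈ evS n m S ↔
      (∀ u v, s(u, v) ∈ ω → u ∈ rect n m → v ∈ rect n m → u ∈ S → v ∈ S) ∧
      ∀ x ∈ rect n m, x ∉ S →
        ∃ y ∈ bdryRight n, y ∈ rect n m ∧ ConnIn ω (↑(rect n m) \ S) x y := by
  have hcal : ∀ x ∈ rect n m, (x ∈ calS n m ω ↔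
      ¬ ∃ y ∈ bdryRight n, y ∈ rect n m ∧ ConnIn ω (rect n m) x y) := fun x hx => by
    simp [calS, hx]
  constructor
  · intro h
    have h' : ∀ x ∈ rect n m, (x ∈ S ↔
        ¬ ∃ y ∈ bdryRight n, y ∈ rect n m ∧ ConnIn ω (rect n m) x y) := by
      intro x hx
      rw [← hcal x hx, show calS n m ω = S ∩ rect n m from h]
      simp [hx]
    have h1 : ∀ u v, s(u, v) ∈ ω → u ∈ rect n m → v ∈ rect n m → u ∈ S → v ∈ S := by
      intro u v huv hu hv huS
      by_contra hvS
      rw [h' v hv, not_not] at hvS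
      obtain ⟨y, hy, hyr, hc⟩ := hvS
      by_cases hne : u = v
      · exact (h' u hu).1 huS ⟨y, hy, hyr, hne ▸ hc⟩
      · exact (h' u hu).1 huS ⟨y, hy, hyr,
          (SimpleGraph.Adj.reachable (connIn_adj.2 ⟨huv, hu, hv, hne⟩)).trans hc⟩
    refine ⟨h1, fun x hx hxS => ?_⟩
    have h2 := hxS
    rw [h' x hx, not_not] at h2
    obtain ⟨y, hy, hyr, hc⟩ := h2
    refine ⟨y, hy, hyr, ?_⟩
    have key : y ∈ {z | z ∉ S ∧ ConnIn ω (↑(rect n m) \ S) x z} := by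
      refine ConnIn.mem (fun u v huv hu hv h3 => ?_) hc ⟨hxS, SimpleGraph.Reachable.refl _⟩
      have hvS : v ∉ S := fun h => h3.1 (h1 v u (Sym2.eq_swap ▸ huv) hv hu h)
      refine ⟨hvS, ?_⟩
      by_cases hne : u = v
      · exact hne ▸ h3.2
      · exact SimpleGraph.Reachable.trans h3.2
          (SimpleGraph.Adj.reachable (connIn_adj.2 ⟨huv, ⟨hu, h3.1⟩, ⟨hv, hvS⟩, hne⟩))
    exact key.2
  · rintro ⟨h1, h2⟩
    ext x
    by_cases hx : x ∈ rect n m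
    · rw [hcal x hx]
      simp only [Set.mem_inter_iff, Finset.mem_coe, hx, and_true]
      constructor
      · intro h3
        by_contra hxS
        obtain ⟨y, hy, hyr, hc⟩ := h2 x hx hxS
        exact h3 ⟨y, hy, hyr, hc.mono Finset.Subset.rfl Set.sdiff_subset⟩
      · rintro hxS ⟨y, hy, hyr, hc⟩
        exact Set.disjoint_left.1 hS (hc.mem (T := S) h1 hxS) hy
    · simp [calS, hx]

/-- The event `𝒮 = S` does not depend on the edges inside `S`. -/
theorem insert_mem_evS {n m : ℕ} {S : Set (ℤ × ℤ)} (hS : Disjoint S (bdryRight n))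
    {u w : ℤ × ℤ} (hu : u ∈ S) (hw : w ∈ S) (ω : Finset (Sym2 (ℤ × ℤ))) :
    insert s(u, w) ω ∈ evS n m S ↔ ω ∈ evS n m S := by
  have hset : {e : Sym2 (ℤ × ℤ) | e ∈ insert s(u, w) ω ∧ ∀ z ∈ e, z ∈ ↑(rect n m) \ S} =
      {e | e ∈ ω ∧ ∀ z ∈ e, z ∈ ↑(rect n m) \ S} := by
    ext e
    simp only [Finset.mem_insert, Set.mem_ofPred_eq]
    refine ⟨?_, fun h => ⟨Or.inr h.1, h.2⟩⟩
    rintro ⟨rfl | h, h'⟩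
    · exact absurd hu (h' u (Sym2.mem_mk_left u w)).2
    · exact ⟨h, h'⟩
  rw [mem_evS_iff hS, mem_evS_iff hS]
  unfold ConnIn
  rw [hset]
  refine and_congr_left fun _ => ⟨fun h x y hxy => h x y (Finset.mem_insert_of_mem hxy),
    fun h x y hxy => ?_⟩
  rcases Finset.mem_insert.1 hxy with h1 | h1
  · rcases Sym2.eq_iff.1 h1 with ⟨rfl, rfl⟩ | ⟨rfl, rfl⟩
    · exact fun _ _ _ => hw
    · exact fun _ _ _ => hu
  · exact h x y h1

/-! ### The domain given by `S` -/

open Classical in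
/-- The part of `S` in `[-m, min m M] × [0, n]`. -/
def dom (n : ℕ) (S : Set (ℤ × ℤ)) (M m : ℕ) : Finset (ℤ × ℤ) :=
  (rect n m).filter fun v => v ∈ S ∧ v.1 ≤ M

theorem mem_dom {n : ℕ} {S : Set (ℤ × ℤ)} {M m : ℕ} {v : ℤ × ℤ} :
    v ∈ dom n S M m ↔ v ∈ rect n m ∧ v ∈ S ∧ v.1 ≤ M := by
  simp [dom]

theorem dom_subset {n : ℕ} {S : Set (ℤ × ℤ)} {M m : ℕ} : dom n S M m ⊆ rect n m :=
  fun _ h => (mem_dom.1 h).1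

/-- `S` is a part of the strip which contains the left part of the boundary but does not meet the
right part, and contains the part of the strip to the left of `-K`. -/
structure IsStripSet (n : ℕ) (S : Set (ℤ × ℤ)) (K : ℕ) : Prop where
  one_le : 1 ≤ n
  left : bdryLeft n ⊆ S
  right : Disjoint S (bdryRight n)
  full : ∀ x y : ℤ, x ≤ -K → 0 ≤ y → y ≤ n → (x, y) ∈ S

theorem IsStripSet.isDomain {n : ℕ} {S : Set (ℤ × ℤ)} {K : ℕ} (hS : IsStripSet n S K) (M : ℕ)
    {m : ℕ} (hm : 1 ≤ m) (hK : K ≤ m) : IsDomain n m (dom n S M m) where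
  one_le_n := hS.one_le
  one_le_m := hm
  subset v hv := by
    rw [mem_dom, mem_rect] at hv
    tauto
  left y h0 h1 := by
    simp only [mem_dom, mem_rect]
    exact ⟨by omega, hS.full _ _ (by omega) h0 h1, by omega⟩
  bottom x hx := by
    simp only [mem_dom, mem_rect]
    refine ⟨fun h => ?_, fun h => ⟨by omega, hS.left ⟨Or.inl rfl, h⟩, by omega⟩⟩
    by_contra hx0
    exact Set.disjoint_left.1 hS.right h.2.1 ⟨Or.inl rfl, not_lt.1 hx0⟩
  top x hx := by
    simp only [mem_dom, mem_rect]
    refine ⟨fun h => ?_, fun h => ⟨by omega, hS.left ⟨Or.inr rfl, h⟩, by omega⟩⟩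
    by_contra hx0
    exact Set.disjoint_left.1 hS.right h.2.1 ⟨Or.inr rfl, not_lt.1 hx0⟩

theorem mem_arcEdges {n m : ℕ} {V : Finset (ℤ × ℤ)} {u w : ℤ × ℤ} :
    s(u, w) ∈ arcEdges n m V ↔ s(u, w) ∈ edges V ∧
      (u.2 = 0 ∧ w.2 = 0 ∨ u.2 = n ∧ w.2 = n ∨ u.1 = -m ∧ w.1 = -m) := by
  simp [arcEdges]

section

variable {n : ℕ} {S : Set (ℤ × ℤ)} {M m m' : ℕ}

theorem mem_dom_of_le {v : ℤ × ℤ} (hv : v ∈ dom n S M m') (h : -(m : ℤ) ≤ v.1)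
    (h' : v.1 ≤ m) : v ∈ dom n S M m := by
  rw [mem_dom, mem_rect] at hv ⊢
  tauto

theorem freeEdges_dom_mono (h : m ≤ m') :
    freeEdges n m (dom n S M m) ⊆ freeEdges n m' (dom n S M m') := by
  intro e he
  induction e using Sym2.ind with
  | _ u w =>
  simp only [freeEdges, Finset.mem_sdiff, mem_arcEdges, mem_edges, mem_dom, mem_rect] at he ⊢
  grind

variable {ω ω' : Finset (Sym2 (ℤ × ℤ))}

/-- Moving the left side of the domain to the right increases the connections. -/
theorem reachable_clamp (hMm : M ≤ m) (h : m ≤ m') (hV : IsDomain n m (dom n S M m))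
    (hω : ω ⊆ freeEdges n m' (dom n S M m'))
    (hωω : ω ∩ freeEdges n m (dom n S M m) ⊆ ω') {x y : ℤ × ℤ}
    (hxy : (openGraph (ω ∪ arcEdges n m' (dom n S M m'))).Reachable x y) :
    (openGraph (ω' ∪ arcEdges n m (dom n S M m))).Reachable
      (max x.1 (-m), x.2) (max y.1 (-m), y.2) := by
  have hedge : ∀ u w, s(u, w) ∈ ω ∪ arcEdges n m' (dom n S M m') → -(m : ℤ) ≤ u.1 →
      -(m : ℤ) ≤ w.1 → s(u, w) ∈ ω' ∪ arcEdges n m (dom n S M m) := by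
    intro u w he hu hw
    have h1 := mem_edges.1 (union_arc_subset hω he)
    have h2 : s(u, w) ∈ edges (dom n S M m) := by
      rw [mem_edges]
      have h3 := mem_dom.1 h1.1
      have h4 := mem_dom.1 h1.2.1
      exact ⟨mem_dom_of_le h1.1 hu (by omega), mem_dom_of_le h1.2.1 hw (by omega), h1.2.2⟩
    rw [Finset.mem_union]
    by_cases h3 : s(u, w) ∈ arcEdges n m (dom n S M m)
    · exact Or.inr h3
    · rcases Finset.mem_union.1 he with h4 | h4
      · exact Or.inl (hωω (Finset.mem_inter.2 ⟨h4, Finset.mem_sdiff.2 ⟨h2, h3⟩⟩))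
      · refine absurd (mem_arcEdges.2 ⟨h2, ?_⟩) h3
        have := (mem_arcEdges.1 h4).2
        omega
  -- Under the projection x ↦ max(x, -m), an edge with an end to the left of x = -m either collapses
  -- to a point or lands on the new left side, which is wired.
  have hcol : ∀ y : ℤ, 0 ≤ y → y + 1 ≤ n →
      (openGraph (ω' ∪ arcEdges n m (dom n S M m))).Reachable (-(m : ℤ), y) (-(m : ℤ), y + 1) := by
    intro y h0 h1
    refine SimpleGraph.Adj.reachable ?_
    rw [openGraph, SimpleGraph.fromEdgeSet_adj]
    refine ⟨Finset.mem_coe.2 (Finset.mem_union_right _ (mem_arcEdges.2 ⟨mem_edges.2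
      ⟨hV.left y h0 (by omega), hV.left (y + 1) (by omega) h1, by simp [lattice]⟩, by simp⟩)),
      by simp⟩
  have hadj : ∀ u w, s(u, w) ∈ ω ∪ arcEdges n m' (dom n S M m') → u ≠ w →
      (openGraph (ω' ∪ arcEdges n m (dom n S M m))).Reachable
      (max u.1 (-m), u.2) (max w.1 (-m), w.2) := by
    intro u w he hne
    by_cases hlt : -(m : ℤ) ≤ u.1 ∧ -(m : ℤ) ≤ w.1
    · rw [max_eq_left hlt.1, max_eq_left hlt.2]
      refine SimpleGraph.Adj.reachable ?_
      rw [openGraph, SimpleGraph.fromEdgeSet_adj]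
      exact ⟨hedge u w he hlt.1 hlt.2, hne⟩
    · have h1 := mem_edges.1 (union_arc_subset hω he)
      have h3 := mem_rect.1 (mem_dom.1 h1.1).1
      have h4 := mem_rect.1 (mem_dom.1 h1.2.1).1
      rcases lattice_edge_cases h1.2.2 with ⟨x, y, ⟨rfl, rfl⟩ | ⟨rfl, rfl⟩⟩ |
        ⟨x, y, ⟨rfl, rfl⟩ | ⟨rfl, rfl⟩⟩ <;> simp only at hlt h3 h4 ⊢
      · rw [max_eq_right (by omega), max_eq_right (by omega)]
      · rw [max_eq_right (by omega), max_eq_right (by omega)]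
      · rw [max_eq_right (by omega)]
        exact hcol y (by omega) (by omega)
      · rw [max_eq_right (by omega)]
        exact (hcol y (by omega) (by omega)).symm
  rw [SimpleGraph.reachable_iff_reflTransGen] at hxy
  induction hxy with
  | refl => exact SimpleGraph.Reachable.refl _
  | tail _ h1 ih =>
    rw [openGraph, SimpleGraph.fromEdgeSet_adj] at h1
    exact ih.trans (hadj _ _ (Finset.mem_coe.1 h1.1) h1.2)

theorem reachable_clamp_of_le (hMm : M ≤ m) (h : m ≤ m') (hV : IsDomain n m (dom n S M m))
    (hω : ω ⊆ freeEdges n m' (dom n S M m'))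
    (hωω : ω ∩ freeEdges n m (dom n S M m) ⊆ ω') {x y : ℤ × ℤ} (hx : -(m : ℤ) ≤ x.1)
    (hy : -(m : ℤ) ≤ y.1)
    (hxy : (openGraph (ω ∪ arcEdges n m' (dom n S M m'))).Reachable x y) :
    (openGraph (ω' ∪ arcEdges n m (dom n S M m))).Reachable x y := by
  have := reachable_clamp hMm h hV hω hωω hxy
  rwa [max_eq_left hx, max_eq_left hy] at this

end

theorem fkWeight_insert_le {a : ℝ} (ha : 1 ≤ a) {V : Finset (ℤ × ℤ)}
    {F B : Finset (Sym2 (ℤ × ℤ))} (hF : F ⊆ edges V) {ω : Finset (Sym2 (ℤ × ℤ))} (hω : ω ⊆ F)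
    {e : Sym2 (ℤ × ℤ)} (he : e ∈ F) (heω : e ∉ ω) :
    fkWeight a V B (insert e ω) ≤ a * fkWeight a V B ω ∧
      fkWeight a V B ω ≤ a * fkWeight a V B (insert e ω) := by
  induction e using Sym2.ind with
  | _ u w =>
  obtain ⟨h1, h2⟩ := selfDual_fkWeight (a := a) (B := B) hF ω hω u w he heω
  have hp := fkWeight_pos (zero_lt_one.trans_le ha) V B ω
  have hp' := fkWeight_pos (zero_lt_one.trans_le ha) V B (insert s(u, w) ω)
  by_cases hr : (openGraph (ω ∪ B)).Reachable u w
  · have := h1 hr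
    constructor <;> nlinarith
  · have := h2 hr
    constructor <;> nlinarith

/-- The self-dual measure on the part of `S` in `[-m, M] × [0, n]`, wired along the arc. -/
def sdMean (a : ℝ) (n : ℕ) (S : Set (ℤ × ℤ)) (M m : ℕ) (A : Finset (Sym2 (ℤ × ℤ)) → Prop) : ℝ :=
  mean (freeEdges n m (dom n S M m))
    (fkWeight a (dom n S M m) (arcEdges n m (dom n S M m))) A

/-- Bringing the wired left side closer can only connect more points, by `reachable_clamp`; so
opening a common edge is relatively more favourable in the shorter domain. -/
theorem sdMean_inter_le {a : ℝ} (ha : 1 ≤ a) {n : ℕ} {S : Set (ℤ × ℤ)} {M m m' : ℕ} (hMm : M ≤ m)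
    (h : m ≤ m') (hV : IsDomain n m (dom n S M m)) {A : Finset (Sym2 (ℤ × ℤ)) → Prop}
    (hA : ∀ ω ω', ω ⊆ ω' → A ω → A ω') :
    sdMean a n S M m' (fun ω => A (ω ∩ freeEdges n m (dom n S M m))) ≤ sdMean a n S M m A := by
  have ha0 : 0 < a := zero_lt_one.trans_le ha
  have hF : ∀ m, freeEdges n m (dom n S M m) ⊆ edges (dom n S M m) := fun m => Finset.sdiff_subset
  refine mean_le_mean_of_subset (freeEdges_dom_mono h) (fkWeight_pos ha0 _ _)
    (fkWeight_pos ha0 _ _) ha0 (fun e he ω hω ω' hω' hωω heω => ?_) (fun e he ω hω heω => ?_) hA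
  · have heω' : e ∉ ω := fun h => heω (hωω (Finset.mem_inter.2 ⟨h, he⟩))
    have he' := freeEdges_dom_mono h he
    obtain ⟨k1, k2⟩ := fkWeight_insert_le ha (B := arcEdges n m (dom n S M m)) (hF m) hω' he heω
    have hp' := fkWeight_pos ha0 (dom n S M m') (arcEdges n m' (dom n S M m')) (insert e ω)
    have hp := fkWeight_pos ha0 (dom n S M m) (arcEdges n m (dom n S M m)) ω'
    induction e using Sym2.ind with
    | _ u w =>
    obtain ⟨l1, l2⟩ := selfDual_fkWeight (a := a) (B := arcEdges n m' (dom n S M m')) (hF m') ω hω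
      u w he' heω'
    obtain ⟨l3, l4⟩ := selfDual_fkWeight (a := a) (B := arcEdges n m (dom n S M m)) (hF m) ω' hω'
      u w he heω
    have hmem := mem_edges.1 (hF m he)
    by_cases hr : (openGraph (ω ∪ arcEdges n m' (dom n S M m'))).Reachable u w
    · have hr' := reachable_clamp_of_le hMm h hV hω hωω (hV.subset u hmem.1).1
        (hV.subset w hmem.2.1).1 hr
      rw [l1 hr, l3 hr']
      linarith
    · rw [l2 hr]
      nlinarith
  · have := (fkWeight_insert_le ha (B := arcEdges n m' (dom n S M m')) (hF m') hω he heω).1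
    linarith

/-! ### Dual connections in the rectangle -/

theorem dualGraph_adj {n m : ℕ} {ω : Finset (Sym2 (ℤ × ℤ))} {g h : ℤ × ℤ}
    (hgh : (dualGraph (rect n m) ω).Adj g h) : FaceAdj ω g h ∧
      ((g.1 = h.1 ∧ -(m : ℤ) ≤ g.1 ∧ ((0 ≤ g.2 ∧ g.2 ≤ n ∧ h.2 = g.2 - 1) ∨
          (0 ≤ h.2 ∧ h.2 ≤ n ∧ g.2 = h.2 - 1))) ∨
        (g.2 = h.2 ∧ 0 ≤ g.2 ∧ g.2 < n ∧ ((-(m : ℤ) ≤ g.1 ∧ h.1 = g.1 - 1) ∨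
          (-(m : ℤ) ≤ h.1 ∧ g.1 = h.1 - 1)))) := by
  have key : ∀ g h : ℤ × ℤ, g ≠ h → (∃ u v, s(u, v) ∈ edges (rect n m) ∧ s(u, v) ∉ ω ∧
      IsCorner g u ∧ IsCorner g v ∧ IsCorner h u ∧ IsCorner h v) → FaceAdj ω g h ∧
      ((g.1 = h.1 ∧ -(m : ℤ) ≤ g.1 ∧ ((0 ≤ g.2 ∧ g.2 ≤ n ∧ h.2 = g.2 - 1) ∨
          (0 ≤ h.2 ∧ h.2 ≤ n ∧ g.2 = h.2 - 1))) ∨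
        (g.2 = h.2 ∧ 0 ≤ g.2 ∧ g.2 < n ∧ ((-(m : ℤ) ≤ g.1 ∧ h.1 = g.1 - 1) ∨
          (-(m : ℤ) ≤ h.1 ∧ g.1 = h.1 - 1)))) := by
    rintro ⟨g1, g2⟩ ⟨h1, h2⟩ hne ⟨u, v, huv, hω, c1, c2, c3, c4⟩
    rw [mem_edges, mem_rect, mem_rect] at huv
    obtain ⟨hu, hv, hadj⟩ := huv
    have hd0 : dir 0 = (1, 0) := by simp [dir]
    have hd1 : dir 1 = (0, 1) := by simp [dir]
    have ho0 : off 0 = (0, -1) := by simp [off]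
    have ho1 : off 1 = (0, 0) := by simp [off]
    have ho2 : off 2 = (-1, 0) := by simp [off]
    have hH : ∀ x y : ℤ, s((x, y), (x + 1, y)) ∉ ω → FaceAdj ω (x, y - 1) (x, y) := by
      intro x y h
      refine ⟨((x, y), 0), ?_, ?_, ?_⟩
      · simpa [edge, hd0] using h
      · simp [face, ho0, sub_eq_add_neg]
      · simp [face, ho1]
    have hW : ∀ x y : ℤ, s((x, y), (x, y + 1)) ∉ ω → FaceAdj ω (x, y) (x - 1, y) := by
      intro x y h
      refine ⟨((x, y), 1), ?_, ?_, ?_⟩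
      · simpa [edge, hd1] using h
      · simp [face, ho1]
      · simp [face, ho2, sub_eq_add_neg]
    have hne' : ¬ (g1 = h1 ∧ g2 = h2) := fun h => hne (by rw [h.1, h.2])
    simp only [IsCorner] at *
    rcases lattice_edge_cases hadj with ⟨x, y, ⟨rfl, rfl⟩ | ⟨rfl, rfl⟩⟩ |
        ⟨x, y, ⟨rfl, rfl⟩ | ⟨rfl, rfl⟩⟩ <;> simp only at *
    · obtain ⟨rfl, rfl⟩ : g1 = x ∧ h1 = x := by omega
      have := hH _ _ hω
      obtain ⟨rfl, rfl⟩ | ⟨rfl, rfl⟩ : (g2 = y ∧ h2 = y - 1) ∨ (g2 = y - 1 ∧ h2 = y) := by omega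
      · exact ⟨this.symm, by omega⟩
      · exact ⟨this, by omega⟩
    · rw [Sym2.eq_swap] at hω
      obtain ⟨rfl, rfl⟩ : g1 = x ∧ h1 = x := by omega
      have := hH _ _ hω
      obtain ⟨rfl, rfl⟩ | ⟨rfl, rfl⟩ : (g2 = y ∧ h2 = y - 1) ∨ (g2 = y - 1 ∧ h2 = y) := by omega
      · exact ⟨this.symm, by omega⟩
      · exact ⟨this, by omega⟩
    · obtain ⟨rfl, rfl⟩ : g2 = y ∧ h2 = y := by omega
      have := hW _ _ hω
      obtain ⟨rfl, rfl⟩ | ⟨rfl, rfl⟩ : (g1 = x ∧ h1 = x - 1) ∨ (g1 = x - 1 ∧ h1 = x) := by omega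
      · exact ⟨this, by omega⟩
      · exact ⟨this.symm, by omega⟩
    · rw [Sym2.eq_swap] at hω
      obtain ⟨rfl, rfl⟩ : g2 = y ∧ h2 = y := by omega
      have := hW _ _ hω
      obtain ⟨rfl, rfl⟩ | ⟨rfl, rfl⟩ : (g1 = x ∧ h1 = x - 1) ∨ (g1 = x - 1 ∧ h1 = x) := by omega
      · exact ⟨this, by omega⟩
      · exact ⟨this.symm, by omega⟩
  rw [dualGraph, SimpleGraph.fromRel_adj] at hgh
  rcases hgh with ⟨hne, h1 | ⟨u, v, h1, h2, h3, h4, h5, h6⟩⟩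
  · exact key g h hne h1
  · exact key g h hne ⟨u, v, h1, h2, h5, h6, h3, h4⟩

/-- Faces above, below and to the left of the rectangle have at most one neighbour in the dual
graph. A dual path can enter one only to turn back, so it can be shortened to an inner path. -/
theorem innerConn_of_reachable {n m : ℕ} (hn : 1 ≤ n) {ω : Finset (Sym2 (ℤ × ℤ))}
    {g : ℤ × ℤ} (h : (dualGraph (rect n m) ω).Reachable (-1, -1) g) :
    (InnerFace n m g → InnerConn n m ω g) ∧
      (¬ InnerFace n m g → ∀ g', (dualGraph (rect n m) ω).Adj g g' → InnerConn n m ω g') := by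
  rw [SimpleGraph.reachable_iff_reflTransGen] at h
  induction h with
  | refl =>
    refine ⟨fun h => ?_, fun _ g' hg' => ?_⟩
    · simp [InnerFace] at h
    · have := (dualGraph_adj hg').2
      have hg : g' = (-1, 0) := by
        ext <;> simp only at this ⊢ <;> omega
      rw [hg]
      exact Relation.ReflTransGen.refl
  | @tail g h _ hgh ih =>
    obtain ⟨h1, h2⟩ := dualGraph_adj hgh
    by_cases hg : InnerFace n m g
    · refine ⟨fun hh => (ih.1 hg).tail ⟨h1, hg, hh⟩, fun hh g' hg' => ?_⟩
      have h3 := (dualGraph_adj hg').2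
      have : g' = g := by
        unfold InnerFace at hg hh
        ext <;> omega
      exact this ▸ ih.1 hg
    · have hh := ih.2 hg h hgh
      refine ⟨fun _ => hh, fun hi => ?_⟩
      unfold InnerFace at hg hi
      omega

/-- Of the four faces around (x, 0), the lower two can reach the dual crossing only through the
faces above them. The bound x ≤ -2 keeps the lower faces distinct from the starting face of the
crossing. -/
theorem innerConn_of_mem_evDual {n m : ℕ} (hn : 1 ≤ n) {ω : Finset (Sym2 (ℤ × ℤ))} {x : ℤ}
    (hx : x ≤ -2) (hxm : -(m : ℤ) < x) (h : ω ∈ evDual n m (x, 0)) :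
    InnerConn n m ω (x - 1, 0) ∨ InnerConn n m ω (x, 0) := by
  obtain ⟨P, -, g, hg, f, hf, hfg⟩ := h
  have hr : (dualGraph (rect n m) ω).Reachable (-1, -1) f :=
    (SimpleGraph.Walk.reachable (P.takeUntil g hg)).trans hfg.symm
  obtain ⟨k1, k2⟩ := innerConn_of_reachable hn hr
  obtain ⟨f1, f2⟩ := f
  simp only [IsCorner] at hf
  have hf1 : f1 = x - 1 ∨ f1 = x := by omega
  have goal : InnerConn n m ω (f1, 0) := by
    by_cases hf2 : f2 = 0
    · subst hf2
      exact k1 ⟨by simp only; omega, by simp, by simp only; omega⟩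
    · obtain rfl : f2 = -1 := by omega
      have hne : (f1, -1) ≠ ((-1, -1) : ℤ × ℤ) := by
        intro h
        have := congrArg Prod.fst h
        simp only at this
        omega
      rw [SimpleGraph.reachable_comm, SimpleGraph.reachable_iff_reflTransGen] at hr
      rcases Relation.ReflTransGen.cases_head hr with h1 | ⟨g', h1, -⟩
      · exact absurd h1 hne
      · have h2 := (dualGraph_adj h1).2
        have : g' = (f1, 0) := by
          ext <;> simp only at h2 ⊢ <;> omega
        rw [← this]
        exact k2 (fun h => by simp [InnerFace] at h) g' h1
  rcases hf1 with rfl | rfl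
  · exact Or.inl goal
  · exact Or.inr goal

/-! ### Rare events -/

section

variable {α : Type*} [DecidableEq α]

theorem sdiff_ratio {F : Finset α} {f : Finset α → ℝ} {a : ℝ} (ha : 1 ≤ a)
    (hf : ∀ ω, 0 < f ω) (h : ∀ ω ⊆ F, ∀ e ∈ F, e ∉ ω →
      f (insert e ω) ≤ a * f ω ∧ f ω ≤ a * f (insert e ω)) (Q : Finset α) {ω : Finset α}
    (hω : ω ⊆ F) : f ω ≤ a ^ Q.card * f (ω \ Q) ∧ f (ω \ Q) ≤ a ^ Q.card * f ω := by
  have ha0 : 0 < a := zero_lt_one.trans_le ha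
  induction Q using Finset.induction with
  | empty => simp
  | insert e Q he ih =>
    have hstep : f (ω \ Q) ≤ a * f ((ω \ Q).erase e) ∧ f ((ω \ Q).erase e) ≤ a * f (ω \ Q) := by
      by_cases heω : e ∈ ω \ Q
      · have := h ((ω \ Q).erase e)
          ((Finset.erase_subset _ _).trans (Finset.sdiff_subset.trans hω)) e
          (hω (Finset.sdiff_subset heω)) (Finset.notMem_erase e _)
        rwa [Finset.insert_erase heω] at this
      · rw [Finset.erase_eq_of_notMem heω]
        have := hf (ω \ Q)
        constructor <;> nlinarith
    rw [Finset.sdiff_insert, Finset.card_insert_of_notMem he, pow_succ]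
    have hp : 0 < a ^ Q.card := by positivity
    constructor
    · calc f ω ≤ a ^ Q.card * f (ω \ Q) := ih.1
        _ ≤ a ^ Q.card * (a * f ((ω \ Q).erase e)) := mul_le_mul_of_nonneg_left hstep.1 hp.le
        _ = _ := by ring
    · calc f ((ω \ Q).erase e) ≤ a * f (ω \ Q) := hstep.2
        _ ≤ a * (a ^ Q.card * f ω) := mul_le_mul_of_nonneg_left ih.2 ha0.le
        _ = _ := by ring

/-- If the occurrence of `A` can be destroyed in many different ways by local changes, and the
place of the change can be recovered from the result, then `A` is unlikely. -/
theorem card_mul_mean_le {ι : Type*} [LinearOrder ι] {F : Finset α} {f : Finset α → ℝ} {a : ℝ}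
    (ha : 1 ≤ a) (hf : ∀ ω, 0 < f ω) (h : ∀ ω ⊆ F, ∀ e ∈ F, e ∉ ω →
      f (insert e ω) ≤ a * f ω ∧ f ω ≤ a * f (insert e ω)) {A : Finset α → Prop} (I : Finset ι)
    (Q : ι → Finset α) {L : ℕ} (hQ : ∀ k ∈ I, (Q k).card ≤ L) (Φ : ι → Finset α → Finset α)
    (hΦF : ∀ k ∈ I, ∀ ω ⊆ F, Φ k ω ⊆ F) (hΦQ : ∀ k ∈ I, ∀ ω, Φ k ω \ Q k = ω \ Q k)
    (hΦ : ∀ k ∈ I, ∀ l ∈ I, k < l → ∀ ω₁ ⊆ F, ∀ ω₂ ⊆ F, A ω₁ → A ω₂ → Φ k ω₁ ≠ Φ l ω₂) :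
    (I.card : ℝ) * mean F f A ≤ (2 * a ^ 2) ^ L := by
  classical
  have ha0 : 0 < a := zero_lt_one.trans_le ha
  set N := F.powerset.filter A with hN
  have hNF : ∀ ω ∈ N, ω ⊆ F ∧ A ω := fun ω hω => by
    rwa [hN, Finset.mem_filter, Finset.mem_powerset] at hω
  -- The weights are compared through the configuration with all of `Q k` closed, at a cost of a
  -- factor a per edge in each direction.
  have hratio : ∀ k ∈ I, ∀ ω ∈ N, f ω ≤ (a ^ 2) ^ L * f (Φ k ω) := by
    intro k hk ω hω
    have h1 := (sdiff_ratio ha hf h (Q k) (hNF ω hω).1).1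
    have h2 := (sdiff_ratio ha hf h (Q k) (hΦF k hk ω (hNF ω hω).1)).2
    rw [hΦQ k hk] at h2
    have h3 : a ^ (Q k).card ≤ a ^ L := pow_le_pow_right₀ ha (hQ k hk)
    have hp := hf (Φ k ω)
    have hp' : 0 < a ^ (Q k).card := by positivity
    calc f ω ≤ a ^ (Q k).card * (a ^ (Q k).card * f (Φ k ω)) :=
          h1.trans (mul_le_mul_of_nonneg_left h2 hp'.le)
      _ ≤ a ^ L * (a ^ L * f (Φ k ω)) := by gcongr
      _ = _ := by ring
  have huniq : ∀ k ∈ I, ∀ l ∈ I, ∀ ω₁ ∈ N, ∀ ω₂ ∈ N, Φ k ω₁ = Φ l ω₂ → k = l := by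
    intro k hk l hl ω₁ h1 ω₂ h2 h12
    rcases lt_trichotomy k l with hlt | heq | hlt
    · exact absurd h12 (hΦ k hk l hl hlt _ (hNF _ h1).1 _ (hNF _ h2).1 (hNF _ h1).2 (hNF _ h2).2)
    · exact heq
    · exact absurd h12.symm
        (hΦ l hl k hk hlt _ (hNF _ h2).1 _ (hNF _ h1).1 (hNF _ h2).2 (hNF _ h1).2)
  -- The result reveals the place `k` and the configuration off `Q k`; only the at most 2^L states
  -- of the edges of `Q k` are lost.
  have hfib : ∀ ω' ∈ F.powerset,
      ((I ×ˢ N).filter fun x => Φ x.1 x.2 = ω').card ≤ 2 ^ L := by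
    intro ω' _
    rcases ((I ×ˢ N).filter fun x => Φ x.1 x.2 = ω').eq_empty_or_nonempty with he | ⟨⟨k, ω⟩, hk⟩
    · rw [he]
      simp
    · simp only [Finset.mem_filter, Finset.mem_product] at hk
      have hkey : ∀ x ∈ (I ×ˢ N).filter fun x => Φ x.1 x.2 = ω', x.1 = k ∧
          x.2 \ Q k = ω' \ Q k := by
        intro x hx
        simp only [Finset.mem_filter, Finset.mem_product] at hx
        have h1 : x.1 = k := huniq _ hx.1.1 _ hk.1.1 _ hx.1.2 _ hk.1.2 (hx.2.trans hk.2.symm)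
        refine ⟨h1, ?_⟩
        rw [← hx.2, ← h1, hΦQ _ hx.1.1]
      refine le_trans ?_ (pow_le_pow_right₀ one_le_two (hQ k hk.1.1))
      rw [← Finset.card_powerset]
      refine Finset.card_le_card_of_injOn (fun x => x.2 ∩ Q k)
        (fun x _ => Finset.mem_coe.2 (Finset.mem_powerset.2 Finset.inter_subset_right))
        fun x hx y hy hxy => ?_
      obtain ⟨h1, h2⟩ := hkey x hx
      obtain ⟨h3, h4⟩ := hkey y hy
      refine Prod.ext (h1.trans h3.symm) ?_
      simp only at hxy
      rw [← Finset.sdiff_union_inter x.2 (Q k), ← Finset.sdiff_union_inter y.2 (Q k), h2, h4, hxy]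
  have hsum : (I.card : ℝ) * ∑ ω ∈ N, f ω ≤ (2 * a ^ 2) ^ L * ∑ ω ∈ F.powerset, f ω := by
    calc (I.card : ℝ) * ∑ ω ∈ N, f ω = ∑ x ∈ I ×ˢ N, f x.2 := by
          simp only [Finset.sum_product, Finset.sum_const, nsmul_eq_mul]
      _ ≤ ∑ x ∈ I ×ˢ N, (a ^ 2) ^ L * f (Φ x.1 x.2) := Finset.sum_le_sum fun x hx => by
          rw [Finset.mem_product] at hx
          exact hratio _ hx.1 _ hx.2
      _ = (a ^ 2) ^ L * ∑ ω' ∈ F.powerset,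
            ∑ x ∈ (I ×ˢ N).filter (fun x => Φ x.1 x.2 = ω'), f (Φ x.1 x.2) := by
          rw [← Finset.mul_sum, Finset.sum_fiberwise_of_maps_to fun x hx => ?_]
          rw [Finset.mem_product] at hx
          exact Finset.mem_powerset.2 (hΦF _ hx.1 _ (hNF _ hx.2).1)
      _ ≤ (a ^ 2) ^ L * ∑ ω' ∈ F.powerset, 2 ^ L * f ω' := by
          refine mul_le_mul_of_nonneg_left (Finset.sum_le_sum fun ω' hω' => ?_) (by positivity)
          rw [Finset.sum_congr rfl fun x hx => congrArg f (Finset.mem_filter.1 hx).2,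
            Finset.sum_const, nsmul_eq_mul]
          exact mul_le_mul_of_nonneg_right (by exact_mod_cast hfib ω' hω') (hf ω').le
      _ = _ := by
          rw [← Finset.mul_sum, mul_pow]
          ring
  unfold mean
  rw [← mul_div_assoc, div_le_iff₀ (sum_powerset_pos hf)]
  convert hsum

end

open Classical in
/-- The free edges between `x = k` and `x = k + 1`. -/
def cutEdges (n m : ℕ) (V : Finset (ℤ × ℤ)) (k : ℤ) : Finset (Sym2 (ℤ × ℤ)) :=
  ((Finset.Icc (0 : ℤ) n).image fun y => s((k, y), (k + 1, y))).filter (· ∈ freeEdges n m V)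

open Classical in
/-- The free edges in the column `x = k`. -/
def columnEdges (n m : ℕ) (V : Finset (ℤ × ℤ)) (k : ℤ) : Finset (Sym2 (ℤ × ℤ)) :=
  ((Finset.Ico (0 : ℤ) n).image fun y => s((k, y), (k, y + 1))).filter (· ∈ freeEdges n m V)

theorem mem_cutEdges {n m : ℕ} {V : Finset (ℤ × ℤ)} {k : ℤ} {e : Sym2 (ℤ × ℤ)} :
    e ∈ cutEdges n m V k ↔ (∃ y : ℤ, (0 ≤ y ∧ y ≤ n) ∧ s((k, y), (k + 1, y)) = e) ∧
      e ∈ freeEdges n m V := by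
  simp [cutEdges]

theorem mem_columnEdges {n m : ℕ} {V : Finset (ℤ × ℤ)} {k : ℤ} {e : Sym2 (ℤ × ℤ)} :
    e ∈ columnEdges n m V k ↔ (∃ y : ℤ, (0 ≤ y ∧ y < n) ∧ s((k, y), (k, y + 1)) = e) ∧
      e ∈ freeEdges n m V := by
  simp [columnEdges]

theorem card_cutEdges_le {n m : ℕ} {V : Finset (ℤ × ℤ)} {k : ℤ} :
    (cutEdges n m V k).card ≤ n + 1 := by
  classical
  refine (Finset.card_filter_le _ _).trans (Finset.card_image_le.trans ?_)
  simp

theorem card_columnEdges_le {n m : ℕ} {V : Finset (ℤ × ℤ)} {k : ℤ} :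
    (columnEdges n m V k).card ≤ n + 1 := by
  classical
  refine (Finset.card_filter_le _ _).trans (Finset.card_image_le.trans ?_)
  simp

theorem fkWeight_ratio {a : ℝ} (ha : 1 ≤ a) {n m : ℕ} (V : Finset (ℤ × ℤ)) :
    ∀ ω ⊆ freeEdges n m V, ∀ e ∈ freeEdges n m V, e ∉ ω →
      fkWeight a V (arcEdges n m V) (insert e ω) ≤ a * fkWeight a V (arcEdges n m V) ω ∧
      fkWeight a V (arcEdges n m V) ω ≤ a * fkWeight a V (arcEdges n m V) (insert e ω) :=
  fun _ hω _ he heω => fkWeight_insert_le ha Finset.sdiff_subset hω he heω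

section

variable {n : ℕ} {S : Set (ℤ × ℤ)} {a : ℝ} {M m K : ℕ}

/-- Far to the right the domain is hardly connected to the base. -/
theorem mul_sdMean_far_le (ha : 1 ≤ a) (hV : IsDomain n m (dom n S M m)) (y : ℤ) :
    (M : ℝ) * sdMean a n S M m (fun ω =>
      (openGraph (ω ∪ arcEdges n m (dom n S M m))).Reachable ((M : ℤ), y) base.1) ≤
    (2 * a ^ 2) ^ (n + 1) := by
  have ha0 : 0 < a := zero_lt_one.trans_le ha
  set V := dom n S M m
  have key := card_mul_mean_le ha (fkWeight_pos ha0 V (arcEdges n m V)) (fkWeight_ratio ha V)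
    (A := fun ω => (openGraph (ω ∪ arcEdges n m V)).Reachable ((M : ℤ), y) base.1)
    (Finset.range M) (fun k : ℕ => cutEdges n m V k) (fun k _ => card_cutEdges_le)
    (fun k ω => ω \ cutEdges n m V k) (fun k _ ω hω => Finset.sdiff_subset.trans hω)
    (fun k _ ω => sdiff_idem) ?_
  · rwa [Finset.card_range] at key
  intro k hk l hl hkl ω₁ h1 ω₂ h2 hA1 hA2 heq
  rw [Finset.mem_range] at hk hl
  -- Equal results would make cut `k` empty in `ω₂`, since the changes at `l` do not touch it. All
  -- cuts lie at x ≥ 0, beyond the horizontal arcs, so an empty one separates the far point from the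
  -- base.
  have hno : ∀ e ∈ cutEdges n m V k, e ∉ ω₂ := by
    intro e he he2
    have hel : e ∉ cutEdges n m V l := by
      intro hel
      obtain ⟨⟨y1, -, h3⟩, -⟩ := mem_cutEdges.1 he
      obtain ⟨⟨y2, -, h4⟩, -⟩ := mem_cutEdges.1 hel
      rw [← h4] at h3
      simp only [Sym2.eq_iff, Prod.mk.injEq] at h3
      omega
    have : e ∈ ω₁ \ cutEdges n m V k := heq ▸ Finset.mem_sdiff.2 ⟨he2, hel⟩
    exact (Finset.mem_sdiff.1 this).2 he
  have hstay : ∀ v, (openGraph (ω₂ ∪ arcEdges n m V)).Reachable ((M : ℤ), y) v →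
      (k : ℤ) < v.1 := by
    intro v hv
    rw [SimpleGraph.reachable_iff_reflTransGen] at hv
    induction hv with
    | refl => simp only; omega
    | @tail u w _ huw ih =>
      rw [openGraph, SimpleGraph.fromEdgeSet_adj] at huw
      by_contra hlt
      have hm := mem_edges.1 (union_arc_subset h2 (Finset.mem_coe.1 huw.1))
      have hbu := hV.subset u hm.1
      have hbw := hV.subset w hm.2.1
      have harc : s(u, w) ∉ arcEdges n m V := by
        intro h
        have h3 := (mem_arcEdges.1 h).2
        have h4 := hV.bottom u.1 hbu.1
        have h5 := hV.top u.1 hbu.1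
        have h6 : (u.1, u.2) ∈ V := hm.1
        rcases h3 with h3 | h3 | h3
        · rw [h3.1] at h6
          have := h4.1 h6
          omega
        · rw [h3.1] at h6
          have := h5.1 h6
          omega
        · omega
      rcases Finset.mem_union.1 (Finset.mem_coe.1 huw.1) with h3 | h3
      · refine hno s(u, w) (mem_cutEdges.2 ⟨⟨u.2, ⟨hbu.2.2.1, hbu.2.2.2⟩, ?_⟩, h2 h3⟩) h3
        rcases lattice_edge_cases hm.2.2 with ⟨x, y, ⟨rfl, rfl⟩ | ⟨rfl, rfl⟩⟩ |
          ⟨x, y, ⟨rfl, rfl⟩ | ⟨rfl, rfl⟩⟩ <;> simp only at ih hlt ⊢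
        · omega
        · obtain rfl : x = k := by omega
          exact Sym2.eq_swap
        · omega
        · omega
      · exact harc h3
  have := hstay _ hA2
  simp only [base] at this
  omega

/-- A point which is joined to the base is joined to the horizontal part of the arc, unless it is
joined to the left side of the rectangle. -/
theorem mul_sdMean_left_le (ha : 1 ≤ a) (hS : IsStripSet n S K) (hKm : K < m) {u : ℤ × ℤ}
    (hu : -(K : ℤ) ≤ u.1) (huV : u ∈ dom n S M m) :
    ((m : ℝ) - K - 1) * sdMean a n S M m (fun ω =>
      (openGraph (ω ∪ arcEdges n m (dom n S M m))).Reachable u base.1 ∧ ω ∉ evConn n m S u) ≤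
    (2 * a ^ 2) ^ (n + 1) := by
  have ha0 : 0 < a := zero_lt_one.trans_le ha
  have hV := hS.isDomain M (show 1 ≤ m by omega) hKm.le
  set V := dom n S M m with hVdef
  have key := card_mul_mean_le ha (fkWeight_pos ha0 V (arcEdges n m V)) (fkWeight_ratio ha V)
    (A := fun ω => (openGraph (ω ∪ arcEdges n m V)).Reachable u base.1 ∧ ω ∉ evConn n m S u)
    (Finset.Ioo (-(m : ℤ)) (-K)) (fun k => columnEdges n m V k) (fun k _ => card_columnEdges_le)
    (fun k ω => ω ∪ columnEdges n m V k)
    (fun k _ ω hω => Finset.union_subset hω fun e he => (mem_columnEdges.1 he).2)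
    (fun k _ ω => by rw [Finset.union_sdiff_right]) ?_
  · rw [Int.card_Ioo] at key
    have h1 : (((-(K : ℤ) - -(m : ℤ) - 1).toNat : ℕ) : ℝ) = (m : ℝ) - K - 1 := by
      have : ((-(K : ℤ) - -(m : ℤ) - 1).toNat : ℤ) = (m : ℤ) - K - 1 := by omega
      exact_mod_cast congrArg (Int.cast : ℤ → ℝ) this
    rwa [h1] at key
  intro k hk l hl hkl ω₁ h1 ω₂ h2 hA1 hA2 heq
  rw [Finset.mem_Ioo] at hk hl
  -- Equal results would make column `k` fully open in `ω₂`. Any path from `u` to the left side then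
  -- meets this column, which joins `u` to the bottom arc, contrary to the event.
  have hyes : ∀ y : ℤ, 0 ≤ y → y < n → s((k, y), (k, y + 1)) ∈ ω₂ := by
    intro y hy0 hyn
    have hmem : ∀ y : ℤ, 0 ≤ y → y ≤ n → (k, y) ∈ V := fun y hy0 hyn => by
      rw [hVdef, mem_dom, mem_rect]
      exact ⟨by simp only; omega, hS.full _ _ (by omega) hy0 hyn, by simp only; omega⟩
    have he : s((k, y), (k, y + 1)) ∈ columnEdges n m V k := by
      refine mem_columnEdges.2 ⟨⟨y, ⟨hy0, hyn⟩, rfl⟩, Finset.mem_sdiff.2 ⟨mem_edges.2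
        ⟨hmem y hy0 hyn.le, hmem _ (by omega) (by omega), by simp [lattice]⟩, fun h => ?_⟩⟩
      have := (mem_arcEdges.1 h).2
      simp only at this
      omega
    have h3 : s((k, y), (k, y + 1)) ∈ ω₂ ∪ columnEdges n m V l :=
      heq ▸ Finset.mem_union_right _ he
    rcases Finset.mem_union.1 h3 with h3 | h3
    · exact h3
    · obtain ⟨⟨y', -, h4⟩, -⟩ := mem_columnEdges.1 h3
      simp only [Sym2.eq_iff, Prod.mk.injEq] at h4
      omega
  have hVS : ∀ v ∈ V, v ∈ S ∩ rect n m := fun v hv => ⟨(mem_dom.1 hv).2.1, (mem_dom.1 hv).1⟩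
  have hcol : ∀ j : ℕ, (j : ℤ) ≤ n → ConnIn ω₂ (S ∩ rect n m) (k, 0) (k, j) := by
    intro j
    induction j with
    | zero => exact fun _ => SimpleGraph.Reachable.refl _
    | succ j ih =>
      intro hj
      push_cast at hj ⊢
      refine SimpleGraph.Reachable.trans (ih (by omega)) (SimpleGraph.Adj.reachable ?_)
      have he := hyes j (by omega) (by omega)
      have hm := mem_edges.1 (Finset.sdiff_subset (h2 he))
      exact connIn_adj.2 ⟨he, hVS _ hm.1, hVS _ hm.2.1, by simp⟩
  have hrow : ∀ v, ConnIn ω₂ (S ∩ rect n m) u v → v ∈ bdryLeft n → v ∈ rect n m → False :=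
    fun v hv h3 h4 => hA2.2 ⟨v, h3, h4, SimpleGraph.Reachable.symm hv⟩
  have hstay : ∀ v, (openGraph (ω₂ ∪ arcEdges n m V)).Reachable u v →
      v ∈ V ∧ ConnIn ω₂ (S ∩ rect n m) u v ∧ k < v.1 := by
    intro v hv
    rw [SimpleGraph.reachable_iff_reflTransGen] at hv
    induction hv with
    | refl => exact ⟨huV, SimpleGraph.Reachable.refl _, by omega⟩
    | @tail v w _ hvw ih =>
      rw [openGraph, SimpleGraph.fromEdgeSet_adj] at hvw
      have hm := mem_edges.1 (union_arc_subset h2 (Finset.mem_coe.1 hvw.1))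
      have hbv := hV.subset v hm.1
      have hbw := hV.subset w hm.2.1
      rcases Finset.mem_union.1 (Finset.mem_coe.1 hvw.1) with h3 | h3
      · have hw : ConnIn ω₂ (S ∩ rect n m) u w := SimpleGraph.Reachable.trans ih.2.1
          (SimpleGraph.Adj.reachable (connIn_adj.2 ⟨h3, hVS _ hm.1, hVS _ hm.2.1, hvw.2⟩))
        refine ⟨hm.2.1, hw, ?_⟩
        by_contra hlt
        have hwk : w.1 = k := by
          have := ih.2.2
          rcases lattice_edge_cases hm.2.2 with ⟨x, y, ⟨rfl, rfl⟩ | ⟨rfl, rfl⟩⟩ |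
            ⟨x, y, ⟨rfl, rfl⟩ | ⟨rfl, rfl⟩⟩ <;> simp only at this hlt ⊢ <;> omega
        have h4 := hcol w.2.toNat (by omega)
        rw [Int.toNat_of_nonneg hbw.2.2.1, ← hwk] at h4
        refine hrow (w.1, 0) (SimpleGraph.Reachable.trans hw (SimpleGraph.Reachable.symm h4))
          ⟨Or.inl rfl, ?_⟩ (mem_rect.2 ?_)
        · simp only; omega
        · simp only; omega
      · exfalso
        have h4 := (mem_arcEdges.1 h3).2
        have h5 := hV.bottom v.1 hbv.1
        have h6 := hV.top v.1 hbv.1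
        have h7 : (v.1, v.2) ∈ V := hm.1
        have hr := (hVS v hm.1).2
        rcases h4 with h4 | h4 | h4
        · rw [h4.1] at h7
          exact hrow v ih.2.1 ⟨Or.inl h4.1, h5.1 h7⟩ hr
        · rw [h4.1] at h7
          exact hrow v ih.2.1 ⟨Or.inr h4.1, h6.1 h7⟩ hr
        · have := ih.2.2
          omega
  obtain ⟨h3, h4, -⟩ := hstay _ hA2.1
  exact hrow _ h4 ⟨Or.inl rfl, by simp [base]⟩ (hVS _ h3).2

end

/-! ### Limits along the rectangles -/

section

variable {n : ℕ} {S : Set (ℤ × ℤ)} {a p q : ℝ} {M m m' K : ℕ}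

/-- The probability, in the self-dual measure on the domain, of a connection to the base. -/
def baseMean (a : ℝ) (n : ℕ) (S : Set (ℤ × ℤ)) (M m : ℕ) (u : ℤ × ℤ) : ℝ :=
  sdMean a n S M m fun ω => (openGraph (ω ∪ arcEdges n m (dom n S M m))).Reachable u base.1

/-- The probability, in the self-dual measure on the domain, of a dual connection of the face
above the bottom side to the end of the arc. -/
def dualMean (a : ℝ) (n : ℕ) (S : Set (ℤ × ℤ)) (M m : ℕ) (x : ℤ) : ℝ :=
  sdMean a n S M m fun ω => InnerConn n m ω (x, 0)

theorem sdMean_nonneg (ha : 1 ≤ a) (A : Finset (Sym2 (ℤ × ℤ)) → Prop) :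
    0 ≤ sdMean a n S M m A :=
  mean_nonneg (fun ω => (fkWeight_pos (zero_lt_one.trans_le ha) _ _ ω).le) A

theorem sdMean_le_one (ha : 1 ≤ a) (A : Finset (Sym2 (ℤ × ℤ)) → Prop) :
    sdMean a n S M m A ≤ 1 :=
  mean_le_one (fun ω => (fkWeight_pos (zero_lt_one.trans_le ha) _ _ ω).le) A

theorem sdMean_mono (ha : 1 ≤ a) {A A' : Finset (Sym2 (ℤ × ℤ)) → Prop}
    (h : ∀ ω ⊆ freeEdges n m (dom n S M m), A ω → A' ω) :
    sdMean a n S M m A ≤ sdMean a n S M m A' :=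
  mean_mono (fun ω => (fkWeight_pos (zero_lt_one.trans_le ha) _ _ ω).le) h

theorem sdMean_or_le (ha : 1 ≤ a) (A A' : Finset (Sym2 (ℤ × ℤ)) → Prop) :
    sdMean a n S M m (fun ω => A ω ∨ A' ω) ≤ sdMean a n S M m A + sdMean a n S M m A' :=
  mean_or_le (fun ω => (fkWeight_pos (zero_lt_one.trans_le ha) _ _ ω).le) A A'

theorem sdMean_not (ha : 1 ≤ a) (A : Finset (Sym2 (ℤ × ℤ)) → Prop) :
    sdMean a n S M m (fun ω => ¬ A ω) = 1 - sdMean a n S M m A :=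
  mean_not (sum_powerset_pos (fkWeight_pos (zero_lt_one.trans_le ha) _ _)) A

theorem baseMean_anti (ha : 1 ≤ a) (hMm : M ≤ m) (h : m ≤ m') (hV : IsDomain n m (dom n S M m))
    {u : ℤ × ℤ} (hu : -(m : ℤ) ≤ u.1) : baseMean a n S M m' u ≤ baseMean a n S M m u := by
  refine le_trans (sdMean_mono ha fun ω hω hr => ?_) (sdMean_inter_le ha hMm h hV
    fun ω ω' hω hr => hr.mono (openGraph_mono (Finset.union_subset_union_left hω)))
  refine reachable_clamp_of_le hMm h hV hω Finset.Subset.rfl hu ?_ hr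
  have := hV.one_le_m
  simp only [base]
  omega

/-- An edge between two inner faces lies to the right of the left side and off the arc, so an inner
path is blind to edges outside the smaller domain. -/
theorem InnerConn.of_inter (hMm : M ≤ m) {ω : Finset (Sym2 (ℤ × ℤ))}
    (hω : ω ⊆ freeEdges n m' (dom n S M m')) {f : ℤ × ℤ}
    (h : InnerConn n m (ω ∩ freeEdges n m (dom n S M m)) f) : InnerConn n m ω f := by
  induction h with
  | refl => exact Relation.ReflTransGen.refl
  | tail _ h1 ih =>
    obtain ⟨⟨s, h1, rfl, rfl⟩, h3, h4⟩ := h1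
    refine ih.tail ⟨⟨s, fun hs => h1 ?_, rfl, rfl⟩, h3, h4⟩
    have he := edge_mem_edges.1 (Finset.sdiff_subset (hω hs))
    have hx : -(m : ℤ) ≤ s.1.1 ∧ -(m : ℤ) ≤ (s.1 + dir s.2).1 := by
      obtain ⟨⟨x, y⟩, d⟩ := s
      rcases @dir_eq d with ⟨k1, k2, k3⟩ | ⟨k1, k2, k3⟩ | ⟨k1, k2, k3⟩ | ⟨k1, k2, k3⟩ <;>
      rcases @dir_eq (d + 1) with ⟨l1, -, l3⟩ | ⟨l1, -, l3⟩ | ⟨l1, -, l3⟩ | ⟨l1, -, l3⟩ <;>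
      first
        | omega
        | (simp only [InnerFace, face, k2, k3, l3, Prod.mk_add_mk] at h3 h4 ⊢; omega)
    have h5 := (mem_dom.1 he.1).2.2
    have h6 := (mem_dom.1 he.2).2.2
    refine Finset.mem_inter.2 ⟨hs, Finset.mem_sdiff.2 ⟨edge_mem_edges.2
      ⟨mem_dom_of_le he.1 hx.1 (by omega), mem_dom_of_le he.2 hx.2 (by omega)⟩,
      fun h => not_inner_of_arc h h3 h4⟩⟩

/-- Dual connections are decreasing events, so their probability grows as the wired left side moves
away, opposite to `baseMean_anti`. -/
theorem dualMean_mono (ha : 1 ≤ a) (hMm : M ≤ m) (h : m ≤ m') (hV : IsDomain n m (dom n S M m))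
    (x : ℤ) : dualMean a n S M m x ≤ dualMean a n S M m' x := by
  have key := sdMean_inter_le ha hMm h hV (A := fun ω => ¬ InnerConn n m ω (x, 0))
    fun ω ω' hω h1 h2 => h1 (h2.mono le_rfl hω)
  rw [sdMean_not ha, sdMean_not ha (fun ω => InnerConn n m _ (x, 0))] at key
  have h2 : sdMean a n S M m' (fun ω => InnerConn n m (ω ∩ freeEdges n m (dom n S M m)) (x, 0)) ≤
      dualMean a n S M m' x :=
    sdMean_mono ha fun ω hω h3 => (h3.of_inter hMm hω).mono h Finset.Subset.rfl
  unfold dualMean at h2 ⊢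
  linarith

open Classical in
/-- The edges of the boundary of `S` which start between `x = -K` and `x = M`. -/
def bdryEdges (n : ℕ) (S : Set (ℤ × ℤ)) (K M : ℕ) : Finset ((ℤ × ℤ) × (ℤ × ℤ)) :=
  ((Finset.Icc (-(K : ℤ)) M ×ˢ Finset.Icc (0 : ℤ) n) ×ˢ
    (Finset.Icc (-(K : ℤ)) (M + 1) ×ˢ Finset.Icc (0 : ℤ) n)).filter
    fun e => lattice.Adj e.1 e.2 ∧ e.1 ∈ S ∧ e.2 ∉ S

theorem mem_bdryEdges {e : (ℤ × ℤ) × (ℤ × ℤ)} : e ∈ bdryEdges n S K M ↔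
    (((-(K : ℤ) ≤ e.1.1 ∧ e.1.1 ≤ M) ∧ 0 ≤ e.1.2 ∧ e.1.2 ≤ n) ∧
      (-(K : ℤ) ≤ e.2.1 ∧ e.2.1 ≤ M + 1) ∧ 0 ≤ e.2.2 ∧ e.2.2 ≤ n) ∧
      lattice.Adj e.1 e.2 ∧ e.1 ∈ S ∧ e.2 ∉ S := by
  simp [bdryEdges]

theorem bdryEdges_subset : ↑(bdryEdges n S K M) ⊆ edgeBdry n S := by
  intro e he
  rw [Finset.mem_coe, mem_bdryEdges] at he
  exact ⟨he.2.1, he.1.1.2, he.1.2.2, he.2.2⟩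

theorem mem_outPairs {V : Finset (ℤ × ℤ)} {e : (ℤ × ℤ) × (ℤ × ℤ)} : e ∈ outPairs n m V ↔
    (e.1 ∈ V ∧ (-(m : ℤ) ≤ e.2.1 ∧ e.2.1 ≤ m + 1) ∧ 0 ≤ e.2.2 ∧ e.2.2 ≤ n) ∧
      lattice.Adj e.1 e.2 ∧ e.2 ∉ V := by
  simp [outPairs]

/-- An edge leaves the truncated domain either by leaving S, which happens only to the right of -K,
or by crossing the artificial right end x = M. -/
theorem outPairs_subset (hS : IsStripSet n S K) (hMm : M ≤ m) :
    outPairs n m (dom n S M m) ⊆ bdryEdges n S K M ∪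
      (Finset.Icc (0 : ℤ) n).image fun y => (((M : ℤ), y), ((M : ℤ) + 1, y)) := by
  intro e he
  rw [mem_outPairs] at he
  obtain ⟨⟨h1, h2, h3⟩, h4, h5⟩ := he
  rw [mem_dom, mem_rect] at h1 h5
  rw [Finset.mem_union, mem_bdryEdges, Finset.mem_image]
  obtain ⟨u, w⟩ := e
  simp only at *
  have hnear : w.1 - 1 ≤ u.1 ∧ u.1 ≤ w.1 + 1 ∧ (u.1 = w.1 ∨ u.2 = w.2) := by
    rcases lattice_edge_cases h4 with ⟨x, y, ⟨rfl, rfl⟩ | ⟨rfl, rfl⟩⟩ |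
      ⟨x, y, ⟨rfl, rfl⟩ | ⟨rfl, rfl⟩⟩ <;> simp <;> omega
  by_cases hwM : w.1 ≤ M
  · have hwS : w ∉ S := fun h => h5 ⟨⟨by omega, h3⟩, h, hwM⟩
    have hwK : -(K : ℤ) < w.1 := by
      by_contra h
      exact hwS (hS.full w.1 w.2 (not_lt.1 h) h3.1 h3.2)
    exact Or.inl ⟨⟨⟨by omega, h1.1.2⟩, by omega, h3⟩, h4, h1.2.1, hwS⟩
  · refine Or.inr ⟨u.2, by rw [Finset.mem_Icc]; exact h1.1.2, ?_⟩
    ext <;> simp only <;> omega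

/-- The relation between the boundary values, in terms of probabilities. -/
theorem one_add_sum_le (ha : 1 ≤ a) (ha2 : a ≤ 2) (hS : IsStripSet n S K) (hM : 1 ≤ M)
    (hMm : M ≤ m) (hKm : K ≤ m) :
    1 + 1 / 2 * ∑ x ∈ Finset.Icc (-(m : ℤ)) (-2), dualMean a n S M m x ≤
      ∑ e ∈ bdryEdges n S K M, baseMean a n S M m e.1 + (n + 1) * ((2 * a ^ 2) ^ (n + 1) / M) := by
  classical
  have hV := hS.isDomain M (hM.trans hMm) hKm
  have ha0 : 0 < a := zero_lt_one.trans_le ha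
  -- Here q ≤ 4 makes a / 2 a cosine, while q ≥ 1 places the angle in [0, π/3], where cos θ ≥ 1/2.
  have hcos : 2 * Real.cos (Real.arccos (a / 2)) = a := by
    rw [Real.cos_arccos (by linarith) (by linarith)]
    ring
  have hle : Real.arccos (a / 2) ≤ Real.pi / 3 := by
    rw [← Real.arccos_cos (x := Real.pi / 3) (by positivity) (by linarith [Real.pi_pos]),
      Real.cos_pi_div_three]
    exact Real.arccos_le_arccos (by linarith)
  have key := hV.sum_boundary (Real.arccos_nonneg _) hle
    (f := fkWeight a (dom n S M m) (arcEdges n m (dom n S M m)))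
    (fun ω => (fkWeight_pos ha0 _ _ ω).le) (by
      rw [hcos]
      exact selfDual_fkWeight Finset.sdiff_subset)
  have hZ := sum_powerset_pos (F := freeEdges n m (dom n S M m))
    (fkWeight_pos ha0 (dom n S M m) (arcEdges n m (dom n S M m)))
  have key2 : 1 + 1 / 2 * ∑ x ∈ Finset.Icc (-(m : ℤ)) (-2), dualMean a n S M m x ≤
      ∑ e ∈ outPairs n m (dom n S M m), baseMean a n S M m e.1 := by
    unfold dualMean baseMean sdMean mean
    rw [← Finset.sum_div, ← Finset.sum_div, le_div_iff₀ hZ, add_mul, one_mul, mul_assoc,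
      div_mul_cancel₀ _ hZ.ne']
    exact key
  refine key2.trans ((Finset.sum_le_sum_of_subset_of_nonneg (outPairs_subset hS hMm)
    fun e _ _ => sdMean_nonneg ha _).trans ?_)
  refine (le_add_of_nonneg_right (Finset.sum_nonneg fun e _ => sdMean_nonneg ha _)).trans
    ((Finset.sum_union_inter (s₁ := bdryEdges n S K M)).le.trans ?_)
  refine add_le_add le_rfl ?_
  rw [Finset.sum_image fun y _ y' _ h => by simpa using h]
  have hfar : ∀ y ∈ Finset.Icc (0 : ℤ) n, baseMean a n S M m ((M : ℤ), y) ≤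
      (2 * a ^ 2) ^ (n + 1) / M := by
    intro y _
    rw [le_div_iff₀ (by exact_mod_cast hM), mul_comm]
    exact mul_sdMean_far_le ha hV y
  refine (Finset.sum_le_card_nsmul _ _ _ hfar).trans (le_of_eq ?_)
  simp

/-- The relation between the boundary values in the limit of a long strip. -/
theorem exists_limits (ha : 1 ≤ a) (ha2 : a ≤ 2) (hS : IsStripSet n S K) (hM : 1 ≤ M) :
    ∃ (A : ℤ → ℝ) (B : ℤ × ℤ → ℝ), (∀ x, 0 ≤ A x) ∧ (∀ u, 0 ≤ B u) ∧
      (∀ᶠ m in atTop, ∀ x, dualMean a n S M m x ≤ A x) ∧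
      (∀ᶠ m in atTop, ∀ u : ℤ × ℤ, -(K : ℤ) ≤ u.1 → B u ≤ baseMean a n S M m u) ∧
      ∀ X : Finset ℤ, (∀ x ∈ X, x ≤ -2) → 1 + 1 / 2 * ∑ x ∈ X, A x ≤
        ∑ e ∈ bdryEdges n S K M, B e.1 + (n + 1) * ((2 * a ^ 2) ^ (n + 1) / M) := by
  set m₀ := M + K with hm₀
  have hV : ∀ j, IsDomain n (m₀ + j) (dom n S M (m₀ + j)) := fun j =>
    hS.isDomain M (by omega) (by omega)
  have hAmono : ∀ x, Monotone fun j => dualMean a n S M (m₀ + j) x := fun x i j hij =>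
    dualMean_mono ha (by omega) (by omega) (hV i) x
  have hBanti : ∀ u : ℤ × ℤ, -(K : ℤ) ≤ u.1 → Antitone fun j => baseMean a n S M (m₀ + j) u :=
    fun u hu i j hij => baseMean_anti ha (by omega) (by omega) (hV i) (by push_cast; omega)
  have hAbdd : ∀ x, BddAbove (Set.range fun j => dualMean a n S M (m₀ + j) x) := fun x =>
    ⟨1, by rintro _ ⟨j, rfl⟩; exact sdMean_le_one ha _⟩
  have hBbdd : ∀ u, BddBelow (Set.range fun j => baseMean a n S M (m₀ + j) u) := fun u =>
    ⟨0, by rintro _ ⟨j, rfl⟩; exact sdMean_nonneg ha _⟩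
  -- By monotonicity these are limits in m and also one-sided bounds for each large m, so the
  -- relation passes to the limit term by term.
  refine ⟨fun x => ⨆ j, dualMean a n S M (m₀ + j) x, fun u => ⨅ j, baseMean a n S M (m₀ + j) u,
    fun x => (sdMean_nonneg ha _).trans (le_ciSup (hAbdd x) 0),
    fun u => le_ciInf fun j => sdMean_nonneg ha _, ?_, ?_, fun X hX => ?_⟩
  · filter_upwards [eventually_ge_atTop m₀] with m hm x
    obtain ⟨j, rfl⟩ := Nat.exists_eq_add_of_le hm
    exact le_ciSup (hAbdd x) j
  · filter_upwards [eventually_ge_atTop m₀] with m hm u _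
    obtain ⟨j, rfl⟩ := Nat.exists_eq_add_of_le hm
    exact ciInf_le (hBbdd u) j
  · have t1 : Tendsto (fun j => 1 + 1 / 2 * ∑ x ∈ X, dualMean a n S M (m₀ + j) x) atTop
        (nhds (1 + 1 / 2 * ∑ x ∈ X, ⨆ j, dualMean a n S M (m₀ + j) x)) :=
      (tendsto_finsetSum _ fun x _ =>
        tendsto_atTop_ciSup (hAmono x) (hAbdd x)).const_mul _ |>.const_add _
    have t2 : Tendsto (fun j => ∑ e ∈ bdryEdges n S K M, baseMean a n S M (m₀ + j) e.1 +
        (n + 1) * ((2 * a ^ 2) ^ (n + 1) / M)) atTop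
        (nhds (∑ e ∈ bdryEdges n S K M, (⨅ j, baseMean a n S M (m₀ + j) e.1) +
          (n + 1) * ((2 * a ^ 2) ^ (n + 1) / M))) :=
      (tendsto_finsetSum _ fun e he => tendsto_atTop_ciInf
        (hBanti _ (mem_bdryEdges.1 he).1.1.1.1) (hBbdd _)).add_const _
    obtain ⟨L, hL⟩ : ∃ L : ℕ, ∀ x ∈ X, -(L : ℤ) ≤ x := by
      refine ⟨X.sup fun x => x.natAbs, fun x hx => ?_⟩
      have := Finset.le_sup (f := fun x : ℤ => x.natAbs) hx
      omega
    refine le_of_tendsto_of_tendsto t1 t2 ?_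
    filter_upwards [eventually_ge_atTop L] with j hj
    refine le_trans ?_ (one_add_sum_le ha ha2 hS hM (by omega) (by omega))
    have : ∑ x ∈ X, dualMean a n S M (m₀ + j) x ≤
        ∑ x ∈ Finset.Icc (-((m₀ + j : ℕ) : ℤ)) (-2), dualMean a n S M (m₀ + j) x := by
      refine Finset.sum_le_sum_of_subset_of_nonneg (fun x hx => ?_)
        fun x _ _ => sdMean_nonneg ha _
      rw [Finset.mem_Icc]
      have := hL x hx
      have := hX x hx
      omega
    linarith

theorem evS_dom (hS : Disjoint S (bdryRight n)) (u w : ℤ × ℤ) (ω : Finset (Sym2 (ℤ × ℤ)))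
    (h : s(u, w) ∈ edges (dom n S M m)) : insert s(u, w) ω ∈ evS n m S ↔ ω ∈ evS n m S := by
  rw [mem_edges, mem_dom, mem_dom] at h
  exact insert_mem_evS hS h.1.2.1 h.2.1.2.1 ω

theorem evConn_mono {u : ℤ × ℤ} {ω ω' : Finset (Sym2 (ℤ × ℤ))} (h : ω ⊆ ω')
    (hω : ω ∈ evConn n m S u) : ω' ∈ evConn n m S u := by
  obtain ⟨y, h1, h2, h3⟩ := hω
  exact ⟨y, h1, h2, h3.mono h Set.Subset.rfl⟩

/-- Lower bound for a term of the boundary-connection function. -/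
theorem SupDual.le_liminf (h : SupDual a p q) (hS : IsStripSet n S K)
    (hpos : ∃ᶠ m in atTop, Possible n m S) {u : ℤ × ℤ} (huS : u ∈ S) (hu : -(K : ℤ) ≤ u.1)
    (huM : u.1 ≤ M) (hu2 : 0 ≤ u.2 ∧ u.2 ≤ n) {b : ℝ}
    (hb : ∀ᶠ m in atTop, b ≤ baseMean a n S M m u) :
    ENNReal.ofReal b ≤ liminf (fun m =>
      ENNReal.ofReal (condProb (rect n m) p q (evConn n m S u) (evS n m S))) (rectFilter n S) := by
  have hne : (rectFilter n S).NeBot := Filter.frequently_iff_neBot.1 hpos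
  have ha := h.one_le
  set C := (2 * a ^ 2) ^ (n + 1) with hC
  -- The subtracted term bounds the connections to the base that use only the artificial left side;
  -- it vanishes as that side recedes.
  have t1 : Tendsto (fun m : ℕ => b - C / ((m : ℝ) - K - 1)) atTop (nhds (b - 0)) := by
    refine tendsto_const_nhds.sub (Tendsto.const_div_atTop ?_ C)
    exact tendsto_atTop_add_const_right _ _
      (tendsto_atTop_add_const_right _ _ tendsto_natCast_atTop_atTop)
  rw [sub_zero] at t1
  have t2 := (ENNReal.tendsto_ofReal t1).mono_left
    (show rectFilter n S ≤ atTop from inf_le_left)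
  rw [← t2.liminf_eq]
  refine liminf_le_liminf ?_
  filter_upwards [show ∀ᶠ m in rectFilter n S, b ≤ baseMean a n S M m u from
      hb.filter_mono inf_le_left,
    show ∀ᶠ m in rectFilter n S, M + K + 2 ≤ m from
      (eventually_ge_atTop _).filter_mono inf_le_left,
    show ∀ᶠ m in rectFilter n S, Possible n m S from
      Filter.mem_inf_of_right (Filter.mem_principal_self _)] with m hm1 hm2 hm3
  refine ENNReal.ofReal_le_ofReal ?_
  have huV : u ∈ dom n S M m := by
    rw [mem_dom, mem_rect]
    exact ⟨by omega, huS, huM⟩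
  have h1 := h.mean_le_condProb dom_subset (fun u w ω he => evS_dom (M := M) hS.right u w ω he) hm3
    (A := evConn n m S u) fun ω ω' h1 h2 => evConn_mono h1 h2
  have h2 := mul_sdMean_left_le ha hS (show K < m by omega) hu huV
  have hmK : (0 : ℝ) < (m : ℝ) - K - 1 := by
    have : ((M + K + 2 : ℕ) : ℝ) ≤ m := by exact_mod_cast hm2
    push_cast at this
    have : (0 : ℝ) ≤ M := by positivity
    linarith
  have h3 := (le_div_iff₀' hmK).2 h2
  have h4 : baseMean a n S M m u ≤ sdMean a n S M m (fun ω => ω ∈ evConn n m S u ∨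
      ((openGraph (ω ∪ arcEdges n m (dom n S M m))).Reachable u base.1 ∧
        ω ∉ evConn n m S u)) :=
    sdMean_mono ha fun ω _ hr => by tauto
  have h5 := h4.trans (sdMean_or_le ha _ _)
  have h6 : sdMean a n S M m (fun ω => ω ∈ evConn n m S u) ≤ _ := h1
  linarith

/-- Upper bound for the probability of a dual connection. -/
theorem SupDual.condProb_evDual_le (h : SupDual a p q) (hn : 1 ≤ n)
    {C : Set (Finset (Sym2 (ℤ × ℤ)))}
    (hC : ∀ u w ω, s(u, w) ∈ edges (dom n S M m) → (insert s(u, w) ω ∈ C ↔ ω ∈ C))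
    (hC' : ∃ ω ⊆ edges (rect n m), ω ∈ C) {x : ℤ} (hx : x ≤ -2) (hxm : -(m : ℤ) < x) :
    condProb (rect n m) p q (evDual n m (x, 0)) C ≤
      dualMean a n S M m (x - 1) + dualMean a n S M m x := by
  have h1 := h.condProb_le_mean dom_subset hC hC'
    (A := {ω | InnerConn n m ω (x - 1, 0) ∨ InnerConn n m ω (x, 0)})
    fun ω ω' h1 h2 => h2.imp (fun h => h.mono le_rfl h1) fun h => h.mono le_rfl h1
  have h2 : condProb (rect n m) p q (evDual n m (x, 0)) C ≤ condProb (rect n m) p q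
      {ω | InnerConn n m ω (x - 1, 0) ∨ InnerConn n m ω (x, 0)} C := by
    rw [condProb_eq_mean h.pos h.lt_one h.q_pos, condProb_eq_mean h.pos h.lt_one h.q_pos]
    exact mean_mono (condWeight_nonneg h.pos h.lt_one h.q_pos)
      fun ω _ hω => innerConn_of_mem_evDual hn hx hxm hω
  exact (h2.trans h1).trans (sdMean_or_le h.one_le _ _)

theorem SupDual.condProb_le_one (h : SupDual a p q) {R : Finset (ℤ × ℤ)}
    {A C : Set (Finset (Sym2 (ℤ × ℤ)))} : condProb R p q A C ≤ 1 := by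
  rw [condProb_eq_mean h.pos h.lt_one h.q_pos]
  exact mean_le_one (condWeight_nonneg h.pos h.lt_one h.q_pos) _

/-- Comparison of the boundary-connection function with a sum along the bottom side. -/
theorem SupDual.tsum_le (h : SupDual a p q) (ha2 : a ≤ 2) (hS : IsStripSet n S K)
    (hpos : ∃ᶠ m in atTop, Possible n m S) {T : ℤ × ℤ → ℝ≥0∞} (hT1 : ∀ x, T x ≤ 1)
    (hT : ∀ M : ℕ, ∀ x : ℤ, x ≤ -2 → ∀ r : ℝ, (∀ᶠ m in atTop,
      dualMean a n S M m (x - 1) + dualMean a n S M m x ≤ r) → T (x, 0) ≤ ENNReal.ofReal r) :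
    ∑' x : bdryBottomLeft, T x ≤ 4 * phiBar p q n S := by
  classical
  have ha := h.one_le
  rw [ENNReal.tsum_eq_iSup_sum]
  refine iSup_le fun X => ?_
  set C : ℝ := (n + 1) * (2 * a ^ 2) ^ (n + 1) with hC
  -- The n + 1 edges across x = M contribute at most C / M in total.
  have t : Tendsto (fun M : ℕ => 4 * (phiBar p q n S + ENNReal.ofReal (C / M))) atTop
      (nhds (4 * (phiBar p q n S + 0))) := by
    refine ENNReal.Tendsto.const_mul (Tendsto.const_add _ ?_) (Or.inr (by simp))
    rw [← ENNReal.ofReal_zero]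
    exact ENNReal.tendsto_ofReal (tendsto_const_div_atTop_nhds_zero_nat C)
  rw [add_zero] at t
  refine ge_of_tendsto t ?_
  filter_upwards [eventually_ge_atTop 1] with M hM
  obtain ⟨A, B, hA0, hB0, hA, hB, hAB⟩ := exists_limits ha ha2 hS hM
  set Y := (X.image fun x => x.1.1).filter (· ≤ -2) with hY
  have hY2 : ∀ x ∈ Y, x ≤ -2 := fun x hx => (Finset.mem_filter.1 hx).2
  have hTY : ∀ x ∈ Y, T (x, 0) ≤ ENNReal.ofReal (A (x - 1) + A x) := fun x hx =>
    hT M x (hY2 x hx) _ (hA.mono fun m hm => add_le_add (hm _) (hm _))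
  -- The vertex (-1, 0), for which the comparison with inner faces is not available, is bounded by 1
  -- and paid for by the constant 1 in the boundary relation.
  have hXY : ∑ x ∈ X, T x ≤ 1 + ∑ x ∈ Y, ENNReal.ofReal (A (x - 1) + A x) := by
    calc ∑ x ∈ X, T x = ∑ x ∈ X.image (fun x => x.1.1), T (x, 0) := by
          rw [Finset.sum_image]
          · refine Finset.sum_congr rfl fun x _ => ?_
            congr 1
            exact Prod.ext rfl x.2.1
          · intro x _ y _ hxy
            exact Subtype.ext (Prod.ext hxy (x.2.1.trans y.2.1.symm))
      _ ≤ ∑ x ∈ insert (-1) Y, T (x, 0) := by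
          refine Finset.sum_le_sum_of_subset fun x hx => ?_
          have hx' := hx
          rw [Finset.mem_image] at hx
          obtain ⟨y, -, rfl⟩ := hx
          have := y.2.2
          rw [Finset.mem_insert, hY, Finset.mem_filter]
          by_cases hy : y.1.1 ≤ -2
          · exact Or.inr ⟨hx', hy⟩
          · exact Or.inl (by omega)
      _ = T (-1, 0) + ∑ x ∈ Y, T (x, 0) := Finset.sum_insert fun h => by
          have := hY2 _ h
          omega
      _ ≤ _ := add_le_add (hT1 _) (Finset.sum_le_sum hTY)
  set Z := Y ∪ Y.image fun x => x - 1 with hZ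
  have hsum : ∑ x ∈ Y, (A (x - 1) + A x) ≤ 2 * ∑ x ∈ Z, A x := by
    rw [Finset.sum_add_distrib]
    have h1 : ∑ x ∈ Y, A x ≤ ∑ x ∈ Z, A x :=
      Finset.sum_le_sum_of_subset_of_nonneg Finset.subset_union_left fun x _ _ => hA0 x
    have h2 : ∑ x ∈ Y, A (x - 1) ≤ ∑ x ∈ Z, A x := by
      rw [← Finset.sum_image (g := fun x : ℤ => x - 1) fun x _ y _ hxy => by simpa using hxy]
      exact Finset.sum_le_sum_of_subset_of_nonneg Finset.subset_union_right fun x _ _ => hA0 x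
    linarith
  have hmain := hAB Z fun x hx => by
    rcases Finset.mem_union.1 hx with hx | hx
    · exact hY2 x hx
    · obtain ⟨y, hy, rfl⟩ := Finset.mem_image.1 hx
      have := hY2 y hy
      omega
  have hphi : ENNReal.ofReal (∑ e ∈ bdryEdges n S K M, B e.1) ≤ phiBar p q n S := by
    rw [ENNReal.ofReal_sum_of_nonneg fun e _ => hB0 e.1, phiBar,
      tsum_subtype (edgeBdry n S) fun e => liminf (fun m =>
        ENNReal.ofReal (condProb (rect n m) p q (evConn n m S e.1) (evS n m S))) (rectFilter n S)]
    refine le_trans (Finset.sum_le_sum fun e he => ?_) (ENNReal.sum_le_tsum (bdryEdges n S K M))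
    rw [Set.indicator_of_mem (bdryEdges_subset he)]
    have hm := mem_bdryEdges.1 he
    exact h.le_liminf hS hpos hm.2.2.1 hm.1.1.1.1 hm.1.1.1.2 hm.1.1.2
      (hB.mono fun m hb => hb _ hm.1.1.1.1)
  calc ∑ x ∈ X, T x ≤ ENNReal.ofReal 1 + ENNReal.ofReal (∑ x ∈ Y, (A (x - 1) + A x)) := by
        rw [ENNReal.ofReal_one, ENNReal.ofReal_sum_of_nonneg fun x _ => add_nonneg (hA0 _) (hA0 _)]
        exact hXY
    _ = ENNReal.ofReal (1 + ∑ x ∈ Y, (A (x - 1) + A x)) :=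
        (ENNReal.ofReal_add zero_le_one
          (Finset.sum_nonneg fun x _ => add_nonneg (hA0 _) (hA0 _))).symm
    -- Each face serves at most two vertices, so the left side is at most 1 + 2 Σ A, which is at
    -- most 4 (1 + ½ Σ A).
    _ ≤ ENNReal.ofReal (4 * (∑ e ∈ bdryEdges n S K M, B e.1 + C / M)) := by
        refine ENNReal.ofReal_le_ofReal ?_
        have : (n + 1) * ((2 * a ^ 2) ^ (n + 1) / M) = C / M := by rw [hC]; ring
        rw [this] at hmain
        linarith
    _ = 4 * (ENNReal.ofReal (∑ e ∈ bdryEdges n S K M, B e.1) + ENNReal.ofReal (C / M)) := by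
        rw [ENNReal.ofReal_mul (by norm_num), ENNReal.ofReal_add
          (Finset.sum_nonneg fun e _ => hB0 _) (by positivity)]
        norm_num
    _ ≤ _ := by gcongr

/-! ### Many incomplete columns -/

/-- The column starts in S at the bottom, so its first missing vertex gives a boundary edge reached
by a vertical segment inside S. -/
theorem exists_bdry_of_column (hL : bdryLeft n ⊆ S) {k : ℤ} (hk : k < 0)
    (hbad : ∃ y : ℤ, 0 ≤ y ∧ y ≤ n ∧ (k, y) ∉ S) :
    ∃ j : ℕ, j < n ∧ (∀ i : ℕ, i ≤ j → (k, (i : ℤ)) ∈ S) ∧ (k, (j : ℤ) + 1) ∉ S := by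
  classical
  have hex : ∃ i : ℕ, (k, (i : ℤ)) ∉ S := by
    obtain ⟨y, hy, -, hS⟩ := hbad
    exact ⟨y.toNat, by rwa [Int.toNat_of_nonneg hy]⟩
  have hle : Nat.find hex ≤ n := by
    obtain ⟨y, hy, hyn, hS⟩ := hbad
    refine (Nat.find_min' hex (m := y.toNat) (by rwa [Int.toNat_of_nonneg hy])).trans (by omega)
  have h0 : Nat.find hex ≠ 0 := fun h => by
    have := Nat.find_spec hex
    rw [h] at this
    exact this (hL ⟨Or.inl rfl, hk⟩)
  obtain ⟨j, hj⟩ := Nat.exists_eq_succ_of_ne_zero h0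
  refine ⟨j, by omega, fun i hi => ?_, ?_⟩
  · have := Nat.find_min hex (m := i) (by omega)
    rwa [not_not] at this
  · have := Nat.find_spec hex
    rw [hj] at this
    push_cast at this
    exact this

/-- It suffices that the vertical segment up to height `j` is open; its fewer than n edges lie in S,
where the conditioning has no direct effect. -/
theorem SupDual.column_le_condProb (h : SupDual a p q) (hR : Disjoint S (bdryRight n)) {k : ℤ}
    (hk : k < 0) (hkm : -(m : ℤ) ≤ k) {j : ℕ} (hj : j < n)
    (hjS : ∀ i : ℕ, i ≤ j → (k, (i : ℤ)) ∈ S) (hm : Possible n m S) :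
    (1 / (1 + a)) ^ n ≤ condProb (rect n m) p q (evConn n m S (k, (j : ℤ))) (evS n m S) := by
  classical
  have ha := h.one_le
  have hrect : ∀ i : ℕ, i ≤ j → (k, (i : ℤ)) ∈ rect n m := fun i hi => by
    rw [mem_rect]
    simp only
    omega
  set Q : Finset (Sym2 (ℤ × ℤ)) :=
    (Finset.range j).image fun i : ℕ => s((k, (i : ℤ)), (k, (i : ℤ) + 1)) with hQ
  have hmem : ∀ e ∈ Q, ∃ i : ℕ, i < j ∧ s((k, (i : ℤ)), (k, (i : ℤ) + 1)) = e := fun e he => by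
    simpa [hQ] using he
  have hcard : Q.card ≤ n := by
    refine Finset.card_image_le.trans ?_
    rw [Finset.card_range]
    exact hj.le
  refine le_trans ?_ (h.pow_le_condProb (Q := Q) (fun e he => ?_) (fun u w ω he => ?_) hm
    fun ω hω => ?_)
  · refine pow_le_pow_of_le_one (by positivity) ?_ hcard
    rw [div_le_one (by positivity)]
    linarith
  · obtain ⟨i, hi, rfl⟩ := hmem e he
    have := hrect (i + 1) hi
    push_cast at this
    exact mem_edges.2 ⟨hrect i hi.le, this, by simp [lattice]⟩
  · obtain ⟨i, hi, hie⟩ := hmem _ he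
    rw [← hie]
    have := hjS (i + 1) hi
    push_cast at this
    exact insert_mem_evS hR (hjS i hi.le) this ω
  · have hcol : ∀ i : ℕ, i ≤ j → ConnIn ω (S ∩ rect n m) (k, 0) (k, (i : ℤ)) := by
      intro i
      induction i with
      | zero => exact fun _ => SimpleGraph.Reachable.refl _
      | succ i ih =>
        intro hi
        have h1 := hrect (i + 1) hi
        have h2 := hjS (i + 1) hi
        push_cast at h1 h2 ⊢
        refine SimpleGraph.Reachable.trans (ih (by omega)) (SimpleGraph.Adj.reachable
          (connIn_adj.2 ⟨hω ?_, ⟨hjS i (by omega), hrect i (by omega)⟩, ⟨h2, h1⟩, by simp⟩))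
        exact Finset.mem_image.2 ⟨i, Finset.mem_range.2 hi, rfl⟩
    exact ⟨(k, 0), ⟨Or.inl rfl, hk⟩, hrect 0 (Nat.zero_le j), hcol j le_rfl⟩

/-- If infinitely many columns on the left are incomplete, then the boundary-connection function is
infinite. -/
theorem SupDual.phiBar_eq_top (h : SupDual a p q) (hL : bdryLeft n ⊆ S)
    (hR : Disjoint S (bdryRight n))
    (hinf : {k : ℤ | k < 0 ∧ ∃ y : ℤ, 0 ≤ y ∧ y ≤ n ∧ (k, y) ∉ S}.Infinite) :
    phiBar p q n S = ⊤ := by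
  have ha := h.one_le
  set bad := {k : ℤ | k < 0 ∧ ∃ y : ℤ, 0 ≤ y ∧ y ≤ n ∧ (k, y) ∉ S} with hbad
  have hinf' : Infinite bad := hinf.to_subtype
  choose j hj using fun k : bad => exists_bdry_of_column hL k.2.1 k.2.2
  let e : bad → edgeBdry n S := fun k => ⟨((k, (j k : ℤ)), (k, (j k : ℤ) + 1)),
    by simp [lattice], ⟨by simp, by have := (hj k).1; simp only; omega⟩,
    ⟨by simp only; omega, by have := (hj k).1; simp only; omega⟩, (hj k).2.1 _ le_rfl, (hj k).2.2⟩
  have he : Function.Injective e := fun k l hkl => by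
    have := congrArg (fun x => x.1.1.1) hkl
    exact Subtype.ext this
  rw [eq_top_iff]
  have hδ : ENNReal.ofReal ((1 / (1 + a)) ^ n) ≠ 0 := by
    rw [Ne, ENNReal.ofReal_eq_zero, not_le]
    positivity
  rw [← ENNReal.tsum_const_eq_top_of_ne_zero (α := bad) hδ]
  -- Different columns provide different boundary edges, so infinitely many terms are bounded below
  -- by one positive constant.
  refine le_trans (ENNReal.tsum_le_tsum fun k => ?_)
    (ENNReal.tsum_comp_le_tsum_of_injective he _)
  refine le_liminf_of_le (by isBoundedDefault) ?_
  filter_upwards [show ∀ᶠ m in rectFilter n S, (-(k : ℤ)).toNat ≤ m from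
      (eventually_ge_atTop _).filter_mono inf_le_left,
    show ∀ᶠ m in rectFilter n S, Possible n m S from
      Filter.mem_inf_of_right (Filter.mem_principal_self _)] with m hm1 hm2
  exact ENNReal.ofReal_le_ofReal
    (h.column_le_condProb hR k.2.1 (by omega) (hj k).1 (hj k).2.1 hm2)

theorem exists_isStripSet (hn : 1 ≤ n) (hL : bdryLeft n ⊆ S) (hR : Disjoint S (bdryRight n))
    (hfin : {k : ℤ | k < 0 ∧ ∃ y : ℤ, 0 ≤ y ∧ y ≤ n ∧ (k, y) ∉ S}.Finite) :
    ∃ K, IsStripSet n S K := by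
  obtain ⟨b, hb⟩ := hfin.bddBelow
  refine ⟨b.natAbs + 1, hn, hL, hR, fun x y hx h0 h1 => ?_⟩
  by_contra hS
  have := hb (show x ∈ _ from ⟨by omega, y, h0, h1, hS⟩)
  omega

end

end FKStrip

end

theorem lemma4p3 (q : ℝ) (hq1 : 1 ≤ q) (hq4 : q ≤ 4) :
    ∃ c : ℝ≥0, 0 < c ∧ ∀ p : ℝ, √q / (1 + √q) ≤ p → p < 1 →
      ∀ n : ℕ, 1 ≤ n → ∀ S : Set (ℤ × ℤ), S ⊆ FKStrip.strip n →
        FKStrip.bdryLeft n ⊆ S → Disjoint S (FKStrip.bdryRight n) →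
        (∃ᶠ m in atTop, FKStrip.Possible n m S) →
          (c : ℝ≥0∞) * ∑' x : FKStrip.bdryBottomLeft, FKStrip.dualConnCond p q n S x
              ≤ FKStrip.phiBar p q n S ∧
          (c : ℝ≥0∞) * ∑' x : FKStrip.bdryBottomLeft, FKStrip.dualConn p q n x
              ≤ FKStrip.phiBar p q n S := by
  refine ⟨1 / 4, by norm_num, fun p hp hp1 n hn S _ hL hR hpos => ?_⟩
  have hsq : √q ^ 2 = q := Real.sq_sqrt (by linarith)
  have h1 : 1 ≤ √q := Real.one_le_sqrt.2 hq1
  have h2 : √q ≤ 2 := Real.sqrt_le_iff.2 ⟨by norm_num, by linarith⟩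
  have h : FKStrip.SupDual (√q) p q := ⟨h1, hsq, (div_le_iff₀ (by linarith)).1 hp, hp1⟩
  -- The domain argument needs complete columns far to the left; in the other case the left-hand
  -- side is infinite.
  by_cases hinf : {k : ℤ | k < 0 ∧ ∃ y : ℤ, 0 ≤ y ∧ y ≤ n ∧ (k, y) ∉ S}.Infinite
  · rw [h.phiBar_eq_top hL hR hinf]
    exact ⟨le_top, le_top⟩
  obtain ⟨K, hS⟩ := FKStrip.exists_isStripSet hn hL hR (Set.not_infinite.1 hinf)
  have hquarter : ∀ s : ℝ≥0∞, s ≤ 4 * FKStrip.phiBar p q n S →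
      ((1 / 4 : ℝ≥0) : ℝ≥0∞) * s ≤ FKStrip.phiBar p q n S := by
    intro s hs
    have h4 : ((1 / 4 : ℝ≥0) : ℝ≥0∞) * 4 = 1 := by
      rw [show (4 : ℝ≥0∞) = ((4 : ℝ≥0) : ℝ≥0∞) from rfl, ← ENNReal.coe_mul]
      norm_num
    calc _ ≤ ((1 / 4 : ℝ≥0) : ℝ≥0∞) * (4 * FKStrip.phiBar p q n S) := by gcongr
      _ = _ := by rw [← mul_assoc, h4, one_mul]
  have hlarge : ∀ x : ℤ, ∀ᶠ m : ℕ in atTop, -(m : ℤ) < x := fun x => by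
    filter_upwards [eventually_ge_atTop (x.natAbs + 1)] with m hm
    omega
  refine ⟨hquarter _ (h.tsum_le h2 hS hpos (fun x => ?_) fun M x hx r hr => ?_),
    hquarter _ (h.tsum_le h2 hS hpos (fun x => ?_) fun M x hx r hr => ?_)⟩
  · refine limsup_le_of_le (by isBoundedDefault) (Eventually.of_forall fun m => ?_)
    exact ENNReal.ofReal_le_one.2 h.condProb_le_one
  · refine limsup_le_of_le (by isBoundedDefault) ?_
    filter_upwards [show ∀ᶠ m in FKStrip.rectFilter n S, _ from hr.filter_mono inf_le_left,
      show ∀ᶠ m in FKStrip.rectFilter n S, _ from (hlarge x).filter_mono inf_le_left,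
      show ∀ᶠ m in FKStrip.rectFilter n S, FKStrip.Possible n m S from
        Filter.mem_inf_of_right (Filter.mem_principal_self _)] with m hm1 hm2 hm3
    exact ENNReal.ofReal_le_ofReal ((h.condProb_evDual_le hn
      (fun u w ω he => FKStrip.evS_dom (M := M) hR u w ω he) hm3 hx hm2).trans hm1)
  · refine limsup_le_of_le (by isBoundedDefault) (Eventually.of_forall fun m => ?_)
    rw [FKStrip.prob_eq_condProb h.pos hp1 h.q_pos]
    exact ENNReal.ofReal_le_one.2 h.condProb_le_one
  · refine limsup_le_of_le (by isBoundedDefault) ?_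
    filter_upwards [hr, hlarge x] with m hm1 hm2
    rw [FKStrip.prob_eq_condProb h.pos hp1 h.q_pos]
    exact ENNReal.ofReal_le_ofReal ((h.condProb_evDual_le (S := S) (M := M) (C := Set.univ) hn
      (fun u w ω _ => by simp) ⟨∅, Finset.empty_subset _, Set.mem_univ _⟩ hx hm2).trans hm1)
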